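/- Let $n\ge 3$ and let $T$ be a finite simplicial triangulation of the closed disk with vertex set $V$, whose boundary is the cycle with vertices $v_1,\dots,v_n$ (in this cyclic order; all other vertices are interior). Let $\Omega$ be a compact convex polygon with $n$ vertices $\phi(v_1),\dots,\phi(v_n)$ in cyclic order along its boundary (all of them genuine corners, i.e. extreme points of $\Omega$), where either (a) $\Omega$ lies in the hyperbolic plane, or (b) $\Omega$ lies in an open hemisphere of the unit sphere $S^2$, and sides, convexity and line segments are meant with respect to the (shortest) geodesics of the respective geometry. A geodesic triangulation of $\Omega$ with combinatorial type $T$ is an embedding of the $1$-skeleton of $T$ into $\Omega$ that agrees with $\phi$ on $v_1,\dots,v_n$ and maps every edge to a geodesic segment parametrized proportionally to arc length; it is determined by the positions of the vertices. Let $X(\Omega,T)$ be the set of all of them, with the topology induced by the vertex positions, that is, as a subspace of $\Omega^{V}$. Then in both cases $X(\Omega,T)$ is contractible (in particular non-empty). -/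

import Mathlib

/-! ### Triangulations of a disk -/

/-- The edges of a family of triangles `F`: the two-element subsets of members of `F`. -/
def edgesOf {V : Type*} [Fintype V] [DecidableEq V] (F : Finset (Finset V)) :
    Finset (Finset V) :=
  {e : Finset V | e.card = 2 ∧ ∃ f ∈ F, e ⊆ f}

/-- The 1-skeleton of a family of triangles, as a graph on the vertices. -/
def skeletonOf {V : Type*} [Fintype V] [DecidableEq V] (F : Finset (Finset V)) :
    SimpleGraph V where
  Adj v w := v ≠ w ∧ {v, w} ∈ edgesOf F
  symm := ⟨fun v w h => ⟨h.1.symm, by rw [Finset.pair_comm]; exact h.2⟩⟩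
  loopless := ⟨fun _ h => h.1 rfl⟩

/-- The link of a vertex `v`: its edges are the sides opposite to `v` of the triangles at `v`. -/
def linkOf {V : Type*} [Fintype V] [DecidableEq V] (F : Finset (Finset V)) (v : V) :
    SimpleGraph V where
  Adj w x := w ≠ x ∧ {v, w, x} ∈ F
  symm := ⟨fun w x h => ⟨h.1.symm, by rw [Finset.pair_comm]; exact h.2⟩⟩
  loopless := ⟨fun _ h => h.1 rfl⟩

/-- A (simplicial) triangulation of a closed disk with vertex set `V`, whose boundary is the cycle
`bd 0, bd 1, …, bd (n - 1)`. It is given combinatorially: a finite pure two-dimensional simplicial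
complex that is a connected surface with boundary (an edge lies in one triangle if it is a
boundary edge and in two otherwise, and the link of every vertex is connected, hence a path or a
cycle), has exactly one boundary cycle, and has Euler characteristic `1`. By the classification of
compact surfaces these are exactly the triangulations of the disk. -/
structure DiskTriangulation (V : Type*) [Fintype V] [DecidableEq V] (n : ℕ) [NeZero n] where
  /-- the triangles -/
  faces : Finset (Finset V)
  /-- the boundary vertices in cyclic order -/
  bd : Fin n → V
  three_le : 3 ≤ n
  card_face : ∀ f ∈ faces, f.card = 3
  exists_face : ∀ v, ∃ f ∈ faces, v ∈ f
  bd_injective : Function.Injective bd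
  bd_edge : ∀ i, (faces.filter fun f => {bd i, bd (i + 1)} ⊆ f).card = 1
  int_edge : ∀ e ∈ edgesOf faces, (∀ i, e ≠ {bd i, bd (i + 1)}) →
    (faces.filter fun f => e ⊆ f).card = 2
  link_connected : ∀ v w x, (skeletonOf faces).Adj v w → (skeletonOf faces).Adj v x →
    (linkOf faces v).Reachable w x
  connected : (skeletonOf faces).Connected
  euler : (Fintype.card V : ℤ) - (edgesOf faces).card + faces.card = 1

/-! ### Geodesic segments and convex polygons

`M` is a surface and `d` its intrinsic (Riemannian) distance function. -/

/-- The geodesic segment from `x` to `y`: the points that lie metrically between `x` and `y`. In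
the hyperbolic plane, and for non-antipodal points of the round sphere, this is the image of the
unique shortest geodesic from `x` to `y`. -/
def geodesicSegment {M : Type*} (d : M → M → ℝ) (x y : M) : Set M :=
  {z | d x z + d z y = d x y}

/-- `φ 0, …, φ (n - 1)` are, in cyclic order, the vertices of a convex polygon with `n` sides
that bounds the region `Ω`: the sides form an embedded closed curve, this curve is the boundary
of the compact region `Ω`, the region is geodesically convex, and its vertices are genuine corners
(extreme points of `Ω`). -/
structure IsConvexPolygon {M : Type*} [TopologicalSpace M] (d : M → M → ℝ) {n : ℕ} [NeZero n]
    (Ω : Set M) (φ : Fin n → M) : Prop where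
  three_le : 3 ≤ n
  injective : Function.Injective φ
  embedded : ∀ i j, i ≠ j →
    geodesicSegment d (φ i) (φ (i + 1)) ∩ geodesicSegment d (φ j) (φ (j + 1)) ⊆
      {φ i, φ (i + 1)} ∩ {φ j, φ (j + 1)}
  isCompact : IsCompact Ω
  frontier_eq : frontier Ω = ⋃ i, geodesicSegment d (φ i) (φ (i + 1))
  convex : ∀ x ∈ Ω, ∀ y ∈ Ω, geodesicSegment d x y ⊆ Ω
  extreme : ∀ i, ∀ x ∈ Ω, ∀ y ∈ Ω, φ i ∈ geodesicSegment d x y → φ i = x ∨ φ i = y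

/-! ### The space of geodesic triangulations -/

/-- The space of geodesic triangulations of the polygon `(Ω, φ)` with combinatorial type `T`. A
point of it is a placement `p` of the vertices in `Ω` that agrees with `φ` on the boundary
vertices and for which drawing every edge as the geodesic segment between its endpoints embeds the
1-skeleton of `T`: distinct vertices have distinct positions and distinct edges meet only in their
common vertices. The topology is the one of the vertex positions, the boundary ones being fixed. -/
def GeodesicTriangulations {M : Type*} (d : M → M → ℝ) {n : ℕ} [NeZero n] (Ω : Set M)
    (φ : Fin n → M) {V : Type*} [Fintype V] [DecidableEq V] (T : DiskTriangulation V n) :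
    Set (V → M) :=
  {p | (∀ v, p v ∈ Ω) ∧ (∀ i, p (T.bd i) = φ i) ∧ Function.Injective p ∧
    ∀ u v x y, (skeletonOf T.faces).Adj u v → (skeletonOf T.faces).Adj x y → s(u, v) ≠ s(x, y) →
      geodesicSegment d (p u) (p v) ∩ geodesicSegment d (p x) (p y) ⊆ p '' ({u, v} ∩ {x, y})}

/-! ### The hyperbolic plane and the round sphere -/

/-- The hyperbolic distance on the upper half-plane, the model of the hyperbolic plane. -/
noncomputable def hyperbolicDist (x y : UpperHalfPlane) : ℝ := dist x y

/-- The unit sphere in Euclidean three-space. -/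
abbrev UnitSphere : Type := Metric.sphere (0 : EuclideanSpace ℝ (Fin 3)) 1

/-- The intrinsic (great-circle) distance on the unit sphere. -/
noncomputable def sphericalDist (x y : UnitSphere) : ℝ :=
  InnerProductGeometry.angle (x : EuclideanSpace ℝ (Fin 3)) (y : EuclideanSpace ℝ (Fin 3))

/-- The open hemisphere centred at `c`. -/
def openHemisphere (c : UnitSphere) : Set UnitSphere :=
  {x | 0 < inner ℝ (c : EuclideanSpace ℝ (Fin 3)) (x : EuclideanSpace ℝ (Fin 3))}

/-!
The space of geodesic triangulations is a retract of a convex set, by Tutte's embedding theorem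
and its converse.

*Reduction to the plane.* Both geometries have projective charts: the Klein model of the
hyperbolic plane, here the region above a parabola (`kleinChart`), and the central projection of a
hemisphere (`Gnomonic.chart`). They map geodesic segments to straight segments, hence `Ω` to a
convex plane polygon and geodesic triangulations to straight-line triangulations
(`IsProjectiveChart.contractibleSpace_geodesicTriangulations`).

*The retraction.* Give every ordered pair of vertices a positive weight. There is a unique
placement of the vertices that extends `φ` and puts every interior vertex at the weighted mean of
its neighbours (`tutteMap`), it depends continuously on the weights, and it is a straight-line
triangulation (`tutteMap_mem`, Tutte's theorem). Conversely, every straight-line triangulation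
comes from some weights (`exists_isBalanced_of_mem`). The weights that belong to a given
triangulation form a convex set and can be continued locally, so a partition of unity glues local
choices to a continuous section of `tutteMap` (`contractibleSpace_planeTriangulations`).

*Tutte's theorem.* For a linear form `h` on the plane, the composite with the placement satisfies
the maximum principle at the interior vertices and is unimodal along the boundary. Ties are broken
by a labelling of the vertices in which every interior vertex on whose neighbours `h` is constant
has a neighbour with a smaller and one with a larger label; such labellings are built ear by ear,
as the 1-skeleton has no cut vertex (`exists_isBipolar_univ`). Counting the sign changes at all
vertices by triangles, and comparing with the Euler characteristic, shows that there are no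
saddles (`changes_le`). But if a triangle were degenerate, or if the two triangles at an edge were
on the same side of it, then for a suitable `h` some choice of the labelling would have a saddle
(`IsTutte.not_const`, `IsTutte.lt_of_lt`). So the placement does not fold
(`IsBalanced.isUnfolded`). It is then an embedding: counting the edges above a point, with the
sign with which a vertical ray crosses them, shows that the point lies in at most one open
triangle (`IsTiling.face_eq_of_inTri`).

*Existence of weights.* In a straight-line triangulation each interior vertex lies in the interior
of the convex hull of its neighbours, since its triangles do not fold: an edge with both triangles
on the same side would put a vertex of one of them into the other or make two sides cross
(`isUnfolded_of_mem`, `IsUnfolded.exists_cone`).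
-/

open Topology

/-! ### Incidences in a disk triangulation -/

theorem Fin.val_one_of_three_le {n : ℕ} [NeZero n] (hn : 3 ≤ n) : ((1 : Fin n) : ℕ) = 1 := by
  rw [Fin.val_one']; exact Nat.mod_eq_of_lt (by omega)

theorem Fin.add_one_ne_self {n : ℕ} [NeZero n] (hn : 3 ≤ n) (i : Fin n) : i + 1 ≠ i := by
  intro h
  have h1 := congrArg Fin.val (add_eq_left.1 h)
  rw [Fin.val_one_of_three_le hn] at h1
  simp at h1

theorem Fin.add_one_add_one_ne_self {n : ℕ} [NeZero n] (hn : 3 ≤ n) (i : Fin n) :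
    i + 1 + 1 ≠ i := by
  intro h
  rw [add_assoc] at h
  have h1 := congrArg Fin.val (add_eq_left.1 h)
  rw [Fin.val_add, Fin.val_one_of_three_le hn, Nat.mod_eq_of_lt (by omega)] at h1
  simp at h1

namespace DiskTriangulation

variable {V : Type*} [Fintype V] [DecidableEq V] {n : ℕ} [NeZero n] (T : DiskTriangulation V n)

/-- A vertex is interior if it is not on the boundary cycle. -/
def IsInterior (v : V) : Prop := ∀ i, T.bd i ≠ v

/-- A boundary edge, as a set of two vertices. -/
def IsBdEdge (e : Finset V) : Prop := ∃ i, e = {T.bd i, T.bd (i + 1)}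

/-- Adjacency in the 1-skeleton. -/
abbrev Adj (v w : V) : Prop := (skeletonOf T.faces).Adj v w

variable {T}

theorem face_ne {a b c : V} (h : {a, b, c} ∈ T.faces) : a ≠ b ∧ a ≠ c ∧ b ≠ c := by
  have h3 := T.card_face _ h
  refine ⟨?_, ?_, ?_⟩ <;> rintro rfl
  · have := Finset.card_le_two (a := a) (b := c)
    simp at h3; omega
  · have := Finset.card_le_two (a := a) (b := b)
    rw [Finset.insert_comm] at h3
    simp at h3; have := Finset.card_le_two (a := b) (b := a); omega
  · have := Finset.card_le_two (a := a) (b := b)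
    simp at h3; omega

theorem exists_third {f : Finset V} (hf : f ∈ T.faces) {v w : V} (hv : v ∈ f) (hw : w ∈ f)
    (hvw : v ≠ w) : ∃ x, f = {v, w, x} := by
  obtain ⟨a, b, c, hab, hac, hbc, rfl⟩ := Finset.card_eq_three.1 (T.card_face f hf)
  simp only [Finset.mem_insert, Finset.mem_singleton] at hv hw
  rcases hv with rfl | rfl | rfl <;> rcases hw with rfl | rfl | rfl
  · exact absurd rfl hvw
  · exact ⟨c, rfl⟩
  · exact ⟨b, by ext; simp; tauto⟩
  · exact ⟨c, by ext; simp; tauto⟩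
  · exact absurd rfl hvw
  · exact ⟨a, by ext; simp; tauto⟩
  · exact ⟨b, by ext; simp; tauto⟩
  · exact ⟨a, by ext; simp; tauto⟩
  · exact absurd rfl hvw

theorem exists_eq_insert {f : Finset V} (hf : f ∈ T.faces) {v : V} (hv : v ∈ f) :
    ∃ w x, f = {v, w, x} := by
  obtain ⟨w, hw, hwv⟩ := Finset.exists_mem_ne (by rw [T.card_face f hf]; norm_num) v
  obtain ⟨x, hx⟩ := exists_third hf hv hw hwv.symm
  exact ⟨w, x, hx⟩

theorem pair_mem_edgesOf {v w : V} :
    {v, w} ∈ edgesOf T.faces ↔ v ≠ w ∧ ∃ f ∈ T.faces, v ∈ f ∧ w ∈ f := by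
  simp [edgesOf, Finset.insert_subset_iff]
  intro _ _ _ _
  constructor
  · rintro h rfl; simp at h
  · exact Finset.card_pair

theorem adj_iff {v w : V} : T.Adj v w ↔ v ≠ w ∧ ∃ f ∈ T.faces, v ∈ f ∧ w ∈ f := by
  change v ≠ w ∧ _ ↔ _
  rw [pair_mem_edgesOf]; tauto

theorem adj_iff_exists_third {v w : V} : T.Adj v w ↔ ∃ x, {v, w, x} ∈ T.faces := by
  rw [adj_iff]
  constructor
  · rintro ⟨h, f, hf, hv, hw⟩
    obtain ⟨x, rfl⟩ := exists_third hf hv hw h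
    exact ⟨x, hf⟩
  · rintro ⟨x, hx⟩
    exact ⟨(face_ne hx).1, _, hx, by simp, by simp⟩

theorem adj_of_mem {f : Finset V} (hf : f ∈ T.faces) {v w : V} (hv : v ∈ f) (hw : w ∈ f)
    (h : v ≠ w) : T.Adj v w := adj_iff.2 ⟨h, f, hf, hv, hw⟩

theorem link_adj_iff {v w x : V} : (linkOf T.faces v).Adj w x ↔ {v, w, x} ∈ T.faces :=
  ⟨fun h => h.2, fun h => ⟨(face_ne h).2.2, h⟩⟩

theorem exists_adj (v : V) : ∃ w, T.Adj v w := by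
  obtain ⟨f, hf, hv⟩ := T.exists_face v
  obtain ⟨w, x, rfl⟩ := exists_eq_insert hf hv
  exact ⟨w, adj_iff_exists_third.2 ⟨x, hf⟩⟩

theorem bd_adj (i : Fin n) : T.Adj (T.bd i) (T.bd (i + 1)) := by
  obtain ⟨f, hf⟩ := Finset.card_eq_one.1 (T.bd_edge i)
  have : f ∈ T.faces.filter fun f => {T.bd i, T.bd (i + 1)} ⊆ f := by rw [hf]; simp
  rw [Finset.mem_filter, Finset.insert_subset_iff, Finset.singleton_subset_iff] at this
  exact adj_of_mem this.1 this.2.1 this.2.2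
    fun h => Fin.add_one_ne_self T.three_le i (T.bd_injective h).symm

theorem IsInterior.not_isBdEdge {v w : V} (hv : T.IsInterior v) : ¬ T.IsBdEdge {v, w} := by
  rintro ⟨i, hi⟩
  have : v ∈ ({T.bd i, T.bd (i + 1)} : Finset V) := by rw [← hi]; simp
  rw [Finset.mem_insert, Finset.mem_singleton] at this
  rcases this with h | h
  · exact hv _ h.symm
  · exact hv _ h.symm

theorem bdEdge_injective : Function.Injective fun i => ({T.bd i, T.bd (i + 1)} : Finset V) := by
  intro i j h
  simp only at h
  by_contra hij
  have h1 : T.bd i ∈ ({T.bd j, T.bd (j + 1)} : Finset V) := by rw [← h]; simp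
  have h2 : T.bd j ∈ ({T.bd i, T.bd (i + 1)} : Finset V) := by rw [h]; simp
  simp only [Finset.mem_insert, Finset.mem_singleton, T.bd_injective.eq_iff] at h1 h2
  rcases h1 with h1 | h1
  · exact hij h1
  rcases h2 with h2 | h2
  · exact hij h2.symm
  · rw [h2] at h1
    exact Fin.add_one_add_one_ne_self T.three_le i h1.symm

/-- An edge that is not on the boundary lies in exactly two triangles. -/
theorem exists_other {v w c : V} (hc : {v, w, c} ∈ T.faces) (he : ¬ T.IsBdEdge {v, w}) :
    ∃ d, d ≠ c ∧ {v, w, d} ∈ T.faces ∧ ∀ x, {v, w, x} ∈ T.faces → x = c ∨ x = d := by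
  have hadj : T.Adj v w := adj_iff_exists_third.2 ⟨c, hc⟩
  have h2 := T.int_edge {v, w} hadj.2 (fun i hi => he ⟨i, hi⟩)
  have hmem : ∀ x, {v, w, x} ∈ T.faces →
      {v, w, x} ∈ T.faces.filter fun f => {v, w} ⊆ f := fun x hx => by
    rw [Finset.mem_filter]
    exact ⟨hx, by intro y; simp; tauto⟩
  have hinj : ∀ x y, {v, w, x} ∈ T.faces → ({v, w, x} : Finset V) = {v, w, y} → x = y := by
    intro x y hx h
    have : x ∈ ({v, w, y} : Finset V) := by rw [← h]; simp
    have h1 := face_ne hx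
    simp only [Finset.mem_insert, Finset.mem_singleton] at this
    rcases this with rfl | rfl | rfl
    · exact absurd rfl h1.2.1
    · exact absurd rfl h1.2.2
    · rfl
  obtain ⟨f, hf, hfc⟩ := Finset.exists_mem_ne (by rw [h2]; norm_num) ({v, w, c} : Finset V)
  rw [Finset.mem_filter, Finset.insert_subset_iff, Finset.singleton_subset_iff] at hf
  obtain ⟨d, rfl⟩ := exists_third hf.1 hf.2.1 hf.2.2 hadj.1
  refine ⟨d, fun h => hfc (by rw [h]), hf.1, fun x hx => ?_⟩
  by_contra! hcon
  have h3 : ({{v, w, x}, {v, w, c}, {v, w, d}} : Finset (Finset V)) ⊆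
      T.faces.filter fun f => {v, w} ⊆ f := by
    intro g hg
    simp only [Finset.mem_insert, Finset.mem_singleton] at hg
    rcases hg with rfl | rfl | rfl
    exacts [hmem _ hx, hmem _ hc, hmem _ hf.1]
  have h4 := Finset.card_le_card h3
  rw [h2, Finset.card_eq_three.2 ⟨_, _, _, ?_, ?_, ?_, rfl⟩] at h4
  · omega
  · exact fun h => hcon.1 (hinj _ _ hx h)
  · exact fun h => hcon.2 (hinj _ _ hx h)
  · exact fun h => hfc h.symm

/-- Double counting of the incidences of edges and triangles, combined with the Euler
characteristic. -/
theorem two_mul_card : 2 * Fintype.card V = T.faces.card + n + 2 := by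
  have hd := Finset.sum_card_bipartiteAbove_eq_sum_card_bipartiteBelow (s := edgesOf T.faces)
    (t := T.faces) (fun e f : Finset V => e ⊆ f)
  have hf : ∀ f ∈ T.faces, (Finset.bipartiteBelow (fun e f : Finset V => e ⊆ f)
      (edgesOf T.faces) f).card = 3 := by
    intro f hf
    have : Finset.bipartiteBelow (fun e f : Finset V => e ⊆ f) (edgesOf T.faces) f
        = f.powersetCard 2 := by
      ext e
      simp only [Finset.bipartiteBelow, edgesOf, Finset.mem_filter, Finset.mem_univ, true_and,
        Finset.mem_powersetCard]
      exact ⟨fun h => ⟨h.2, h.1.1⟩, fun h => ⟨⟨h.2, f, hf, h.1⟩, h.1⟩⟩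
    rw [this, Finset.card_powersetCard, T.card_face f hf]; rfl
  rw [Finset.sum_congr rfl hf, Finset.sum_const, smul_eq_mul] at hd
  set B : Finset (Finset V) := Finset.univ.image fun i => {T.bd i, T.bd (i + 1)} with hB
  have hBc : B.card = n := by
    rw [hB, Finset.card_image_of_injective _ bdEdge_injective]; simp
  have hBE : B ⊆ edgesOf T.faces := by
    intro e he
    obtain ⟨i, -, rfl⟩ := Finset.mem_image.1 he
    exact (bd_adj i).2
  have h1 : ∀ e ∈ B, (Finset.bipartiteAbove (fun e f : Finset V => e ⊆ f) T.faces e).card = 1 := by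
    intro e he
    obtain ⟨i, -, rfl⟩ := Finset.mem_image.1 he
    exact T.bd_edge i
  have h2 : ∀ e ∈ edgesOf T.faces \ B,
      (Finset.bipartiteAbove (fun e f : Finset V => e ⊆ f) T.faces e).card = 2 := by
    intro e he
    rw [Finset.mem_sdiff] at he
    exact T.int_edge e he.1 fun i hi => he.2 (Finset.mem_image.2 ⟨i, Finset.mem_univ _, hi.symm⟩)
  rw [← Finset.sum_sdiff hBE, Finset.sum_congr rfl h1, Finset.sum_congr rfl h2, Finset.sum_const,
    Finset.sum_const, Finset.card_sdiff_of_subset hBE, hBc, smul_eq_mul, smul_eq_mul] at hd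
  have := T.euler
  have hle := Finset.card_le_card hBE
  omega

/-- A nonempty set of vertices that is closed under adjacency is everything. -/
theorem eq_univ_of_closed {S : Set V} (hne : S.Nonempty)
    (hS : ∀ v ∈ S, ∀ w, T.Adj v w → w ∈ S) (v : V) : v ∈ S := by
  obtain ⟨u, hu⟩ := hne
  by_contra hv
  obtain ⟨p⟩ := T.connected.preconnected u v
  obtain ⟨d, -, h1, h2⟩ := p.exists_boundary_dart S hu hv
  exact h2 (hS _ h1 _ d.adj)

/-- Connectedness of the link of `a`, as the existence of a crossing edge. -/
theorem exists_link_boundary {a u w : V} {S : Set V} (hu : T.Adj a u) (hw : T.Adj a w)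
    (huS : u ∈ S) (hwS : w ∉ S) : ∃ s t, s ∈ S ∧ t ∉ S ∧ {a, s, t} ∈ T.faces := by
  obtain ⟨p⟩ := T.link_connected a u w hu hw
  obtain ⟨d, -, h1, h2⟩ := p.exists_boundary_dart S huS hwS
  exact ⟨_, _, h1, h2, link_adj_iff.1 d.adj⟩

/-- The 1-skeleton has no cut vertex, because links are connected. -/
theorem mem_of_closed_avoiding {a : V} {S : Set V} (hne : S.Nonempty) (haS : a ∉ S)
    (hS : ∀ v ∈ S, ∀ w, w ≠ a → T.Adj v w → w ∈ S) {v : V} (hv : v ≠ a) : v ∈ S := by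
  obtain ⟨u, hu⟩ := hne
  by_contra hvS
  -- both `S` and its complement minus `a` have a neighbour of `a`
  have hs : ∃ s ∈ S, T.Adj a s := by
    by_contra! hcon
    exact haS (eq_univ_of_closed ⟨u, hu⟩ (fun x hx w hw => hS x hx w
      (fun h => hcon x hx (h ▸ hw.symm)) hw) a)
  have hr : ∃ r, r ∉ S ∧ T.Adj a r := by
    by_contra! hcon
    have := eq_univ_of_closed (T := T) (S := {x | x ∉ S ∧ x ≠ a}) ⟨v, hvS, hv⟩
      (fun x hx w hw => ⟨fun hwS => hx.1 (hS w hwS x hx.2 hw.symm), fun h =>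
        hcon x hx.1 (h ▸ hw.symm)⟩) a
    exact this.2 rfl
  obtain ⟨s, hsS, hsa⟩ := hs
  obtain ⟨r, hrS, hra⟩ := hr
  obtain ⟨x, y, hx, hy, hxy⟩ := exists_link_boundary hsa hra hsS hrS
  have hne := face_ne hxy
  exact hy (hS x hx y hne.2.1.symm (adj_of_mem hxy (by simp) (by simp) hne.2.2))

theorem exists_walk_avoiding {a x y : V} (hx : x ≠ a) (hy : y ≠ a) :
    ∃ p : (skeletonOf T.faces).Walk x y, a ∉ p.support := by
  refine mem_of_closed_avoiding (T := T) (a := a)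
    (S := {y | ∃ p : (skeletonOf T.faces).Walk x y, a ∉ p.support}) ⟨x, .nil, ?_⟩ ?_ ?_ hy
  · simpa using hx.symm
  · rintro ⟨p, hp⟩
    exact hp p.end_mem_support
  · rintro v ⟨p, hp⟩ w hw hvw
    refine ⟨p.concat hvw, ?_⟩
    rw [SimpleGraph.Walk.support_concat]
    simp [hp, hw.symm]

end DiskTriangulation

/-! ### Counting sign changes -/

/-- If every vertex of `S` has degree two in `L` then the number of edges leaving `S` is even;
here in the form that there is never exactly one. -/
theorem SimpleGraph.exists_other_leaving_edge {V : Type*} [Fintype V] (L : SimpleGraph V)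
    {S : Set V} (hdeg : ∀ v ∈ S, ∃ x y, x ≠ y ∧ ∀ w, L.Adj v w ↔ w = x ∨ w = y)
    {s t : V} (hs : s ∈ S) (ht : t ∉ S) (hst : L.Adj s t) :
    ∃ s' t', s' ∈ S ∧ t' ∉ S ∧ L.Adj s' t' ∧ ¬ (s' = s ∧ t' = t) := by
  classical
  by_contra! hcon
  let H : SimpleGraph V :=
    { Adj := fun u w => L.Adj u w ∧ u ∈ S ∧ w ∈ S
      symm := ⟨fun u w h => ⟨h.1.symm, h.2.2, h.2.1⟩⟩
      loopless := ⟨fun u h => L.loopless.irrefl u h.1⟩ }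
  have hnone : ∀ v ∉ S, H.degree v = 0 := fun v hv => by
    rw [← H.card_neighborFinset_eq_degree, Finset.card_eq_zero, Finset.eq_empty_iff_forall_notMem]
    intro w hw
    rw [H.mem_neighborFinset] at hw
    exact hv hw.2.1
  have hs1 : H.degree s = 1 := by
    obtain ⟨x, y, hxy, h⟩ := hdeg s hs
    wlog hx : t = x generalizing x y
    · exact this y x hxy.symm (fun w => by rw [h, or_comm]) (((h t).1 hst).resolve_left hx)
    have hy : y ∈ S := by
      by_contra hy
      exact hxy ((hcon s y hs hy ((h y).2 (Or.inr rfl))).2.trans hx).symm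
    rw [← H.card_neighborFinset_eq_degree, Finset.card_eq_one]
    refine ⟨y, ?_⟩
    ext w
    rw [H.mem_neighborFinset, Finset.mem_singleton]
    constructor
    · rintro ⟨h1, -, h2⟩
      rcases (h w).1 h1 with rfl | rfl
      · exact absurd (hx ▸ h2) ht
      · rfl
    · rintro rfl
      exact ⟨(h _).2 (Or.inr rfl), hs, hy⟩
  obtain ⟨v, hvs, hv⟩ := H.exists_ne_odd_degree_of_exists_odd_degree s (by rw [hs1]; decide)
  by_cases hvS : v ∈ S
  · obtain ⟨x, y, hxy, h⟩ := hdeg v hvS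
    have hin : ∀ w, L.Adj v w → w ∈ S := fun w hw => by
      by_contra hwS
      exact hvs (hcon v w hvS hwS hw).1
    have h2 : H.degree v = 2 := by
      rw [← H.card_neighborFinset_eq_degree, Finset.card_eq_two]
      refine ⟨x, y, hxy, ?_⟩
      ext w
      rw [H.mem_neighborFinset, Finset.mem_insert, Finset.mem_singleton, ← h]
      exact ⟨fun hw => hw.1, fun hw => ⟨hw, hvS, hin w hw⟩⟩
    rw [h2] at hv
    exact absurd hv (by decide)
  · rw [hnone v hvS] at hv
    exact absurd hv (by decide)

theorem Finset.exists_sorted {V α : Type*} [DecidableEq V] [LinearOrder α] {k : V → α}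
    (hk : Function.Injective k) {f : Finset V}
    (hf : f.card = 3) : ∃ a b c, f = {a, b, c} ∧ k a < k b ∧ k b < k c := by
  obtain ⟨a, b, c, hab, hac, hbc, rfl⟩ := Finset.card_eq_three.1 hf
  rcases lt_or_gt_of_ne (hk.ne hab) with h1 | h1 <;> rcases lt_or_gt_of_ne (hk.ne hac) with h2 | h2
    <;> rcases lt_or_gt_of_ne (hk.ne hbc) with h3 | h3
  · exact ⟨a, b, c, rfl, h1, h3⟩
  · exact ⟨a, c, b, by ext; simp; tauto, h2, h3⟩
  · exact absurd (h1.trans h3) (not_lt.2 h2.le)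
  · exact ⟨c, a, b, by ext; simp; tauto, h2, h1⟩
  · exact ⟨b, a, c, by ext; simp; tauto, h1, h2⟩
  · exact absurd (h1.trans h2) (not_lt.2 h3.le)
  · exact ⟨b, c, a, by ext; simp; tauto, h3, h2⟩
  · exact ⟨c, b, a, by ext; simp; tauto, h3, h1⟩

theorem Finset.insert_pair_ne_of_lt {V α : Type*} [DecidableEq V] [LinearOrder α]
    {k : V → α} {v s t s' t' : V} (hs : k s < k v) (ht' : k v < k t')
    (hs' : k s' < k v) (ht : k v < k t) (h : ¬ (s' = s ∧ t' = t)) :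
    ({v, s, t} : Finset V) ≠ {v, s', t'} := by
  intro heq
  have h1 : s' ∈ ({v, s, t} : Finset V) := by rw [heq]; simp
  have h2 : t' ∈ ({v, s, t} : Finset V) := by rw [heq]; simp
  simp only [Finset.mem_insert, Finset.mem_singleton] at h1 h2
  refine h ⟨?_, ?_⟩
  · rcases h1 with rfl | rfl | rfl
    · exact absurd hs' (lt_irrefl _)
    · rfl
    · exact absurd hs' ht.le.not_gt
  · rcases h2 with rfl | rfl | rfl
    · exact absurd ht' (lt_irrefl _)
    · exact absurd ht' hs.le.not_gt
    · rfl

namespace DiskTriangulation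

variable {V : Type*} [Fintype V] [DecidableEq V] {n : ℕ} [NeZero n] {T : DiskTriangulation V n}
  {α : Type*} [LinearOrder α]

variable (T) in
/-- The number of triangles at `v` in which `v` is the middle vertex with respect to `k`; this is
the number of sign changes of `k - k v` along the link of `v`. -/
def changes (k : V → α) (v : V) : ℕ :=
  (T.faces.filter fun f => v ∈ f ∧ (∃ w ∈ f, k w < k v) ∧ ∃ x ∈ f, k v < k x).card

variable (T) in
/-- `v` has a neighbour where `k` is smaller. -/
def HasLower (k : V → α) (v : V) : Prop := ∃ w, T.Adj v w ∧ k w < k v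

variable (T) in
/-- `v` has a neighbour where `k` is larger. -/
def HasUpper (k : V → α) (v : V) : Prop := ∃ w, T.Adj v w ∧ k v < k w

theorem sum_changes {k : V → α} (hk : Function.Injective k) :
    ∑ v, T.changes k v = T.faces.card := by
  have hd := Finset.sum_card_bipartiteAbove_eq_sum_card_bipartiteBelow (s := Finset.univ)
    (t := T.faces) (fun (v : V) (f : Finset V) => v ∈ f ∧ (∃ w ∈ f, k w < k v) ∧ ∃ x ∈ f, k v < k x)
  refine hd.trans ?_
  rw [Finset.card_eq_sum_ones]
  refine Finset.sum_congr rfl fun f hf => ?_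
  obtain ⟨a, b, c, rfl, hab, hbc⟩ := Finset.exists_sorted hk (T.card_face f hf)
  rw [Finset.card_eq_one]
  refine ⟨b, ?_⟩
  ext v
  simp only [Finset.bipartiteBelow, Finset.mem_filter, Finset.mem_univ, true_and,
    Finset.mem_insert, Finset.mem_singleton, exists_eq_or_imp, exists_eq_left]
  constructor
  · rintro ⟨rfl | rfl | rfl, h1, h2⟩
    · rcases h1 with h1 | h1 | h1
      · exact absurd h1 (lt_irrefl _)
      · exact absurd h1 hab.le.not_gt
      · exact absurd h1 (hab.trans hbc).le.not_gt
    · rfl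
    · rcases h2 with h1 | h1 | h1
      · exact absurd h1 (hab.trans hbc).le.not_gt
      · exact absurd h1 hbc.le.not_gt
      · exact absurd h1 (lt_irrefl _)
  · rintro rfl
    exact ⟨Or.inr (Or.inl rfl), Or.inl hab, Or.inr (Or.inr hbc)⟩

theorem mem_changes {k : V → α} {v s t : V} (h : {v, s, t} ∈ T.faces) (hs : k s < k v)
    (ht : k v < k t) : {v, s, t} ∈ T.faces.filter fun f => v ∈ f ∧ (∃ w ∈ f, k w < k v) ∧
      ∃ x ∈ f, k v < k x :=
  Finset.mem_filter.2 ⟨h, by simp, ⟨s, by simp, hs⟩, ⟨t, by simp, ht⟩⟩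

theorem exists_change {k : V → α} (hk : Function.Injective k) {v : V} (h1 : T.HasLower k v)
    (h2 : T.HasUpper k v) : ∃ s t, {v, s, t} ∈ T.faces ∧ k s < k v ∧ k v < k t := by
  obtain ⟨w, hw, hwv⟩ := h1
  obtain ⟨x, hx, hxv⟩ := h2
  obtain ⟨s, t, hs, ht, hst⟩ := exists_link_boundary (S := {y | k y < k v}) hw hx hwv
    hxv.le.not_gt
  refine ⟨s, t, hst, hs, lt_of_le_of_ne (not_lt.1 ht) (hk.ne (face_ne hst).2.1)⟩

theorem one_le_changes {k : V → α} (hk : Function.Injective k) {v : V} (h1 : T.HasLower k v)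
    (h2 : T.HasUpper k v) : 1 ≤ T.changes k v := by
  obtain ⟨s, t, h, hs, ht⟩ := exists_change hk h1 h2
  exact Finset.card_pos.2 ⟨_, mem_changes h hs ht⟩

/-- The vertices of the link of `v` that are not on a boundary edge at `v` have degree two. -/
theorem link_degree_two {v w : V} (he : ¬ T.IsBdEdge {v, w}) (hvw : T.Adj v w) :
    ∃ x y, x ≠ y ∧ ∀ u, (linkOf T.faces v).Adj w u ↔ u = x ∨ u = y := by
  obtain ⟨c, hc⟩ := adj_iff_exists_third.1 hvw
  obtain ⟨d, hdc, hd, h⟩ := exists_other hc he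
  refine ⟨c, d, hdc.symm, fun u => ?_⟩
  rw [link_adj_iff]
  refine ⟨h u, ?_⟩
  rintro (rfl | rfl) <;> assumption

theorem two_le_changes {k : V → α} (hk : Function.Injective k) {v : V} (hv : T.IsInterior v)
    (h1 : T.HasLower k v) (h2 : T.HasUpper k v) : 2 ≤ T.changes k v := by
  obtain ⟨s, t, h, hs, ht⟩ := exists_change hk h1 h2
  obtain ⟨s', t', hs', ht', hst', hne⟩ := (linkOf T.faces v).exists_other_leaving_edge
    (S := {w | T.Adj v w ∧ k w < k v}) (fun w hw => link_degree_two hv.not_isBdEdge hw.1)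
    (s := s) (t := t) ⟨adj_iff_exists_third.2 ⟨t, h⟩, hs⟩ (fun hc => ht.le.not_gt hc.2)
    (link_adj_iff.2 h)
  rw [link_adj_iff] at hst'
  have hfn := face_ne hst'
  have ht'' : k v < k t' := by
    refine lt_of_le_of_ne (not_lt.1 fun hlt => ht' ⟨?_, hlt⟩) (hk.ne hfn.2.1)
    exact adj_of_mem hst' (by simp) (by simp) hfn.2.1
  rw [← Finset.card_pair (Finset.insert_pair_ne_of_lt hs ht'' hs'.2 ht hne)]
  refine Finset.card_le_card ?_
  rw [Finset.insert_subset_iff, Finset.singleton_subset_iff]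
  exact ⟨mem_changes h hs ht, mem_changes hst' hs'.2 ht''⟩

/-- The index count: if `k` has no interior local extremum, and one local maximum and one local
minimum on the boundary, then there are no saddles. -/
theorem changes_le {k : V → α} (hk : Function.Injective k)
    (hint : ∀ v, T.IsInterior v → T.HasLower k v ∧ T.HasUpper k v)
    (hmax : ∀ i j, ¬ T.HasUpper k (T.bd i) → ¬ T.HasUpper k (T.bd j) → i = j)
    (hmin : ∀ i j, ¬ T.HasLower k (T.bd i) → ¬ T.HasLower k (T.bd j) → i = j) (v : V) :
    T.changes k v ≤ 2 ∧ (¬ T.IsInterior v → T.changes k v ≤ 1) := by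
  classical
  let β : V → ℕ := fun v => if T.IsInterior v then 0 else 1
  let γ : V → ℕ := fun v => (if ¬ T.IsInterior v ∧ ¬ T.HasUpper k v then 1 else 0) +
    (if ¬ T.IsInterior v ∧ ¬ T.HasLower k v then 1 else 0)
  have hbd : ∀ v, ¬ T.IsInterior v → ∃ i, T.bd i = v := fun v hv => by
    unfold IsInterior at hv; push Not at hv; exact hv
  have hβ : ∑ v, β v = n := by
    have h1 : ∑ v, β v = ∑ v, if v ∈ Finset.univ.image T.bd then 1 else 0 := by
      refine Finset.sum_congr rfl fun v _ => ?_
      simp only [β, Finset.mem_image, Finset.mem_univ, true_and]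
      by_cases h : T.IsInterior v
      · rw [if_pos h, if_neg]; rintro ⟨i, hi⟩; exact h i hi
      · rw [if_neg h, if_pos (hbd v h)]
    rw [h1, Finset.sum_ite_mem, Finset.univ_inter, ← Finset.card_eq_sum_ones,
      Finset.card_image_of_injective _ T.bd_injective, Finset.card_univ, Fintype.card_fin]
  have hcard : ∀ P : V → Prop, (∀ i j, ¬ P (T.bd i) → ¬ P (T.bd j) → i = j) →
      (∑ v, if ¬ T.IsInterior v ∧ ¬ P v then 1 else 0) ≤ 1 := fun P hP => by
    rw [← Finset.card_filter, Finset.card_le_one]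
    intro a ha b hb
    simp only [Finset.mem_filter, Finset.mem_univ, true_and] at ha hb
    obtain ⟨i, rfl⟩ := hbd a ha.1
    obtain ⟨j, rfl⟩ := hbd b hb.1
    rw [hP i j ha.2 hb.2]
  have hγ : ∑ v, γ v ≤ 2 := by
    rw [Finset.sum_add_distrib]
    exact add_le_add (hcard _ hmax) (hcard _ hmin)
  have hle : ∀ v ∈ Finset.univ, 2 ≤ T.changes k v + β v + γ v := by
    intro v _
    by_cases hv : T.IsInterior v
    · have := two_le_changes hk hv (hint v hv).1 (hint v hv).2
      omega
    · by_cases h1 : T.HasLower k v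
      · by_cases h2 : T.HasUpper k v
        · have := one_le_changes hk h1 h2
          simp only [β, if_neg hv]
          omega
        · simp only [β, γ, if_neg hv, hv, h2, not_false_eq_true, and_self, if_true]
          omega
      · simp only [β, γ, if_neg hv, hv, h1, not_false_eq_true, and_self, if_true]
        omega
  have hsum : ∑ v, (T.changes k v + β v + γ v) ≤ ∑ _v : V, 2 := by
    rw [Finset.sum_add_distrib, Finset.sum_add_distrib, sum_changes hk, hβ, Finset.sum_const,
      Finset.card_univ, smul_eq_mul]
    have := T.two_mul_card
    omega
  have heq := (Finset.sum_eq_sum_iff_of_le hle).1 (le_antisymm (Finset.sum_le_sum hle) hsum) v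
    (Finset.mem_univ v)
  refine ⟨by omega, fun hv => ?_⟩
  have : β v = 1 := if_neg hv
  omega

end DiskTriangulation

/-! ### Orderings without local extrema -/

/-- The values of `g` on `U` are distinct, and every vertex of `U` outside `B` has, within `U`,
a neighbour with a smaller and a neighbour with a larger value of `g`. -/
def SimpleGraph.IsBipolar {V : Type*} (G : SimpleGraph V) (B U : Set V) (g : V → ℝ) : Prop :=
  Set.InjOn g U ∧ ∀ v ∈ U, v ∉ B →
    (∃ u ∈ U, G.Adj v u ∧ g u < g v) ∧ ∃ u ∈ U, G.Adj v u ∧ g v < g u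

theorem SimpleGraph.IsBipolar.neg {V : Type*} {G : SimpleGraph V} {B U : Set V} {g : V → ℝ}
    (h : G.IsBipolar B U g) : G.IsBipolar B U (fun v => - g v) := by
  refine ⟨fun x hx y hy hxy => h.1 hx hy (neg_injective hxy), fun v hv hB => ?_⟩
  obtain ⟨⟨u, hu, h1, h2⟩, w, hw, h3, h4⟩ := h.2 v hv hB
  exact ⟨⟨w, hw, h3, neg_lt_neg h4⟩, u, hu, h1, neg_lt_neg h2⟩

/-- A bipolar labelling extends monotonically along a path that starts next to `a ∈ U`, stays
outside `U`, and ends at a vertex of `U` with a larger label: each new vertex gets a label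
just above the label of its predecessor. -/
theorem SimpleGraph.IsBipolar.exists_ear {V : Type*} [Finite V] {G : SimpleGraph V} {x z : V}
    (p : G.Walk x z) : ∀ (_ : p.IsPath) {B U : Set V} {g : V → ℝ} {a : V}
    (_ : G.IsBipolar B U g) (_ : z ∈ U) (_ : ∀ y ∈ p.support, y ≠ z → y ∉ U) (_ : a ∈ U)
    (_ : G.Adj a x) (_ : g a < g z),
    ∃ (U' : Set V) (g' : V → ℝ), U ⊆ U' ∧ x ∈ U' ∧ Set.EqOn g' g U ∧ g a < g' x ∧
      G.IsBipolar B U' g' := by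
  classical
  induction p with
  | nil => exact fun _ B U g a hg hz _ _ _ hlt => ⟨U, g, subset_rfl, hz, fun _ _ => rfl, hlt, hg⟩
  | @cons x y z hxy p ih =>
    intro hp B U g a hg hz hsupp ha hax hlt
    rw [SimpleGraph.Walk.cons_isPath_iff] at hp
    have hxz : x ≠ z := fun h => hp.2 (h ▸ p.end_mem_support)
    have hxU : x ∉ U := hsupp x (by simp) hxz
    obtain ⟨c, hac, hc⟩ : ∃ c, g a < c ∧ ∀ u, g a < g u → c < g u := by
      have h1 : ∀ᶠ c in 𝓝[>] g a, ∀ u, g a < g u → c < g u :=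
        Filter.eventually_all.2 fun u => by
          by_cases hu : g a < g u
          · filter_upwards [Ioo_mem_nhdsGT hu] with c hc _ using hc.2
          · exact Filter.Eventually.of_forall fun c h => absurd h hu
      obtain ⟨c, h2, h3⟩ := (h1.and self_mem_nhdsWithin).exists
      exact ⟨c, h3, h2⟩
    have hne : ∀ u ∈ U, u ≠ x := fun u hu h => hxU (h ▸ hu)
    have hupd : ∀ u ∈ U, Function.update g x c u = g u := fun u hu =>
      Function.update_of_ne (hne u hu) _ _
    have hg1 : G.IsBipolar (insert x B) (insert x U) (Function.update g x c) := by
      have hcu : ∀ u ∈ U, g u ≠ c := fun u hu h => by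
        rcases lt_or_ge (g a) (g u) with h1 | h1
        · exact (hc u h1).ne' h
        · linarith
      refine ⟨?_, ?_⟩
      · rintro u (rfl | hu) w (rfl | hw) huw
        · rfl
        · rw [Function.update_self, hupd w hw] at huw
          exact absurd huw.symm (hcu w hw)
        · rw [Function.update_self, hupd u hu] at huw
          exact absurd huw (hcu u hu)
        · rw [hupd u hu, hupd w hw] at huw
          exact hg.1 hu hw huw
      · rintro v hv hvB
        rw [Set.mem_insert_iff, not_or] at hvB
        have hvU := (Set.mem_insert_iff.1 hv).resolve_left hvB.1
        obtain ⟨⟨u, hu, h1, h2⟩, w, hw, h3, h4⟩ := hg.2 v hvU hvB.2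
        refine ⟨⟨u, Or.inr hu, h1, ?_⟩, w, Or.inr hw, h3, ?_⟩
        · rwa [hupd u hu, hupd v hvU]
        · rwa [hupd w hw, hupd v hvU]
    obtain ⟨U', g', hUU', hyU', heq, hgy, hgood⟩ := ih hp.1 hg1 (Or.inr hz)
      (fun w hw hwz hwU => by
        rcases hwU with rfl | hwU
        · exact hp.2 hw
        · exact hsupp w (by simp [hw]) hwz hwU) (Or.inl rfl) hxy
      (by rw [Function.update_self, hupd z hz]; exact hc z hlt)
    have hx' : g' x = c := by rw [heq (Or.inl rfl), Function.update_self]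
    have hU' : ∀ u ∈ U, g' u = g u := fun u hu => by rw [heq (Or.inr hu), hupd u hu]
    refine ⟨U', g', (Set.subset_insert _ _).trans hUU', hUU' (Or.inl rfl), hU', by rwa [hx'],
      hgood.1, fun v hv hvB => ?_⟩
    by_cases hvx : v = x
    · subst hvx
      refine ⟨⟨a, hUU' (Or.inr ha), hax.symm, ?_⟩, y, hyU', hxy, ?_⟩
      · rwa [hx', hU' a ha]
      · rwa [hx', ← Function.update_self v c g]
    · exact hgood.2 v hv (by simp [hvx, hvB])

/-- The initial part of a walk up to its first vertex in `U`. -/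
theorem SimpleGraph.Walk.exists_prefix_to_set {V : Type*} {G : SimpleGraph V} {x y : V}
    (p : G.Walk x y) {U : Set V} (hy : y ∈ U) : ∃ (z : V) (q : G.Walk x z), q.IsPath ∧ z ∈ U ∧
      (∀ w ∈ q.support, w ∈ p.support) ∧ ∀ w ∈ q.support, w ≠ z → w ∉ U := by
  classical
  suffices h : ∃ (z : V) (q : G.Walk x z), z ∈ U ∧
      (∀ w ∈ q.support, w ∈ p.support) ∧ ∀ w ∈ q.support, w ≠ z → w ∉ U by
    obtain ⟨z, q, hz, h1, h2⟩ := h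
    exact ⟨z, q.bypass, q.bypass_isPath, hz, fun w hw => h1 w (q.support_bypass_subset_support hw),
      fun w hw => h2 w (q.support_bypass_subset_support hw)⟩
  induction p with
  | nil => exact ⟨_, .nil, hy, fun w hw => hw, fun w hw hne => by simp at hw; exact absurd hw hne⟩
  | @cons x y' y hxy p ih =>
    by_cases hx : x ∈ U
    · exact ⟨x, .nil, hx, fun w hw => by simp at hw; simp [hw],
        fun w hw hne => by simp at hw; exact absurd hw hne⟩
    · obtain ⟨z, q, hz, h1, h2⟩ := ih hy
      refine ⟨z, .cons hxy q, hz, fun w hw => ?_, fun w hw hne => ?_⟩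
      · rw [SimpleGraph.Walk.support_cons, List.mem_cons] at hw ⊢
        exact hw.imp_right (h1 w)
      · rw [SimpleGraph.Walk.support_cons, List.mem_cons] at hw
        rcases hw with rfl | hw
        · exact hx
        · exact h2 w hw hne

namespace DiskTriangulation

variable {V : Type*} [Fintype V] [DecidableEq V] {n : ℕ} [NeZero n] {T : DiskTriangulation V n}

/-- As the 1-skeleton has no cut vertex, bipolar labellings of sets with at least two vertices
extend to all vertices. -/
theorem exists_isBipolar_univ {B : Set V} (m : ℕ) : ∀ {U : Set V} {g : V → ℝ}
    (_ : (skeletonOf T.faces).IsBipolar B U g) (_ : U.Nontrivial) (_ : Uᶜ.ncard = m),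
    ∃ g' : V → ℝ, Set.EqOn g' g U ∧ (skeletonOf T.faces).IsBipolar B Set.univ g' := by
  induction m using Nat.strong_induction_on with
  | _ m ih =>
    intro U g hg hU hm
    by_cases huniv : ∀ v, v ∈ U
    · rw [Set.eq_univ_of_forall huniv] at hg
      exact ⟨g, fun _ _ => rfl, hg⟩
    push Not at huniv
    obtain ⟨v, hv⟩ := huniv
    have hedge : ∃ a ∈ U, ∃ x, T.Adj a x ∧ x ∉ U := by
      by_contra! hcon
      exact hv (eq_univ_of_closed hU.nonempty hcon v)
    obtain ⟨a, ha, x, hax, hx⟩ := hedge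
    obtain ⟨b, hb, hba⟩ := hU.exists_ne a
    obtain ⟨p, hp⟩ := exists_walk_avoiding (T := T) hax.ne' hba
    obtain ⟨z, q, hq, hz, hqp, hqU⟩ := p.exists_prefix_to_set hb
    have hza : z ≠ a := fun h => hp (h ▸ hqp z q.end_mem_support)
    suffices h : ∃ (U' : Set V) (g' : V → ℝ), U ⊆ U' ∧ x ∈ U' ∧ Set.EqOn g' g U ∧
        (skeletonOf T.faces).IsBipolar B U' g' by
      obtain ⟨U', g', hUU', hxU', heq, hg'⟩ := h
      obtain ⟨g'', h1, h2⟩ := ih (U'ᶜ.ncard) (by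
        rw [← hm]
        exact Set.ncard_lt_ncard ((Set.ssubset_iff_of_subset (Set.compl_subset_compl.2 hUU')).2
          ⟨x, hx, fun h => h hxU'⟩) (Set.toFinite _)) hg' (hU.mono hUU') rfl
      exact ⟨g'', fun u hu => (h1 (hUU' hu)).trans (heq hu), h2⟩
    rcases lt_or_gt_of_ne (fun h => hza (hg.1 hz ha h) : g z ≠ g a) with hlt | hlt
    · obtain ⟨U', g', h1, h2, h3, -, h5⟩ := hg.neg.exists_ear q hq hz hqU ha hax (neg_lt_neg hlt)
      exact ⟨U', fun v => - g' v, h1, h2, fun u hu => by simp only [h3 hu, neg_neg], h5.neg⟩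
    · obtain ⟨U', g', h1, h2, h3, -, h5⟩ := hg.exists_ear q hq hz hqU ha hax hlt
      exact ⟨U', g', h1, h2, h3, h5⟩

/-! ### Functions with the maximum principle -/

/-- A cyclic sequence of reals whose local maxima are global, and attained at most at two
positions, which are adjacent. -/
def _root_.IsUnimodal {n : ℕ} [NeZero n] (u : Fin n → ℝ) : Prop :=
  ∀ i, u (i + 1) ≤ u i → u (i - 1) ≤ u i → ∀ j, u j ≤ u i ∧
    (u j = u i → j = i ∨ j = i + 1 ∨ j = i - 1)

variable (T) in
/-- All neighbours of the interior vertex `v` have the same value as `v`. -/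
def IsFlat (h : V → ℝ) (v : V) : Prop := T.IsInterior v ∧ ∀ w, T.Adj v w → h w = h v

variable (T) in
/-- The properties of a coordinate function of a convex combination map onto a strictly convex
polygon that the combinatorial part of the argument uses. -/
structure IsTutte (h : V → ℝ) : Prop where
  harmonic : ∀ v, T.IsInterior v → T.IsFlat h v ∨ T.HasLower h v ∧ T.HasUpper h v
  top : IsUnimodal fun i => h (T.bd i)
  bot : IsUnimodal fun i => - h (T.bd i)
  nonconst : ∃ i j, h (T.bd i) ≠ h (T.bd j)

theorem IsTutte.neg {h : V → ℝ} (hh : T.IsTutte h) : T.IsTutte fun v => - h v where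
  harmonic v hv := by
    rcases hh.harmonic v hv with h1 | ⟨⟨w, hw, h2⟩, x, hx, h3⟩
    · exact Or.inl ⟨hv, fun w hw => by simp only [h1.2 w hw]⟩
    · exact Or.inr ⟨⟨x, hx, neg_lt_neg h3⟩, w, hw, neg_lt_neg h2⟩
  top := hh.bot
  bot := by simpa using hh.top
  nonconst := by
    obtain ⟨i, j, hij⟩ := hh.nonconst
    exact ⟨i, j, fun h => hij (neg_injective h)⟩

theorem eq_of_not_hasUpper {α : Type*} [LinearOrder α] {h : V → ℝ} {k : V → α}
    (hk : Function.Injective k) (hmono : ∀ v w, k v ≤ k w → h v ≤ h w)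
    (htop : IsUnimodal fun i => h (T.bd i)) {i j : Fin n}
    (hi : ∀ w, T.Adj (T.bd i) w → k w ≤ k (T.bd i))
    (hj : ∀ w, T.Adj (T.bd j) w → k w ≤ k (T.bd j)) : i = j := by
  have hprev : ∀ i, T.Adj (T.bd i) (T.bd (i - 1)) := fun i => by
    have := (bd_adj (T := T) (i - 1)).symm
    rwa [sub_add_cancel] at this
  have ti := htop i (hmono _ _ (hi _ (bd_adj i))) (hmono _ _ (hi _ (hprev i)))
  have tj := htop j (hmono _ _ (hj _ (bd_adj j))) (hmono _ _ (hj _ (hprev j)))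
  rcases (ti j).2 (le_antisymm (ti j).1 (tj i).1) with rfl | rfl | rfl
  · rfl
  · refine T.bd_injective (hk (le_antisymm (hj _ (bd_adj i).symm) (hi _ (bd_adj i))))
  · refine T.bd_injective (hk (le_antisymm (hj _ (hprev i).symm) (hi _ (hprev i))))

theorem IsTutte.changes_le {h g : V → ℝ} (hh : T.IsTutte h)
    (hg : (skeletonOf T.faces).IsBipolar {v | ¬ T.IsFlat h v} Set.univ g) (v : V) :
    T.changes (fun v => toLex (h v, g v)) v ≤ 2 ∧
      (¬ T.IsInterior v → T.changes (fun v => toLex (h v, g v)) v ≤ 1) := by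
  have hk : Function.Injective fun v => toLex (h v, g v) := fun v w hvw =>
    hg.1 (Set.mem_univ _) (Set.mem_univ _) (congrArg (fun x => (ofLex x).2) hvw)
  have hmono : ∀ v w, toLex (h v, g v) ≤ toLex (h w, g w) → h v ≤ h w := fun v w hvw => by
    rcases Prod.Lex.toLex_le_toLex.1 hvw with h1 | h1
    exacts [h1.le, h1.1.le]
  refine DiskTriangulation.changes_le hk (fun v hv => ?_) (fun i j hi hj => ?_)
    (fun i j hi hj => ?_) v
  · rcases hh.harmonic v hv with h1 | ⟨⟨w, hw, h2⟩, x, hx, h3⟩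
    · obtain ⟨⟨w, -, hw, h2⟩, x, -, hx, h3⟩ := hg.2 v (Set.mem_univ _) (fun h => h h1)
      exact ⟨⟨w, hw, Prod.Lex.toLex_lt_toLex.2 (Or.inr ⟨h1.2 w hw, h2⟩)⟩, x, hx,
        Prod.Lex.toLex_lt_toLex.2 (Or.inr ⟨(h1.2 x hx).symm, h3⟩)⟩
    · exact ⟨⟨w, hw, Prod.Lex.toLex_lt_toLex.2 (Or.inl h2)⟩, x, hx,
        Prod.Lex.toLex_lt_toLex.2 (Or.inl h3)⟩
  · unfold HasUpper at hi hj
    push Not at hi hj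
    exact eq_of_not_hasUpper hk hmono hh.top hi hj
  · unfold HasLower at hi hj
    push Not at hi hj
    exact eq_of_not_hasUpper (k := fun v => OrderDual.toDual (toLex (h v, g v)))
      (h := fun v => - h v) hk (fun v w hvw => neg_le_neg (hmono _ _ hvw)) hh.bot hi hj

theorem not_isBdEdge_of_ne {a b c d : V} (hc : {a, b, c} ∈ T.faces) (hd : {a, b, d} ∈ T.faces)
    (hcd : c ≠ d) : ¬ T.IsBdEdge {a, b} := by
  rintro ⟨i, hi⟩
  have h1 := T.bd_edge i
  rw [← hi, Finset.card_eq_one] at h1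
  obtain ⟨f, hf⟩ := h1
  have hmem : ∀ x, {a, b, x} ∈ T.faces → ({a, b, x} : Finset V) = f := fun x hx => by
    have : {a, b, x} ∈ T.faces.filter fun f => {a, b} ⊆ f := by
      rw [Finset.mem_filter]; exact ⟨hx, by intro y; simp; tauto⟩
    rwa [hf, Finset.mem_singleton] at this
  have h2 : c ∈ ({a, b, d} : Finset V) := by rw [hmem d hd, ← hmem c hc]; simp
  have h3 := face_ne hc
  simp only [Finset.mem_insert, Finset.mem_singleton] at h2
  rcases h2 with rfl | rfl | rfl
  exacts [h3.2.1 rfl, h3.2.2 rfl, hcd rfl]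

theorem eq_or_eq_of_face {a b c d x : V} (hc : {a, b, c} ∈ T.faces) (hd : {a, b, d} ∈ T.faces)
    (hcd : c ≠ d) (hx : {a, b, x} ∈ T.faces) : x = c ∨ x = d := by
  obtain ⟨d', hd', -, h⟩ := exists_other hc (not_isBdEdge_of_ne hc hd hcd)
  rcases h d hd with rfl | rfl
  · exact absurd rfl hcd
  · exact h x hx

theorem face_swap {a b c : V} (h : {a, b, c} ∈ T.faces) : {a, c, b} ∈ T.faces := by
  rwa [Finset.pair_comm]

theorem face_rotate {a b c : V} (h : {a, b, c} ∈ T.faces) : {b, c, a} ∈ T.faces := by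
  have : ({b, c, a} : Finset V) = {a, b, c} := by ext; simp; tauto
  rwa [this]

/-- A tie-breaking function for `h` with prescribed behaviour next to the edge `ab`. -/
theorem exists_tieBreak {h : V → ℝ} {a b c d : V} (hc : {a, b, c} ∈ T.faces)
    (hd : {a, b, d} ∈ T.faces) (hcd : c ≠ d) (hab : h a = h b) (had : h d ≠ h a) :
    ∃ g : V → ℝ, (skeletonOf T.faces).IsBipolar {v | ¬ T.IsFlat h v} Set.univ g ∧
      g b < g a ∧ g a < g c := by
  have hcne := face_ne hc
  have hdne := face_ne hd
  have haB : ¬ T.IsFlat h a := fun hf => had (hf.2 d (adj_of_mem hd (by simp) (by simp) hdne.2.1))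
  have hbB : ¬ T.IsFlat h b := fun hf => had
    ((hf.2 d (adj_of_mem hd (by simp) (by simp) hdne.2.2)).trans hab.symm)
  set B : Set V := {v | ¬ T.IsFlat h v} with hB
  have hBnt : B.Nontrivial := ⟨a, haB, b, hbB, hcne.1⟩
  -- every vertex other than `b` and `a` gets a larger label
  let g₀ : V → ℝ := fun v => if v = b then -2 else if v = a then -1 else
    ((Fintype.equivFin V v : ℕ) : ℝ)
  have hg₀b : g₀ b = -2 := by simp [g₀]
  have hg₀a : g₀ a = -1 := by simp [g₀, hcne.1]
  have hg₀ : ∀ v, v ≠ b → v ≠ a → g₀ v = ((Fintype.equivFin V v : ℕ) : ℝ) := fun v h1 h2 => by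
    simp [g₀, h1, h2]
  have hpos : ∀ v, v ≠ b → v ≠ a → -1 < g₀ v := fun v h1 h2 => by
    rw [hg₀ v h1 h2]
    exact lt_of_lt_of_le (by norm_num) (Nat.cast_nonneg _)
  have hinj : Function.Injective g₀ := by
    intro v w hvw
    by_cases hvb : v = b <;> by_cases hwb : w = b
    · rw [hvb, hwb]
    · subst hvb
      by_cases hwa : w = a
      · subst hwa; linarith
      · have := hpos w hwb hwa; linarith
    · subst hwb
      by_cases hva : v = a
      · subst hva; linarith
      · have := hpos v hvb hva; linarith
    · by_cases hva : v = a <;> by_cases hwa : w = a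
      · rw [hva, hwa]
      · subst hva; have := hpos w hwb hwa; linarith
      · subst hwa; have := hpos v hvb hva; linarith
      · rw [hg₀ v hvb hva, hg₀ w hwb hwa, Nat.cast_inj] at hvw
        exact (Fintype.equivFin V).injective (Fin.ext hvw)
  have hgood : (skeletonOf T.faces).IsBipolar B B g₀ :=
    ⟨hinj.injOn, fun v hv hv' => absurd hv hv'⟩
  by_cases hcB : c ∈ B
  · obtain ⟨g, hg, hg'⟩ := exists_isBipolar_univ _ hgood hBnt rfl
    refine ⟨g, hg', ?_, ?_⟩
    · rw [hg haB, hg hbB]; linarith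
    · rw [hg haB, hg hcB, hg₀a]; exact hpos c hcne.2.2.symm hcne.2.1.symm
  -- the flat component of `c` is attached to a vertex other than `a` and `b`
  let C : Set V := {y | ∃ p : (skeletonOf T.faces).Walk c y, ∀ w ∈ p.support, w ∉ B}
  have hCB : ∀ y ∈ C, y ∉ B := fun y ⟨p, hp⟩ => hp y p.end_mem_support
  have hcC : c ∈ C := ⟨.nil, by simpa using hcB⟩
  have hdC : d ∉ C := fun hdC => had
    (((not_not.1 (hCB d hdC)).2 a (adj_of_mem hd (by simp) (by simp) hdne.2.1.symm)).symm)
  obtain ⟨s, t, hs, ht, hst, hne⟩ := (linkOf T.faces a).exists_other_leaving_edge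
    (S := {y | y ∈ C ∧ T.Adj a y}) (fun y hy => link_degree_two (by
      rw [Finset.pair_comm]
      exact (not_not.1 (hCB y hy.1)).1.not_isBdEdge) hy.2)
    (s := c) (t := b) ⟨hcC, adj_of_mem hc (by simp) (by simp) hcne.2.1⟩
    (fun hb => hCB b hb.1 hbB) (link_adj_iff.2 (face_swap hc))
  rw [link_adj_iff] at hst
  have hstne := face_ne hst
  have hsC : s ∈ C := hs.1
  have htC : t ∉ C := fun h => ht ⟨h, adj_of_mem hst (by simp) (by simp) hstne.2.1⟩
  have htb : t ≠ b := by
    rintro rfl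
    rcases eq_or_eq_of_face hc hd hcd (face_swap hst) with rfl | rfl
    · exact hne ⟨rfl, rfl⟩
    · exact hdC hsC
  obtain ⟨p, hp⟩ := hsC
  have hadjst : T.Adj s t := adj_of_mem hst (by simp) (by simp) hstne.2.2
  have htB : t ∈ B := by
    by_contra htB
    refine htC ⟨p.concat hadjst, fun w hw => ?_⟩
    rw [SimpleGraph.Walk.support_concat, List.mem_append,
      List.mem_singleton] at hw
    rcases hw with hw | rfl
    exacts [hp w hw, htB]
  obtain ⟨z, q, hq, hz, hqp, hqB⟩ := (p.concat hadjst).exists_prefix_to_set htB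
  have hzt : z = t := by
    have := hqp z q.end_mem_support
    rw [SimpleGraph.Walk.support_concat, List.mem_append,
      List.mem_singleton] at this
    rcases this with h1 | h1
    exacts [absurd hz (hp z h1), h1]
  subst hzt
  obtain ⟨U, g₁, hU, hcU, heq, hlt, hg₁⟩ := hgood.exists_ear q hq hz hqB haB
    (adj_of_mem hc (by simp) (by simp) hcne.2.1) (by
      rw [hg₀a]; exact hpos z htb hstne.2.1.symm)
  obtain ⟨g, hg, hg'⟩ := exists_isBipolar_univ _ hg₁ (hBnt.mono hU) rfl
  refine ⟨g, hg', ?_, ?_⟩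
  · rw [hg (hU haB), hg (hU hbB), heq haB, heq hbB]; linarith
  · rwa [hg (hU haB), hg hcU, heq haB]

/-- The triangles on the two sides of an edge on which `h` is constant lie on different sides of
the level of `h`. Otherwise, breaking the tie so that `b` is below `a` and `c` is above `a` would
make `a` a saddle. -/
theorem IsTutte.lt_of_lt {h : V → ℝ} (hh : T.IsTutte h) {a b c d : V}
    (hc : {a, b, c} ∈ T.faces) (hd : {a, b, d} ∈ T.faces) (hcd : c ≠ d) (hab : h a = h b)
    (had : h a < h d) : h c < h a := by
  by_contra! hca
  have hcne := face_ne hc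
  have hdne := face_ne hd
  obtain ⟨g, hg, hgb, hgc⟩ := exists_tieBreak hc hd hcd hab had.ne'
  have hle := hh.changes_le hg a
  have hk : Function.Injective fun v => toLex (h v, g v) := fun v w hvw =>
    hg.1 (Set.mem_univ _) (Set.mem_univ _) (congrArg (fun x => (ofLex x).2) hvw)
  have hlex : ∀ v w, h v < h w → toLex (h v, g v) < toLex (h w, g w) := fun v w hvw =>
    Prod.Lex.toLex_lt_toLex.2 (Or.inl hvw)
  have hklt : ∀ v w, toLex (h v, g v) < toLex (h w, g w) ↔ h v < h w ∨ h v = h w ∧ g v < g w :=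
    fun v w => Prod.Lex.toLex_lt_toLex
  set k : V → ℝ ×ₗ ℝ := fun v => toLex (h v, g v) with hkdef
  have hkb : k b < k a := (hklt b a).2 (Or.inr ⟨hab.symm, hgb⟩)
  have hkd : k a < k d := hlex _ _ had
  have hkc : k a < k c := (hklt a c).2 (hca.lt_or_eq.imp_right fun h => ⟨h, hgc⟩)
  have hne : ({a, b, c} : Finset V) ≠ {a, b, d} :=
    Finset.insert_pair_ne_of_lt hkb hkd hkb hkc fun h => hcd h.2.symm
  have hmc := mem_changes hc hkb hkc
  have hmd := mem_changes hd hkb hkd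
  have h2 : 2 ≤ T.changes k a := by
    rw [← Finset.card_pair hne]
    refine Finset.card_le_card ?_
    rw [Finset.insert_subset_iff, Finset.singleton_subset_iff]
    exact ⟨hmc, hmd⟩
  have hint : T.IsInterior a := by
    by_contra hint
    have := hle.2 hint
    omega
  have hadj : T.Adj a d := adj_of_mem hd (by simp) (by simp) hdne.2.1
  obtain ⟨l, hl, hla⟩ : T.HasLower h a := by
    rcases hh.harmonic a hint with h1 | h1
    · exact absurd (h1.2 d hadj) had.ne'
    · exact h1.1
  obtain ⟨s, t, hs, ht, hst⟩ := exists_link_boundary (S := {w | k w < k a ∧ w ≠ b}) hl hadj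
    ⟨hlex _ _ hla, fun h => by rw [h] at hla; exact hla.ne hab.symm⟩ (fun h => hkd.le.not_gt h.1)
  have hstne := face_ne hst
  have hkt : k a < k t := by
    refine lt_of_le_of_ne (not_lt.1 fun hlt => ?_) (hk.ne hstne.2.1)
    have htb : t = b := by
      by_contra htb
      exact ht ⟨hlt, htb⟩
    subst htb
    rcases eq_or_eq_of_face hc hd hcd (face_swap hst) with rfl | rfl
    · exact hkc.le.not_gt hs.1
    · exact hkd.le.not_gt hs.1
  have h3 : 3 ≤ T.changes k a := by
    rw [← Finset.card_eq_three.2 ⟨_, _, _, hne,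
      Finset.insert_pair_ne_of_lt hkb hkt hs.1 hkc fun h => hs.2 h.1,
      Finset.insert_pair_ne_of_lt hkb hkt hs.1 hkd fun h => hs.2 h.1, rfl⟩]
    refine Finset.card_le_card ?_
    rw [Finset.insert_subset_iff, Finset.insert_subset_iff, Finset.singleton_subset_iff]
    exact ⟨hmc, hmd, mem_changes hst hs.1 hkt⟩
  omega

/-- `h` is not constant on any triangle. Otherwise some edge would have a triangle on which `h` is
constant on one side and another one on the other side, against `IsTutte.lt_of_lt`. -/
theorem IsTutte.not_const {h : V → ℝ} (hh : T.IsTutte h) {a b c : V}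
    (hf : {a, b, c} ∈ T.faces) (hab : h a = h b) (hac : h a = h c) : False := by
  -- a vertex that lies both in a constant and in a nonconstant triangle
  let S : Set V := {v | ∃ w x, {v, w, x} ∈ T.faces ∧ h v = h w ∧ h v = h x}
  have haS : a ∈ S := ⟨b, c, hf, hab, hac⟩
  have hex : ∃ v ∈ S, ∃ w, T.Adj v w ∧ ¬ ∃ x, {v, w, x} ∈ T.faces ∧ h v = h w ∧ h v = h x := by
    by_contra! hcon
    have hclosed := eq_univ_of_closed (T := T) (S := {v | v ∈ S ∧ h v = h a}) ⟨a, haS, rfl⟩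
      (fun v hv w hvw => by
        obtain ⟨x, hx, h1, h2⟩ := hcon v hv.1 w hvw
        refine ⟨⟨x, v, face_rotate hx, ?_, h1.symm⟩, h1.symm.trans hv.2⟩
        rw [← h1, h2])
    obtain ⟨i, j, hij⟩ := hh.nonconst
    exact hij ((hclosed (T.bd i)).2.trans (hclosed (T.bd j)).2.symm)
  obtain ⟨v, ⟨w₀, x₀, hf₀, h1, h2⟩, u, hvu, hu⟩ := hex
  let S' : Set V := {w | ∃ x, {v, w, x} ∈ T.faces ∧ h v = h w ∧ h v = h x}
  have hwS' : w₀ ∈ S' := ⟨x₀, hf₀, h1, h2⟩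
  obtain ⟨s, t, ⟨c', hc', hs1, hs2⟩, ht, hst⟩ := exists_link_boundary (T := T) (S := S')
    (adj_iff_exists_third.2 ⟨x₀, hf₀⟩) hvu hwS' hu
  have hvt : h v ≠ h t := fun h3 => ht ⟨s, face_swap hst, h3, hs1⟩
  have hct : c' ≠ t := by rintro rfl; exact hvt hs2
  rcases lt_or_gt_of_ne hvt with hlt | hlt
  · exact (hh.lt_of_lt hc' hst hct hs1 hlt).ne hs2.symm
  · have := hh.neg.lt_of_lt hc' hst hct (by simp only [hs1]) (neg_lt_neg hlt)
    linarith

end DiskTriangulation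

/-! ### Plane geometry -/

/-- Twice the signed area of the triangle `abc`. -/
def cross (a b c : ℝ × ℝ) : ℝ := (b.1 - a.1) * (c.2 - a.2) - (b.2 - a.2) * (c.1 - a.1)

theorem cross_rotate (a b c : ℝ × ℝ) : cross b c a = cross a b c := by unfold cross; ring

theorem cross_swap (a b c : ℝ × ℝ) : cross a c b = - cross a b c := by unfold cross; ring

theorem cross_swap_left (a b c : ℝ × ℝ) : cross b a c = - cross a b c := by unfold cross; ring

@[simp] theorem cross_self_left (a b : ℝ × ℝ) : cross a a b = 0 := by unfold cross; ring

@[simp] theorem cross_self_right (a b : ℝ × ℝ) : cross a b b = 0 := by unfold cross; ring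

@[simp] theorem cross_self_outer (a b : ℝ × ℝ) : cross a b a = 0 := by unfold cross; ring

theorem cross_sum (a b c z : ℝ × ℝ) :
    cross b c z + cross c a z + cross a b z = cross a b c := by unfold cross; ring

/-- The barycentric coordinates of `z` with respect to the triangle `abc` reproduce every affine
function, such as `cross u v`. -/
theorem cross_barycentric (a b c z u v : ℝ × ℝ) : cross a b c * cross u v z =
    cross b c z * cross u v a + cross c a z * cross u v b + cross a b z * cross u v c := by
  unfold cross; ring

theorem cross_combo (a b x y : ℝ × ℝ) (s t : ℝ) (h : s + t = 1) :
    cross a b (s • x + t • y) = s * cross a b x + t * cross a b y := by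
  obtain rfl : s = 1 - t := by linarith
  simp only [cross, Prod.fst_add, Prod.snd_add, Prod.smul_fst, Prod.smul_snd, smul_eq_mul]
  ring

@[fun_prop] theorem continuous_cross {X : Type*} [TopologicalSpace X] {f g h : X → ℝ × ℝ}
    (hf : Continuous f) (hg : Continuous g) (hh : Continuous h) :
    Continuous fun x => cross (f x) (g x) (h x) := by
  unfold cross; fun_prop

/-- The open triangle with vertices `a`, `b`, `c`, for a nondegenerate triangle. -/
def InTri (a b c z : ℝ × ℝ) : Prop := 0 < cross a b c * cross a b z ∧
  0 < cross a b c * cross b c z ∧ 0 < cross a b c * cross c a z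

/-- The closed triangle with vertices `a`, `b`, `c`, for a nondegenerate triangle. -/
def InClosedTri (a b c z : ℝ × ℝ) : Prop := 0 ≤ cross a b c * cross a b z ∧
  0 ≤ cross a b c * cross b c z ∧ 0 ≤ cross a b c * cross c a z

theorem InTri.rotate {a b c z : ℝ × ℝ} (h : InTri a b c z) : InTri b c a z := by
  obtain ⟨h1, h2, h3⟩ := h
  exact ⟨by rwa [cross_rotate], by rwa [cross_rotate], by rwa [cross_rotate]⟩

theorem InTri.swap {a b c z : ℝ × ℝ} (h : InTri a b c z) : InTri a c b z := by
  obtain ⟨h1, h2, h3⟩ := h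
  rw [cross_swap_left] at h1 h2 h3
  refine ⟨?_, ?_, ?_⟩ <;> rw [cross_swap a b c]
  · rw [cross_swap_left c a z]; rw [cross_swap_left] at h3; linarith
  · rw [cross_swap_left b c z]; rw [cross_swap_left] at h2; linarith
  · rw [cross_swap_left a b z]; rw [cross_swap_left] at h1; linarith

theorem isOpen_inTri (a b c : ℝ × ℝ) : IsOpen {z | InTri a b c z} := by
  have h : ∀ u v : ℝ × ℝ, IsOpen {z | 0 < cross a b c * cross u v z} := fun u v =>
    isOpen_lt continuous_const (by fun_prop)
  exact (h _ _).inter ((h _ _).inter (h _ _))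

theorem InClosedTri.mem_closure {a b c z : ℝ × ℝ} (hD : cross a b c ≠ 0)
    (h : InClosedTri a b c z) : z ∈ closure {z | InTri a b c z} := by
  -- move `z` towards the barycentre `m`
  set m : ℝ × ℝ := ((a.1 + b.1 + c.1) / 3, (a.2 + b.2 + c.2) / 3) with hm
  have h1 : cross a b m = cross a b c / 3 := by simp only [cross, hm]; ring
  have h2 : cross b c m = cross a b c / 3 := by simp only [cross, hm]; ring
  have h3 : cross c a m = cross a b c / 3 := by simp only [cross, hm]; ring
  have hD2 : 0 < cross a b c * (cross a b c / 3) := by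
    have := mul_self_pos.2 hD; linarith
  have hlim : Filter.Tendsto (fun t : ℝ => (1 - t) • z + t • m) (𝓝[>] 0) (𝓝 z) := by
    have : Filter.Tendsto (fun t : ℝ => (1 - t) • z + t • m) (𝓝 0)
        (𝓝 ((1 - (0 : ℝ)) • z + (0 : ℝ) • m)) :=
      Continuous.tendsto (by fun_prop) 0
    simp only [sub_zero, one_smul, zero_smul, add_zero] at this
    exact this.mono_left nhdsWithin_le_nhds
  refine mem_closure_of_tendsto hlim ?_
  filter_upwards [Ioo_mem_nhdsGT (zero_lt_one' ℝ)] with t ht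
  have hpos : ∀ u v : ℝ × ℝ, 0 ≤ cross a b c * cross u v z → cross u v m = cross a b c / 3 →
      0 < cross a b c * cross u v ((1 - t) • z + t • m) := fun u v h4 h5 => by
    rw [cross_combo _ _ _ _ _ _ (by ring), h5, mul_add]
    have h6 : 0 < t * (cross a b c * (cross a b c / 3)) := mul_pos ht.1 hD2
    have h7 : 0 ≤ (1 - t) * (cross a b c * cross u v z) := mul_nonneg (by linarith [ht.2]) h4
    linarith
  exact ⟨hpos _ _ h.1 h1, hpos _ _ h.2.1 h2, hpos _ _ h.2.2 h3⟩

/-- A half neighbourhood of a point of the open side `ab` lies in the triangle. -/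
theorem eventually_inClosedTri {a b c : ℝ × ℝ} (hD : cross a b c ≠ 0) {s t : ℝ} (hs : 0 < s)
    (ht : 0 < t) (hst : s + t = 1) :
    ∀ᶠ z in 𝓝 (s • a + t • b), 0 ≤ cross a b c * cross a b z → InClosedTri a b c z := by
  have hD2 := mul_self_pos.2 hD
  have c1 : ∀ᶠ z in 𝓝 (s • a + t • b), 0 < cross a b c * cross b c z := by
    refine (Continuous.tendsto (by fun_prop) _).eventually_const_lt ?_
    rw [cross_combo _ _ _ _ _ _ hst, cross_rotate a b c, cross_self_outer, mul_zero,
      add_zero, mul_left_comm]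
    exact mul_pos hs hD2
  have c2 : ∀ᶠ z in 𝓝 (s • a + t • b), 0 < cross a b c * cross c a z := by
    refine (Continuous.tendsto (by fun_prop) _).eventually_const_lt ?_
    rw [cross_combo _ _ _ _ _ _ hst, cross_self_right, mul_zero, zero_add,
      ← cross_rotate c a b, mul_left_comm]
    exact mul_pos ht hD2
  filter_upwards [c1, c2] with z h1 h2 h3 using ⟨h3, h1.le, h2.le⟩

/-- Triangles on different sides of `ab` cover a neighbourhood of each point of the open
segment. -/
theorem eventually_inClosedTri_or {a b c d : ℝ × ℝ} (h : cross a b c * cross a b d < 0) {s t : ℝ}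
    (hs : 0 < s) (ht : 0 < t) (hst : s + t = 1) :
    ∀ᶠ z in 𝓝 (s • a + t • b), InClosedTri a b c z ∨ InClosedTri a b d z := by
  filter_upwards [eventually_inClosedTri (left_ne_zero_of_mul h.ne) hs ht hst,
    eventually_inClosedTri (right_ne_zero_of_mul h.ne) hs ht hst] with z h1 h2
  by_cases h3 : 0 ≤ cross a b c * cross a b z
  · exact Or.inl (h1 h3)
  · refine Or.inr (h2 ?_)
    by_contra h4
    push Not at h3 h4
    have h5 := mul_pos_of_neg_of_neg h3 h4
    have h6 : cross a b c * cross a b z * (cross a b d * cross a b z) =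
      (cross a b c * cross a b d) * (cross a b z * cross a b z) := by ring
    rw [h6] at h5
    exact absurd h5 (mul_nonpos_of_nonpos_of_nonneg h.le (mul_self_nonneg _)).not_gt

/-- If the corners of a triangle lie weakly on one side of the line `uv`, so do its points. -/
theorem InTri.nonneg {a b c z u v : ℝ × ℝ} {r : ℝ} (hD : cross a b c ≠ 0) (h : InTri a b c z)
    (ha : 0 ≤ r * cross u v a) (hb : 0 ≤ r * cross u v b) (hc : 0 ≤ r * cross u v c) :
    0 ≤ r * cross u v z := by
  have h1 := cross_barycentric a b c z u v
  have hD2 := mul_self_pos.2 hD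
  have h2 : cross a b c * cross a b c * (r * cross u v z) =
      (cross a b c * cross b c z) * (r * cross u v a) +
      (cross a b c * cross c a z) * (r * cross u v b) +
      (cross a b c * cross a b z) * (r * cross u v c) := by
    linear_combination (cross a b c * r) * h1
  have h3 : 0 ≤ cross a b c * cross a b c * (r * cross u v z) := by
    rw [h2]
    exact add_nonneg (add_nonneg (mul_nonneg h.2.1.le ha) (mul_nonneg h.2.2.le hb))
      (mul_nonneg h.1.le hc)
  exact nonneg_of_mul_nonneg_right h3 hD2

/-! ### Ray casting -/

/-- The segment `uv`, directed to the right, meets the vertical upward ray from `z`. -/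
def Above (z u v : ℝ × ℝ) : Prop := u.1 ≤ z.1 ∧ z.1 < v.1 ∧ cross u v z < 0

open Classical in
/-- The contribution of the side `uv` of the triangle `uvw` to the ray casting count: `1` if the
vertical upward ray from `z` leaves the triangle there, `-1` if it enters. -/
noncomputable def rayTerm (z u v w : ℝ × ℝ) : ℤ :=
  if Above z u v then (if cross u v w < 0 then 1 else -1) else 0

/-- The sum of the contributions of the sides of a triangle. -/
noncomputable def raySum (z a b c : ℝ × ℝ) : ℤ :=
  rayTerm z a b c + rayTerm z a c b + rayTerm z b a c + rayTerm z b c a + rayTerm z c a b +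
    rayTerm z c b a

theorem raySum_rotate (z a b c : ℝ × ℝ) : raySum z b c a = raySum z a b c := by
  unfold raySum; ring

theorem raySum_swap (z a b c : ℝ × ℝ) : raySum z a c b = raySum z a b c := by
  unfold raySum; ring

theorem rayTerm_of_left {z u v w : ℝ × ℝ} (h : v.1 ≤ z.1) : rayTerm z u v w = 0 :=
  if_neg fun h' => h.not_gt h'.2.1

theorem rayTerm_of_right {z u v w : ℝ × ℝ} (h : z.1 < u.1) : rayTerm z u v w = 0 :=
  if_neg fun h' => h.not_ge h'.1

theorem cross_fst_identity (a b c z : ℝ × ℝ) : cross b c z * (a.1 - z.1) +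
    cross c a z * (b.1 - z.1) + cross a b z * (c.1 - z.1) = 0 := by unfold cross; ring

theorem raySum_one_left {z a b c : ℝ × ℝ} (hD : cross a b c ≠ 0) (ha : a.1 ≤ z.1)
    (hb : z.1 < b.1) (hc : z.1 < c.1) :
    0 ≤ raySum z a b c ∧ (InTri a b c z → 1 ≤ raySum z a b c) := by
  wlog hpos : 0 < cross a b c generalizing b c
  · have := this (b := c) (c := b) (by rwa [cross_swap, neg_ne_zero]) hc hb
      (by rw [cross_swap]; exact neg_pos.2 (lt_of_le_of_ne (not_lt.1 hpos) hD))
    rw [raySum_swap] at this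
    exact ⟨this.1, fun h => this.2 h.swap⟩
  have h1 := cross_fst_identity a b c z
  have h2 := cross_sum a b c z
  have e1 : raySum z a b c = rayTerm z a b c + rayTerm z a c b := by
    unfold raySum
    rw [rayTerm_of_right (u := b) hb, rayTerm_of_right (u := b) hb, rayTerm_of_right (u := c) hc,
      rayTerm_of_right (u := c) hc]
    ring
  have e2 : rayTerm z a b c = if cross a b z < 0 then -1 else 0 := by
    simp [rayTerm, Above, ha, hb, hpos.le.not_gt]
  have e3 : rayTerm z a c b = if 0 < cross c a z then 1 else 0 := by
    simp [rayTerm, Above, ha, hc, cross_swap a b c, hpos, Left.neg_neg_iff]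
    rw [← neg_neg (cross a c z), ← cross_swap_left a c z]
    simp
  rw [e1, e2, e3]
  constructor
  · split_ifs with h3 h4
    · norm_num
    · exfalso
      have h5 : cross b c z * (z.1 - a.1) < 0 := by nlinarith
      have h6 : cross b c z < 0 := by
        by_contra h6
        have := mul_nonneg (not_lt.1 h6) (sub_nonneg.2 ha)
        linarith
      linarith
    · norm_num
    · norm_num
  · intro h
    rw [if_neg, if_pos]
    · norm_num
    · exact (mul_pos_iff_of_pos_left hpos).1 h.2.2
    · exact ((mul_pos_iff_of_pos_left hpos).1 h.1).le.not_gt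

theorem raySum_one_right {z a b c : ℝ × ℝ} (hD : cross a b c ≠ 0) (ha : z.1 < a.1)
    (hb : b.1 ≤ z.1) (hc : c.1 ≤ z.1) :
    0 ≤ raySum z a b c ∧ (InTri a b c z → 1 ≤ raySum z a b c) := by
  wlog hpos : 0 < cross a b c generalizing b c
  · have := this (b := c) (c := b) (by rwa [cross_swap, neg_ne_zero]) hc hb
      (by rw [cross_swap]; exact neg_pos.2 (lt_of_le_of_ne (not_lt.1 hpos) hD))
    rw [raySum_swap] at this
    exact ⟨this.1, fun h => this.2 h.swap⟩
  have h1 := cross_fst_identity a b c z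
  have h2 := cross_sum a b c z
  have e1 : raySum z a b c = rayTerm z b a c + rayTerm z c a b := by
    unfold raySum
    rw [rayTerm_of_right (u := a) ha, rayTerm_of_right (u := a) ha, rayTerm_of_left (v := b) hb,
      rayTerm_of_left (v := c) hc]
    ring
  have e2 : rayTerm z b a c = if 0 < cross a b z then 1 else 0 := by
    simp [rayTerm, Above, ha, hb, cross_swap_left a b, hpos]
  have e3 : rayTerm z c a b = if cross c a z < 0 then -1 else 0 := by
    have : cross c a b = cross a b c := by rw [← cross_rotate]
    simp [rayTerm, Above, ha, hc, this, hpos.le.not_gt]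
  rw [e1, e2, e3]
  constructor
  · split_ifs with h3 h4 h4
    · norm_num
    · norm_num
    · exfalso
      have h5 : cross b c z * (a.1 - z.1) ≤ 0 := by nlinarith
      have h6 : cross b c z ≤ 0 := by
        by_contra h6
        have := mul_pos (not_le.1 h6) (sub_pos.2 ha)
        linarith
      linarith
    · norm_num
  · intro h
    rw [if_pos, if_neg]
    · norm_num
    · exact ((mul_pos_iff_of_pos_left hpos).1 h.2.2).le.not_gt
    · exact (mul_pos_iff_of_pos_left hpos).1 h.1

theorem not_inTri_of_same_side {z a b c : ℝ × ℝ} (hD : cross a b c ≠ 0)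
    (h : (a.1 ≤ z.1 ∧ b.1 ≤ z.1 ∧ c.1 ≤ z.1) ∨ (z.1 < a.1 ∧ z.1 < b.1 ∧ z.1 < c.1)) :
    ¬ InTri a b c z := by
  rintro ⟨h1, h2, h3⟩
  have h4 := cross_fst_identity a b c z
  have h5 : cross a b c * cross b c z * (a.1 - z.1) + cross a b c * cross c a z * (b.1 - z.1) +
    cross a b c * cross a b z * (c.1 - z.1) = 0 := by linear_combination cross a b c * h4
  rcases h with ⟨ha, hb, hc⟩ | ⟨ha, hb, hc⟩
  · have n1 := mul_nonpos_of_nonneg_of_nonpos h2.le (sub_nonpos.2 ha)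
    have n2 := mul_nonpos_of_nonneg_of_nonpos h3.le (sub_nonpos.2 hb)
    have n3 := mul_nonpos_of_nonneg_of_nonpos h1.le (sub_nonpos.2 hc)
    have e1 := (mul_eq_zero.1
      (by linarith : cross a b c * cross b c z * (a.1 - z.1) = 0)).resolve_left h2.ne'
    have e2 := (mul_eq_zero.1
      (by linarith : cross a b c * cross c a z * (b.1 - z.1) = 0)).resolve_left h3.ne'
    have e3 := (mul_eq_zero.1
      (by linarith : cross a b c * cross a b z * (c.1 - z.1) = 0)).resolve_left h1.ne'
    apply hD
    unfold cross
    rw [show b.1 - a.1 = 0 by linarith, show c.1 - a.1 = 0 by linarith]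
    ring
  · have n1 := mul_pos h2 (sub_pos.2 ha)
    have n2 := mul_pos h3 (sub_pos.2 hb)
    have n3 := mul_pos h1 (sub_pos.2 hc)
    linarith

/-- The ray casting count of a triangle is nonnegative, and at least `1` on the open triangle. -/
theorem raySum_bound {z a b c : ℝ × ℝ} (hD : cross a b c ≠ 0) :
    0 ≤ raySum z a b c ∧ (InTri a b c z → 1 ≤ raySum z a b c) := by
  have hD' : cross b c a ≠ 0 := by rwa [cross_rotate]
  have hD'' : cross c a b ≠ 0 := by rwa [← cross_rotate]
  have r1 := raySum_rotate z a b c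
  have r2 : raySum z c a b = raySum z a b c := by rw [← raySum_rotate]
  rcases le_or_gt a.1 z.1 with ha | ha <;> rcases le_or_gt b.1 z.1 with hb | hb <;>
    rcases le_or_gt c.1 z.1 with hc | hc
  · refine ⟨le_of_eq ?_, fun h => absurd h (not_inTri_of_same_side hD (Or.inl ⟨ha, hb, hc⟩))⟩
    simp [raySum, rayTerm_of_left, ha, hb, hc]
  · have := raySum_one_right hD'' hc ha hb
    rw [r2] at this
    exact ⟨this.1, fun h => this.2 h.rotate.rotate⟩
  · have := raySum_one_right hD' hb hc ha
    rw [r1] at this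
    exact ⟨this.1, fun h => this.2 h.rotate⟩
  · exact raySum_one_left hD ha hb hc
  · exact raySum_one_right hD ha hb hc
  · have := raySum_one_left hD' hb hc ha
    rw [r1] at this
    exact ⟨this.1, fun h => this.2 h.rotate⟩
  · have := raySum_one_left hD'' hc ha hb
    rw [r2] at this
    exact ⟨this.1, fun h => this.2 h.rotate.rotate⟩
  · refine ⟨le_of_eq ?_, fun h => absurd h (not_inTri_of_same_side hD (Or.inr ⟨ha, hb, hc⟩))⟩
    simp [raySum, rayTerm_of_right, ha, hb, hc]

/-- Two segments above `z`, each of which has the other one weakly below its line, cross the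
vertical line through `z` at the same height. -/
theorem Above.cross_eq_zero {z u v u' v' : ℝ × ℝ} (h : Above z u v) (h' : Above z u' v')
    (h1 : cross u v u' ≤ 0) (h2 : cross u v v' ≤ 0) (h3 : cross u' v' u ≤ 0)
    (h4 : cross u' v' v ≤ 0) : cross u v u' = 0 := by
  have key : (v'.1 - z.1) * cross u v u' + (z.1 - u'.1) * cross u v v' +
      ((v.1 - z.1) * cross u' v' u + (z.1 - u.1) * cross u' v' v) = 0 := by
    unfold cross; ring
  have a1 := mul_nonpos_of_nonneg_of_nonpos (sub_nonneg.2 h'.2.1.le) h1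
  have a2 := mul_nonpos_of_nonneg_of_nonpos (sub_nonneg.2 h'.1) h2
  have a3 := mul_nonpos_of_nonneg_of_nonpos (sub_nonneg.2 h.2.1.le) h3
  have a4 := mul_nonpos_of_nonneg_of_nonpos (sub_nonneg.2 h.1) h4
  exact (mul_eq_zero.1 (by linarith : (v'.1 - z.1) * cross u v u' = 0)).resolve_left
    (sub_pos.2 h'.2.1).ne'

/-! ### Maps of a triangulated disk that do not fold -/

/-- All points of the polygon other than the ends of a side lie strictly on the same side of it. -/
def IsStrictPolygon {n : ℕ} [NeZero n] (φ : Fin n → ℝ × ℝ) : Prop :=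
  ∀ i j k, j ≠ i → j ≠ i + 1 → k ≠ i → k ≠ i + 1 →
    0 < cross (φ i) (φ (i + 1)) (φ j) * cross (φ i) (φ (i + 1)) (φ k)

namespace DiskTriangulation

variable {V : Type*} [Fintype V] [DecidableEq V] {n : ℕ} [NeZero n] {T : DiskTriangulation V n}
  {p : V → ℝ × ℝ} {φ : Fin n → ℝ × ℝ}

variable (T) in
/-- The triangles are nondegenerate, and two triangles with a common edge lie on different sides
of it. -/
structure IsUnfolded (p : V → ℝ × ℝ) : Prop where
  nondeg : ∀ {a b c}, {a, b, c} ∈ T.faces → cross (p a) (p b) (p c) ≠ 0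
  opposite : ∀ {a b c d}, {a, b, c} ∈ T.faces → {a, b, d} ∈ T.faces → c ≠ d →
    cross (p a) (p b) (p c) * cross (p a) (p b) (p d) < 0

/-- The triangles at an interior vertex cover all directions. -/
theorem IsUnfolded.exists_cone (hp : T.IsUnfolded p) {v : V} (hv : T.IsInterior v)
    (z : ℝ × ℝ) : ∃ w x, {v, w, x} ∈ T.faces ∧
      0 ≤ cross (p v) (p w) (p x) * cross (p v) (p w) z ∧
      0 ≤ cross (p v) (p w) (p x) * cross (p x) (p v) z := by
  let K : Set (ℝ × ℝ) := {z | ∃ w x, {v, w, x} ∈ T.faces ∧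
      0 ≤ cross (p v) (p w) (p x) * cross (p v) (p w) z ∧
      0 ≤ cross (p v) (p w) (p x) * cross (p x) (p v) z}
  have hKclosed : IsClosed K := by
    have : K = ⋃ (w : V) (x : V), {z | {v, w, x} ∈ T.faces ∧
      0 ≤ cross (p v) (p w) (p x) * cross (p v) (p w) z ∧
      0 ≤ cross (p v) (p w) (p x) * cross (p x) (p v) z} := by
      ext z; simp [K]
    rw [this]
    refine isClosed_iUnion_of_finite fun w => isClosed_iUnion_of_finite fun x => ?_
    have hc : ∀ (r : ℝ) (a b : ℝ × ℝ), IsClosed {z | 0 ≤ r * cross a b z} := fun r a b =>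
      isClosed_le continuous_const (by fun_prop)
    exact isClosed_const.inter ((hc _ _ _).inter (hc _ _ _))
  -- a point on the ray through `p w`, where two cones meet
  have hray : ∀ w x z, {v, w, x} ∈ T.faces → cross (p v) (p w) z = 0 →
      0 < cross (p v) (p w) (p x) * cross (p x) (p v) z → K ∈ 𝓝 z := by
    intro w x z hf h0 hpos
    obtain ⟨y, hyx, hy, -⟩ := exists_other hf hv.not_isBdEdge
    have hopp := hp.opposite hf hy hyx.symm
    have hpos' : 0 < cross (p v) (p w) (p y) * cross (p y) (p v) z := by
      have hD := hp.nondeg hf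
      -- `z` lies on the ray, hence the two products are proportional
      have h1 : cross (p v) (p w) (p x) * cross (p y) (p v) z =
          cross (p v) (p w) (p y) * cross (p x) (p v) z := by
        unfold cross at h0 ⊢
        linear_combination (((p x).1 - (p v).1) * ((p y).2 - (p v).2) -
          ((p y).1 - (p v).1) * ((p x).2 - (p v).2)) * h0
      have h2 : 0 < (cross (p v) (p w) (p y) * cross (p y) (p v) z) *
          (cross (p v) (p w) (p x) * cross (p v) (p w) (p x)) := by
        have h3 : cross (p v) (p w) (p y) ≠ 0 := hp.nondeg hy
        have h4 := mul_pos (mul_self_pos.2 h3) hpos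
        have : (cross (p v) (p w) (p y) * cross (p y) (p v) z) *
          (cross (p v) (p w) (p x) * cross (p v) (p w) (p x)) =
          (cross (p v) (p w) (p y) * cross (p v) (p w) (p y)) *
            (cross (p v) (p w) (p x) * cross (p x) (p v) z) := by
          linear_combination (cross (p v) (p w) (p y) * cross (p v) (p w) (p x)) * h1
        rwa [this]
      exact (mul_pos_iff_of_pos_right (mul_self_pos.2 hD)).1 h2
    have c1 : ∀ᶠ z' in 𝓝 z, 0 < cross (p v) (p w) (p x) * cross (p x) (p v) z' :=
      (Continuous.tendsto (by fun_prop) z).eventually_const_lt hpos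
    have c2 : ∀ᶠ z' in 𝓝 z, 0 < cross (p v) (p w) (p y) * cross (p y) (p v) z' :=
      (Continuous.tendsto (by fun_prop) z).eventually_const_lt hpos'
    filter_upwards [c1, c2] with z' h1 h2
    by_cases h3 : 0 ≤ cross (p v) (p w) (p x) * cross (p v) (p w) z'
    · exact ⟨w, x, hf, h3, h1.le⟩
    · refine ⟨w, y, hy, ?_, h2.le⟩
      by_contra h4
      push Not at h3 h4
      have h5 := mul_pos_of_neg_of_neg h3 h4
      have h6 : cross (p v) (p w) (p x) * cross (p v) (p w) z' *
        (cross (p v) (p w) (p y) * cross (p v) (p w) z') =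
        (cross (p v) (p w) (p x) * cross (p v) (p w) (p y)) *
          (cross (p v) (p w) z' * cross (p v) (p w) z') := by ring
      rw [h6] at h5
      exact absurd h5 (mul_nonpos_of_nonpos_of_nonneg hopp.le (mul_self_nonneg _)).not_gt
  have hKnhds : ∀ z ∈ K, z ≠ p v → K ∈ 𝓝 z := by
    rintro z ⟨w, x, hf, h1, h2⟩ hz
    have hD := hp.nondeg hf
    rcases h1.lt_or_eq with h1 | h1
    · rcases h2.lt_or_eq with h2 | h2
      · have c1 : ∀ᶠ z' in 𝓝 z, 0 < cross (p v) (p w) (p x) * cross (p v) (p w) z' :=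
          (Continuous.tendsto (by fun_prop) z).eventually_const_lt h1
        have c2 : ∀ᶠ z' in 𝓝 z, 0 < cross (p v) (p w) (p x) * cross (p x) (p v) z' :=
          (Continuous.tendsto (by fun_prop) z).eventually_const_lt h2
        filter_upwards [c1, c2] with z' h3 h4 using ⟨w, x, hf, h3.le, h4.le⟩
      · refine hray x w z (face_swap hf) ?_ ?_
        · rw [← neg_eq_zero, ← cross_swap_left]
          exact (mul_eq_zero.1 h2.symm).resolve_left hD
        · rw [cross_swap (p v) (p w) (p x), cross_swap_left (p v) (p w) z]; linarith
    · have h0 := (mul_eq_zero.1 h1.symm).resolve_left hD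
      refine hray w x z hf h0 (lt_of_le_of_ne h2 fun h3 => hz ?_)
      have h4 := (mul_eq_zero.1 h3.symm).resolve_left hD
      -- `z` lies on the lines through `p v` in two independent directions
      have e1 : cross (p v) (p w) (p x) * (z.1 - (p v).1) = 0 := by
        unfold cross at *
        linear_combination ((p x).1 - (p v).1) * h0 + ((p w).1 - (p v).1) * h4
      have e2 : cross (p v) (p w) (p x) * (z.2 - (p v).2) = 0 := by
        unfold cross at *
        linear_combination ((p x).2 - (p v).2) * h0 + ((p w).2 - (p v).2) * h4
      exact Prod.ext (sub_eq_zero.1 ((mul_eq_zero.1 e1).resolve_left hD))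
        (sub_eq_zero.1 ((mul_eq_zero.1 e2).resolve_left hD))
  change z ∈ K
  obtain ⟨w, hvw⟩ := T.exists_adj v
  obtain ⟨x, hf⟩ := adj_iff_exists_third.1 hvw
  by_cases hz : z = p v
  · exact ⟨w, x, hf, by simp [hz], by simp [hz]⟩
  have hconn : IsPreconnected ({p v}ᶜ : Set (ℝ × ℝ)) :=
    (isConnected_compl_singleton_of_one_lt_rank (by simp [one_add_one_eq_two]) (p v)).isPreconnected
  have hpw : p w ∈ ({p v}ᶜ : Set (ℝ × ℝ)) := fun h => by
    have h1 := hp.nondeg hf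
    rw [Set.mem_singleton_iff] at h
    rw [h, cross_self_left] at h1
    exact h1 rfl
  have hsub := hconn.subset_of_closure_inter_subset (u := interior K) isOpen_interior
    ⟨p w, hpw, mem_interior_iff_mem_nhds.2 (hKnhds _ ⟨w, x, hf, by simp, by
      rw [← cross_rotate (p x) (p v) (p w)]
      exact mul_self_nonneg _⟩ hpw)⟩
    (fun y hy => mem_interior_iff_mem_nhds.2 (hKnhds y
      (hKclosed.closure_subset_iff.2 interior_subset hy.1) hy.2))
  exact interior_subset (hsub hz)

variable (T φ) in
/-- An unfolded map with boundary values `φ` whose image lies on one side of every side of the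
polygon. -/
structure IsTiling (p : V → ℝ × ℝ) : Prop extends T.IsUnfolded p where
  bd : ∀ i, p (T.bd i) = φ i
  side : ∀ i v w, 0 ≤ cross (φ i) (φ (i + 1)) (p v) * cross (φ i) (φ (i + 1)) (p w)

open Classical in
/-- The total contribution to the ray casting count of the pair `u v` as a side of triangles. -/
noncomputable def edgeTerm (f : Finset V) (p : V → ℝ × ℝ) (z : ℝ × ℝ) (u v : V) : ℤ :=
  if Above z (p u) (p v) then (if ∃ w ∈ f, cross (p u) (p v) (p w) < 0 then 1 else -1) else 0

theorem sum_edgeTerm (z : ℝ × ℝ) {a b c : V} (hf : {a, b, c} ∈ T.faces) :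
    ∑ q ∈ ({a, b, c} : Finset V) ×ˢ {a, b, c}, edgeTerm {a, b, c} p z q.1 q.2 =
      raySum z (p a) (p b) (p c) := by
  obtain ⟨hab, hac, hbc⟩ := face_ne hf
  have hself : ∀ u, edgeTerm {a, b, c} p z u u = 0 := fun u =>
    if_neg fun h => by simpa using h.2.2
  have hterm : ∀ u v w, ({a, b, c} : Finset V) = {u, v, w} →
      edgeTerm {a, b, c} p z u v = rayTerm z (p u) (p v) (p w) := fun u v w h => by
    rw [h]
    simp [edgeTerm, rayTerm]
  rw [Finset.sum_product, Finset.sum_insert (by simp [hab, hac]), Finset.sum_pair hbc]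
  simp only [Finset.sum_insert (show a ∉ ({b, c} : Finset V) by simp [hab, hac]),
    Finset.sum_pair hbc, hself]
  rw [hterm a b c rfl, hterm a c b (by ext; simp; tauto), hterm b a c (by ext; simp; tauto),
    hterm b c a (by ext; simp; tauto), hterm c a b (by ext; simp; tauto),
    hterm c b a (by ext; simp; tauto)]
  unfold raySum
  ring

theorem IsTiling.side_of_isBdEdge (hp : T.IsTiling φ p) {u v : V} (huv : u ≠ v)
    (he : T.IsBdEdge {u, v}) (w x : V) :
    0 ≤ cross (p u) (p v) (p w) * cross (p u) (p v) (p x) := by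
  obtain ⟨i, hi⟩ := he
  have h := hp.side i w x
  rw [← hp.bd, ← hp.bd] at h
  have h1 : u ∈ ({T.bd i, T.bd (i + 1)} : Finset V) := by rw [← hi]; simp
  have h2 : v ∈ ({T.bd i, T.bd (i + 1)} : Finset V) := by rw [← hi]; simp
  rw [Finset.mem_insert, Finset.mem_singleton] at h1 h2
  rcases h1 with rfl | rfl <;> rcases h2 with rfl | rfl
  · exact absurd rfl huv
  · exact h
  · rwa [cross_swap_left, cross_swap_left _ _ (p x), neg_mul_neg]
  · exact absurd rfl huv

theorem IsTiling.mem_of_cross_eq_zero (hp : T.IsTiling φ p) (hφ : IsStrictPolygon φ) {u v : V}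
    (huv : u ≠ v) (he : T.IsBdEdge {u, v}) {x : V} (hx : ¬ T.IsInterior x)
    (h0 : cross (p u) (p v) (p x) = 0) : x = u ∨ x = v := by
  unfold IsInterior at hx
  push Not at hx
  obtain ⟨j, rfl⟩ := hx
  obtain ⟨i, hi⟩ := he
  have hmem : T.bd j ∈ ({u, v} : Finset V) ↔ T.bd j ∈ ({T.bd i, T.bd (i + 1)} : Finset V) := by
    rw [hi]
  rw [Finset.mem_insert, Finset.mem_singleton, Finset.mem_insert, Finset.mem_singleton,
    T.bd_injective.eq_iff, T.bd_injective.eq_iff] at hmem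
  by_contra hcon
  have hj : ¬ (j = i ∨ j = i + 1) := fun h => hcon (hmem.2 h)
  rw [not_or] at hj
  have h := hφ i j j hj.1 hj.2 hj.1 hj.2
  rw [← hp.bd, ← hp.bd, ← hp.bd] at h
  have h1 : u ∈ ({T.bd i, T.bd (i + 1)} : Finset V) := by rw [← hi]; simp
  have h2 : v ∈ ({T.bd i, T.bd (i + 1)} : Finset V) := by rw [← hi]; simp
  rw [Finset.mem_insert, Finset.mem_singleton] at h1 h2
  rcases h1 with rfl | rfl <;> rcases h2 with rfl | rfl
  · exact absurd rfl huv
  · rw [h0] at h; simp at h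
  · rw [cross_swap_left, h0] at h; simp at h
  · exact absurd rfl huv

theorem IsBdEdge.not_isInterior {u v : V} (he : T.IsBdEdge {u, v}) :
    ¬ T.IsInterior u ∧ ¬ T.IsInterior v :=
  ⟨fun h => h.not_isBdEdge he, fun h => h.not_isBdEdge (by rwa [Finset.pair_comm] at he)⟩

/-- At most one boundary edge lies above `z` and has the polygon below it. -/
theorem IsTiling.top_edge_unique (hp : T.IsTiling φ p) (hφ : IsStrictPolygon φ) {z : ℝ × ℝ}
    {u v u' v' : V} (h : Above z (p u) (p v)) (h' : Above z (p u') (p v'))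
    (he : T.IsBdEdge {u, v}) (he' : T.IsBdEdge {u', v'})
    (hneg : ∃ w, cross (p u) (p v) (p w) < 0) (hneg' : ∃ w, cross (p u') (p v') (p w) < 0) :
    u = u' ∧ v = v' := by
  have huv : u ≠ v := by rintro rfl; exact absurd h.2.2 (by simp)
  have huv' : u' ≠ v' := by rintro rfl; exact absurd h'.2.2 (by simp)
  have hle : ∀ x, cross (p u) (p v) (p x) ≤ 0 := fun x => by
    obtain ⟨w, hw⟩ := hneg
    by_contra hx
    exact absurd (hp.side_of_isBdEdge huv he w x)
      (mul_neg_of_neg_of_pos hw (not_le.1 hx)).not_ge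
  have hle' : ∀ x, cross (p u') (p v') (p x) ≤ 0 := fun x => by
    obtain ⟨w, hw⟩ := hneg'
    by_contra hx
    exact absurd (hp.side_of_isBdEdge huv' he' w x)
      (mul_neg_of_neg_of_pos hw (not_le.1 hx)).not_ge
  have h1 := h.cross_eq_zero h' (hle _) (hle _) (hle' _) (hle' _)
  have hu : u' = u := by
    rcases hp.mem_of_cross_eq_zero hφ huv he he'.not_isInterior.1 h1 with h2 | h2
    · exact h2
    · subst h2
      exact absurd h'.1 h.2.1.not_ge
  subst hu
  have h2 : cross (p u') (p v) (p v') = 0 := by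
    have := hle' v
    rw [cross_swap] at this
    exact le_antisymm (hle v') (by linarith)
  refine ⟨rfl, ?_⟩
  rcases hp.mem_of_cross_eq_zero hφ huv he he'.not_isInterior.2 h2 with h3 | h3
  · exact absurd h3.symm huv'
  · exact h3.symm

/-- Interior edges contribute zero to the ray casting count. -/
theorem IsTiling.sum_edgeTerm_le (hp : T.IsTiling φ p) (z : ℝ × ℝ) (u v : V) [Decidable
    (Above z (p u) (p v) ∧ T.IsBdEdge {u, v} ∧ ∃ w, cross (p u) (p v) (p w) < 0)] :
    ∑ f ∈ T.faces with u ∈ f ∧ v ∈ f, edgeTerm f p z u v ≤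
      if Above z (p u) (p v) ∧ T.IsBdEdge {u, v} ∧ ∃ w, cross (p u) (p v) (p w) < 0
        then 1 else 0 := by
  by_cases hA : Above z (p u) (p v)
  swap
  · rw [if_neg fun h => hA h.1]
    refine le_of_eq (Finset.sum_eq_zero fun f _ => if_neg hA)
  have huv : u ≠ v := by rintro rfl; exact absurd hA.2.2 (by simp)
  by_cases hadj : T.Adj u v
  swap
  · rw [Finset.filter_eq_empty_iff.2, Finset.sum_empty]
    · split_ifs <;> norm_num
    · exact fun f hf h => hadj (adj_of_mem hf h.1 h.2 huv)
  obtain ⟨c, hc⟩ := adj_iff_exists_third.1 hadj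
  have hterm : ∀ x, edgeTerm {u, v, x} p z u v =
      if cross (p u) (p v) (p x) < 0 then 1 else -1 := fun x => by
    simp [edgeTerm, hA]
  by_cases he : T.IsBdEdge {u, v}
  · have hs : T.faces.filter (fun f => u ∈ f ∧ v ∈ f) = {{u, v, c}} := by
      rw [Finset.eq_singleton_iff_unique_mem]
      refine ⟨by simp [hc], fun f hf => ?_⟩
      rw [Finset.mem_filter] at hf
      obtain ⟨d, rfl⟩ := exists_third hf.1 hf.2.1 hf.2.2 huv
      by_contra hne
      exact not_isBdEdge_of_ne hf.1 hc (fun h => hne (by rw [h])) he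
    rw [hs, Finset.sum_singleton, hterm]
    by_cases h : cross (p u) (p v) (p c) < 0
    · rw [if_pos h, if_pos ⟨hA, he, c, h⟩]
    · rw [if_neg h]
      split_ifs <;> norm_num
  · obtain ⟨d, hdc, hd, hcd⟩ := exists_other hc he
    have hs : T.faces.filter (fun f => u ∈ f ∧ v ∈ f) = {{u, v, c}, {u, v, d}} := by
      ext f
      rw [Finset.mem_filter, Finset.mem_insert, Finset.mem_singleton]
      constructor
      · rintro ⟨hf, hu, hv⟩
        obtain ⟨x, rfl⟩ := exists_third hf hu hv huv
        rcases hcd x hf with rfl | rfl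
        exacts [Or.inl rfl, Or.inr rfl]
      · rintro (rfl | rfl)
        exacts [⟨hc, by simp, by simp⟩, ⟨hd, by simp, by simp⟩]
    have hne : ({u, v, c} : Finset V) ≠ {u, v, d} := fun h => by
      have : c ∈ ({u, v, d} : Finset V) := by rw [← h]; simp
      have h3 := face_ne hc
      simp only [Finset.mem_insert, Finset.mem_singleton] at this
      rcases this with rfl | rfl | rfl
      exacts [h3.2.1 rfl, h3.2.2 rfl, hdc rfl]
    rw [hs, Finset.sum_pair hne, hterm, hterm,
      if_neg (fun h => he h.2.1 : ¬ (Above z (p u) (p v) ∧ T.IsBdEdge {u, v} ∧ _))]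
    rcases mul_neg_iff.1 (hp.opposite hc hd hdc.symm) with ⟨h1, h2⟩ | ⟨h1, h2⟩
    · rw [if_neg h1.le.not_gt, if_pos h2]; norm_num
    · rw [if_pos h1, if_neg h2.le.not_gt]; norm_num

/-- Open triangles are disjoint: the number of triangles around `z` is computed by the crossings
of the vertical upward ray from `z` with the boundary. -/
theorem IsTiling.face_eq_of_inTri (hp : T.IsTiling φ p) (hφ : IsStrictPolygon φ) {z : ℝ × ℝ}
    {a b c a' b' c' : V} (hf : {a, b, c} ∈ T.faces) (hf' : {a', b', c'} ∈ T.faces)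
    (hz : InTri (p a) (p b) (p c) z) (hz' : InTri (p a') (p b') (p c') z) :
    ({a, b, c} : Finset V) = {a', b', c'} := by
  classical
  by_contra hne
  have htotal : ∑ f ∈ T.faces, ∑ q ∈ f ×ˢ f, edgeTerm f p z q.1 q.2 ≤ 1 := by
    rw [Finset.sum_comm' (t' := Finset.univ)
      (s' := fun q : V × V => T.faces.filter fun f => q.1 ∈ f ∧ q.2 ∈ f)
      (by intro f q; simp [Finset.mem_product])]
    refine (Finset.sum_le_sum fun q _ => hp.sum_edgeTerm_le z q.1 q.2).trans ?_
    rw [← Finset.sum_filter, Finset.sum_const, nsmul_eq_mul, mul_one]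
    norm_cast
    rw [Finset.card_le_one]
    rintro ⟨u, v⟩ h ⟨u', v'⟩ h'
    simp only [Finset.mem_filter, Finset.mem_univ, true_and] at h h'
    obtain ⟨h1, h2⟩ := hp.top_edge_unique hφ h.1 h'.1 h.2.1 h'.2.1 h.2.2 h'.2.2
    rw [h1, h2]
  have hlow : ∑ f ∈ ({{a, b, c}, {a', b', c'}} : Finset (Finset V)),
      ∑ q ∈ f ×ˢ f, edgeTerm f p z q.1 q.2 ≤
      ∑ f ∈ T.faces, ∑ q ∈ f ×ˢ f, edgeTerm f p z q.1 q.2 := by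
    refine Finset.sum_le_sum_of_subset_of_nonneg ?_ fun f hf _ => ?_
    · rw [Finset.insert_subset_iff, Finset.singleton_subset_iff]
      exact ⟨hf, hf'⟩
    · obtain ⟨x, y, w, -, -, -, rfl⟩ := Finset.card_eq_three.1 (T.card_face f hf)
      rw [sum_edgeTerm z hf]
      exact (raySum_bound (hp.nondeg hf)).1
  rw [Finset.sum_pair hne, sum_edgeTerm z hf, sum_edgeTerm z hf'] at hlow
  have h1 := (raySum_bound (hp.nondeg hf)).2 hz
  have h2 := (raySum_bound (hp.nondeg hf')).2 hz'
  linarith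

/-- If the closed triangles with property `P` cover a neighbourhood of `z`, relative to the open
triangle `abc` whose closure contains `z`, then `abc` has property `P`. -/
theorem IsTiling.of_eventually (hp : T.IsTiling φ p) (hφ : IsStrictPolygon φ) {z : ℝ × ℝ}
    {a b c : V} (hf : {a, b, c} ∈ T.faces) (hz : InClosedTri (p a) (p b) (p c) z)
    {P : Finset V → Prop}
    (h : ∀ᶠ z' in 𝓝 z, InTri (p a) (p b) (p c) z' → ∃ x y w, {x, y, w} ∈ T.faces ∧
      P {x, y, w} ∧ InClosedTri (p x) (p y) (p w) z') : P {a, b, c} := by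
  obtain ⟨z', hz', h'⟩ := ((mem_closure_iff_frequently.1
    (hz.mem_closure (hp.nondeg hf))).and_eventually h).exists
  obtain ⟨x, y, w, hxyw, hP, hcl⟩ := h' hz'
  obtain ⟨z'', h1, h2⟩ := mem_closure_iff.1 (hcl.mem_closure (hp.nondeg hxyw)) _
    (isOpen_inTri (p a) (p b) (p c)) hz'
  rwa [hp.face_eq_of_inTri hφ hf hxyw h1 h2]

/-- A triangle that contains a point of the open edge `uv` has this edge as a side. -/
theorem IsTiling.mem_of_open_edge (hp : T.IsTiling φ p) (hφ : IsStrictPolygon φ) {u v : V}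
    (huv : T.Adj u v) {s t : ℝ} (hs : 0 < s) (ht : 0 < t) (hst : s + t = 1) {a b c : V}
    (hf : {a, b, c} ∈ T.faces) (hz : InClosedTri (p a) (p b) (p c) (s • p u + t • p v)) :
    u ∈ ({a, b, c} : Finset V) ∧ v ∈ ({a, b, c} : Finset V) := by
  obtain ⟨x, hx⟩ := adj_iff_exists_third.1 huv
  refine hp.of_eventually hφ hf hz (P := fun f => u ∈ f ∧ v ∈ f) ?_
  by_cases he : T.IsBdEdge {u, v}
  · filter_upwards [eventually_inClosedTri (hp.nondeg hx) hs ht hst] with z' h1 h2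
    exact ⟨u, v, x, hx, by simp, h1 (h2.nonneg (hp.nondeg hf)
      (hp.side_of_isBdEdge huv.1 he _ _) (hp.side_of_isBdEdge huv.1 he _ _)
      (hp.side_of_isBdEdge huv.1 he _ _))⟩
  · obtain ⟨y, hyx, hy, -⟩ := exists_other hx he
    filter_upwards [eventually_inClosedTri_or (hp.opposite hx hy hyx.symm) hs ht hst]
      with z' h1 _
    rcases h1 with h1 | h1
    exacts [⟨u, v, x, hx, by simp, h1⟩, ⟨u, v, y, hy, by simp, h1⟩]

/-- A triangle that contains an interior vertex has it as a vertex. -/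
theorem IsTiling.mem_of_interior (hp : T.IsTiling φ p) (hφ : IsStrictPolygon φ) {v : V}
    (hv : T.IsInterior v) {a b c : V} (hf : {a, b, c} ∈ T.faces)
    (hz : InClosedTri (p a) (p b) (p c) (p v)) : v ∈ ({a, b, c} : Finset V) := by
  refine hp.of_eventually hφ hf hz (P := fun f => v ∈ f) ?_
  have h : ∀ᶠ z' in 𝓝 (p v), ∀ w x, {v, w, x} ∈ T.faces →
      0 < cross (p v) (p w) (p x) * cross (p w) (p x) z' := by
    refine Filter.eventually_all.2 fun w => Filter.eventually_all.2 fun x => ?_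
    by_cases hx : {v, w, x} ∈ T.faces
    · have : ∀ᶠ z' in 𝓝 (p v), 0 < cross (p v) (p w) (p x) * cross (p w) (p x) z' := by
        refine (Continuous.tendsto (by fun_prop) _).eventually_const_lt ?_
        rw [cross_rotate (p v) (p w) (p x)]
        exact mul_self_pos.2 (hp.nondeg hx)
      filter_upwards [this] with z' h _ using h
    · exact Filter.Eventually.of_forall fun _ h => absurd h hx
  filter_upwards [h] with z' h _
  obtain ⟨w, x, hx, h1, h2⟩ := hp.exists_cone hv z'
  exact ⟨v, w, x, hx, by simp, h1, (h w x hx).le, h2⟩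

theorem inClosedTri_vertex (a b c : ℝ × ℝ) : InClosedTri a b c a := by
  refine ⟨by simp, ?_, by simp⟩
  rw [cross_rotate a b c]
  exact mul_self_nonneg _

theorem IsTiling.injective (hp : T.IsTiling φ p) (hφ : IsStrictPolygon φ)
    (hinj : Function.Injective φ) : Function.Injective p := by
  have key : ∀ v x, T.IsInterior v → p v = p x → v = x := by
    intro v x hv h
    by_contra hne
    obtain ⟨f, hf, hx⟩ := T.exists_face x
    obtain ⟨y, w, rfl⟩ := exists_eq_insert hf hx
    have hmem := hp.mem_of_interior hφ hv hf (by rw [h]; exact inClosedTri_vertex _ _ _)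
    obtain ⟨r, hr⟩ := exists_third hf hmem hx hne
    rw [hr] at hf
    exact hp.nondeg hf (by rw [h, cross_self_left])
  intro v x h
  by_cases hv : T.IsInterior v
  · exact key v x hv h
  by_cases hx : T.IsInterior x
  · exact (key x v hx h.symm).symm
  unfold IsInterior at hv hx
  push Not at hv hx
  obtain ⟨i, rfl⟩ := hv
  obtain ⟨j, rfl⟩ := hx
  rw [hp.bd, hp.bd] at h
  rw [hinj h]

theorem IsTiling.eq_of_mem_segment (hp : T.IsTiling φ p) (hφ : IsStrictPolygon φ)
    (hinj : Function.Injective φ) {u v x : V} (huv : T.Adj u v)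
    (hx : p x ∈ segment ℝ (p u) (p v)) : x = u ∨ x = v := by
  obtain ⟨s, t, hs, ht, hst, h⟩ := hx
  have hpinj := hp.injective hφ hinj
  rcases hs.eq_or_lt with rfl | hs
  · right
    obtain rfl : t = 1 := by linarith
    exact hpinj (by rw [← h]; simp)
  rcases ht.eq_or_lt with rfl | ht
  · left
    obtain rfl : s = 1 := by linarith
    exact hpinj (by rw [← h]; simp)
  by_contra hne
  rw [not_or] at hne
  obtain ⟨f, hf, hxf⟩ := T.exists_face x
  obtain ⟨y, w, rfl⟩ := exists_eq_insert hf hxf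
  have hmem := hp.mem_of_open_edge hφ huv hs ht hst hf (by rw [h]; exact inClosedTri_vertex _ _ _)
  obtain ⟨r, hr⟩ := exists_third hf hmem.1 hmem.2 huv.1
  rw [hr] at hf hxf
  simp only [Finset.mem_insert, Finset.mem_singleton] at hxf
  obtain rfl := (hxf.resolve_left hne.1).resolve_left hne.2
  refine hp.nondeg hf ?_
  rw [← h, cross_combo _ _ _ _ _ _ hst]
  simp

theorem IsTiling.segment_inter (hp : T.IsTiling φ p) (hφ : IsStrictPolygon φ)
    (hinj : Function.Injective φ) {u v x y : V} (huv : T.Adj u v) (hxy : T.Adj x y)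
    (hne : s(u, v) ≠ s(x, y)) :
    segment ℝ (p u) (p v) ∩ segment ℝ (p x) (p y) ⊆ p '' ({u, v} ∩ {x, y}) := by
  rintro z ⟨hz, hz'⟩
  have hend : ∀ w, p w ∈ segment ℝ (p u) (p v) → p w ∈ segment ℝ (p x) (p y) →
      p w ∈ p '' ({u, v} ∩ {x, y}) := fun w h1 h2 =>
    ⟨w, ⟨hp.eq_of_mem_segment hφ hinj huv h1, hp.eq_of_mem_segment hφ hinj hxy h2⟩, rfl⟩
  obtain ⟨s, t, hs, ht, hst, h⟩ := hz
  obtain ⟨s', t', hs', ht', hst', h'⟩ := hz'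
  rcases hs.eq_or_lt with rfl | hs
  · obtain rfl : t = 1 := by linarith
    rw [zero_smul, one_smul, zero_add] at h
    subst h
    exact hend v (right_mem_segment _ _ _) ⟨s', t', hs', ht', hst', h'⟩
  rcases ht.eq_or_lt with rfl | ht
  · obtain rfl : s = 1 := by linarith
    rw [zero_smul, one_smul, add_zero] at h
    subst h
    exact hend u (left_mem_segment _ _ _) ⟨s', t', hs', ht', hst', h'⟩
  rcases hs'.eq_or_lt with rfl | hs'
  · obtain rfl : t' = 1 := by linarith
    rw [zero_smul, one_smul, zero_add] at h'
    subst h'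
    exact hend y ⟨s, t, hs.le, ht.le, hst, h⟩ (right_mem_segment _ _ _)
  rcases ht'.eq_or_lt with rfl | ht'
  · obtain rfl : s' = 1 := by linarith
    rw [zero_smul, one_smul, add_zero] at h'
    subst h'
    exact hend x ⟨s, t, hs.le, ht.le, hst, h⟩ (left_mem_segment _ _ _)
  exfalso
  obtain ⟨r, hf⟩ := adj_iff_exists_third.1 huv
  have hD := hp.nondeg hf
  have hcl : InClosedTri (p u) (p v) (p r) z := by
    rw [← h]
    refine ⟨?_, ?_, ?_⟩ <;> rw [cross_combo _ _ _ _ _ _ hst]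
    · simp
    · rw [cross_rotate (p u) (p v) (p r), cross_self_outer, mul_zero, add_zero, mul_left_comm]
      exact mul_nonneg hs.le (mul_self_nonneg _)
    · rw [cross_self_right, mul_zero, zero_add, ← cross_rotate (p r) (p u) (p v), mul_left_comm]
      exact mul_nonneg ht.le (mul_self_nonneg _)
  rw [← h'] at hcl
  have hmem := hp.mem_of_open_edge hφ hxy hs' ht' hst' hf hcl
  -- the third vertex is an end of `xy`, so the point is off the line through `u` and `v`
  have hr : x = r ∨ y = r := by
    have h1 := hmem.1
    have h2 := hmem.2
    simp only [Finset.mem_insert, Finset.mem_singleton] at h1 h2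
    rcases h1 with rfl | rfl | rfl
    · rcases h2 with rfl | rfl | rfl
      · exact absurd rfl hxy.1
      · exact absurd rfl hne
      · exact Or.inr rfl
    · rcases h2 with rfl | rfl | rfl
      · exact absurd Sym2.eq_swap hne
      · exact absurd rfl hxy.1
      · exact Or.inr rfl
    · exact Or.inl rfl
  have h0 : s' * cross (p u) (p v) (p x) + t' * cross (p u) (p v) (p y) = 0 := by
    rw [← cross_combo _ _ _ _ _ _ hst', h', ← h, cross_combo _ _ _ _ _ _ hst]
    simp
  have hzero : ∀ w, w ∈ ({u, v, r} : Finset V) → w ≠ r → cross (p u) (p v) (p w) = 0 := by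
    intro w hw hwr
    simp only [Finset.mem_insert, Finset.mem_singleton] at hw
    rcases hw with rfl | rfl | rfl
    · simp
    · simp
    · exact absurd rfl hwr
  rcases hr with rfl | rfl
  · rw [hzero y hmem.2 hxy.1.symm, mul_zero, add_zero] at h0
    exact hD ((mul_eq_zero.1 h0).resolve_left hs'.ne')
  · rw [hzero x hmem.1 hxy.1, mul_zero, zero_add] at h0
    exact hD ((mul_eq_zero.1 h0).resolve_left ht'.ne')

end DiskTriangulation

namespace DiskTriangulation

variable {V : Type*} [Fintype V] [DecidableEq V] {n : ℕ} [NeZero n] {T : DiskTriangulation V n}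
  {p : V → ℝ × ℝ} {φ : Fin n → ℝ × ℝ} {w : V → V → ℝ}

/-! ### Convex combination maps -/

open Classical in
variable (T) in
/-- The set of neighbours of `v`. -/
noncomputable def neighbors (v : V) : Finset V := {u | T.Adj v u}

theorem mem_neighbors {v u : V} : u ∈ T.neighbors v ↔ T.Adj v u := by
  simp [neighbors]

variable (T) in
/-- `h` is in equilibrium at every interior vertex with respect to the weights `w`. -/
def IsHarmonic (w : V → V → ℝ) (h : V → ℝ) : Prop :=
  ∀ v, T.IsInterior v → ∑ u ∈ T.neighbors v, w v u * (h u - h v) = 0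

theorem IsHarmonic.neg {h : V → ℝ} (hh : T.IsHarmonic w h) : T.IsHarmonic w fun v => - h v :=
  fun v hv => by
    rw [← neg_eq_zero, ← hh v hv, ← Finset.sum_neg_distrib]
    exact Finset.sum_congr rfl fun u _ => by ring

/-- An affine function of two harmonic functions is harmonic. -/
theorem IsHarmonic.affine {g h : V → ℝ} (hg : T.IsHarmonic w g) (hh : T.IsHarmonic w h)
    (α β γ : ℝ) : T.IsHarmonic w fun v => α * g v + β * h v + γ := fun v hv => by
  have : ∑ u ∈ T.neighbors v, w v u * (α * g u + β * h u + γ - (α * g v + β * h v + γ)) =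
      α * ∑ u ∈ T.neighbors v, w v u * (g u - g v) +
      β * ∑ u ∈ T.neighbors v, w v u * (h u - h v) := by
    rw [Finset.mul_sum, Finset.mul_sum, ← Finset.sum_add_distrib]
    exact Finset.sum_congr rfl fun u _ => by ring
  rw [this, hg v hv, hh v hv, mul_zero, mul_zero, add_zero]

theorem IsHarmonic.eq_of_le (hw : ∀ v u, 0 < w v u) {h : V → ℝ} (hh : T.IsHarmonic w h) {v : V}
    (hv : T.IsInterior v) (hle : ∀ u, T.Adj v u → h u ≤ h v) {u : V} (hu : T.Adj v u) :
    h u = h v := by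
  have h0 := (Finset.sum_eq_zero_iff_of_nonpos fun u hu => mul_nonpos_of_nonneg_of_nonpos
    (hw v u).le (sub_nonpos.2 (hle u (mem_neighbors.1 hu)))).1 (hh v hv) u (mem_neighbors.2 hu)
  exact sub_eq_zero.1 ((mul_eq_zero.1 h0).resolve_left (hw v u).ne')

theorem IsHarmonic.flat_or (hw : ∀ v u, 0 < w v u) {h : V → ℝ} (hh : T.IsHarmonic w h) {v : V}
    (hv : T.IsInterior v) : T.IsFlat h v ∨ T.HasLower h v ∧ T.HasUpper h v := by
  by_cases h1 : T.HasUpper h v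
  · by_cases h2 : T.HasLower h v
    · exact Or.inr ⟨h2, h1⟩
    · unfold HasLower at h2
      push Not at h2
      exact Or.inl ⟨hv, fun u hu => neg_injective
        (hh.neg.eq_of_le hw hv (fun u hu => neg_le_neg (h2 u hu)) hu)⟩
  · unfold HasUpper at h1
    push Not at h1
    exact Or.inl ⟨hv, fun u hu => hh.eq_of_le hw hv h1 hu⟩

/-- The maximum principle. -/
theorem IsHarmonic.le_of_bd_le (hw : ∀ v u, 0 < w v u) {h : V → ℝ} (hh : T.IsHarmonic w h)
    {M : ℝ} (hM : ∀ i, h (T.bd i) ≤ M) (v : V) : h v ≤ M := by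
  obtain ⟨m, -, hm⟩ := Finset.exists_max_image Finset.univ h ⟨v, Finset.mem_univ v⟩
  refine (hm v (Finset.mem_univ v)).trans ?_
  by_contra hlt
  have hclosed := eq_univ_of_closed (T := T) (S := {x | h x = h m}) ⟨m, rfl⟩ (fun x hx u hu => by
    refine (hh.eq_of_le hw (fun i hi => ?_) (fun u _ => ?_) hu).trans hx
    · rw [Set.mem_ofPred_eq, ← hi] at hx
      exact hlt (hx ▸ hM i)
    · rw [Set.mem_ofPred_eq] at hx
      rw [hx]
      exact hm u (Finset.mem_univ u)) (T.bd 0)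
  exact hlt (hclosed ▸ hM 0)

theorem IsHarmonic.eq_zero (hw : ∀ v u, 0 < w v u) {h : V → ℝ} (hh : T.IsHarmonic w h)
    (h0 : ∀ i, h (T.bd i) = 0) (v : V) : h v = 0 := by
  refine le_antisymm (hh.le_of_bd_le hw (fun i => (h0 i).le) v) ?_
  have := hh.neg.le_of_bd_le hw (fun i => (neg_eq_zero.2 (h0 i)).le) v
  linarith

open Classical in
variable (T) in
/-- The matrix of the linear system for harmonic functions with given boundary values. -/
noncomputable def tutteMatrix (w : V → V → ℝ) : Matrix V V ℝ := fun v u =>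
  if T.IsInterior v then (if u ∈ T.neighbors v then w v u else 0) -
    (if u = v then ∑ x ∈ T.neighbors v, w v x else 0) else if u = v then 1 else 0

theorem tutteMatrix_mulVec_interior {v : V} (hv : T.IsInterior v) (h : V → ℝ) :
    (T.tutteMatrix w).mulVec h v = ∑ u ∈ T.neighbors v, w v u * (h u - h v) := by
  simp only [Matrix.mulVec, dotProduct, tutteMatrix, if_pos hv, sub_mul, Finset.sum_sub_distrib,
    mul_sub, ite_mul, zero_mul, Finset.sum_ite_eq', Finset.mem_univ, if_true, Finset.sum_ite_mem,
    Finset.univ_inter, Finset.sum_mul]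

theorem tutteMatrix_mulVec_bd {v : V} (hv : ¬ T.IsInterior v) (h : V → ℝ) :
    (T.tutteMatrix w).mulVec h v = h v := by
  simp [Matrix.mulVec, dotProduct, tutteMatrix, if_neg hv]

/-- The Dirichlet problem is uniquely solvable, by the maximum principle. -/
theorem det_tutteMatrix_ne_zero (hw : ∀ v u, 0 < w v u) : (T.tutteMatrix w).det ≠ 0 := by
  intro hdet
  obtain ⟨h, hne, h0⟩ := Matrix.exists_mulVec_eq_zero_iff.2 hdet
  refine hne (funext fun v => IsHarmonic.eq_zero (T := T) hw (fun v hv => ?_) (fun i => ?_) v)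
  · rw [← tutteMatrix_mulVec_interior hv, h0]; rfl
  · rw [← tutteMatrix_mulVec_bd (T := T) (w := w) (fun hi => hi i rfl) h, h0]; rfl

variable (T) in
/-- The harmonic function with boundary values `b`, by Cramer's rule. -/
noncomputable def harmonicExt (b : Fin n → ℝ) (w : V → V → ℝ) : V → ℝ :=
  (T.tutteMatrix w).det⁻¹ • (T.tutteMatrix w).adjugate.mulVec (Function.extend T.bd b 0)

theorem tutteMatrix_mulVec_harmonicExt (hw : ∀ v u, 0 < w v u) (b : Fin n → ℝ) :
    (T.tutteMatrix w).mulVec (T.harmonicExt b w) = Function.extend T.bd b 0 := by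
  rw [harmonicExt, Matrix.mulVec_smul, Matrix.mulVec_mulVec, Matrix.mul_adjugate,
    Matrix.smul_mulVec, Matrix.one_mulVec, smul_smul,
    inv_mul_cancel₀ (det_tutteMatrix_ne_zero hw), one_smul]

theorem harmonicExt_bd (hw : ∀ v u, 0 < w v u) (b : Fin n → ℝ) (i : Fin n) :
    T.harmonicExt b w (T.bd i) = b i := by
  rw [← tutteMatrix_mulVec_bd (T := T) (w := w) (fun hi => hi i rfl) (T.harmonicExt b w),
    tutteMatrix_mulVec_harmonicExt hw, T.bd_injective.extend_apply]

theorem isHarmonic_harmonicExt (hw : ∀ v u, 0 < w v u) (b : Fin n → ℝ) :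
    T.IsHarmonic w (T.harmonicExt b w) := fun v hv => by
  rw [← tutteMatrix_mulVec_interior hv, tutteMatrix_mulVec_harmonicExt hw,
    Function.extend_apply' _ _ _ (fun ⟨i, hi⟩ => hv i hi)]
  rfl

theorem continuous_tutteMatrix : Continuous fun w => T.tutteMatrix w := by
  refine continuous_matrix fun v u => ?_
  unfold tutteMatrix
  split_ifs <;> fun_prop

theorem continuousOn_harmonicExt (b : Fin n → ℝ) :
    ContinuousOn (T.harmonicExt b) {w | ∀ v u, 0 < w v u} := by
  have h1 : Continuous fun w => (T.tutteMatrix w).det := continuous_tutteMatrix.matrix_det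
  have h2 : Continuous fun w =>
      (T.tutteMatrix w).adjugate.mulVec (Function.extend T.bd b 0) :=
    continuous_tutteMatrix.matrix_adjugate.matrix_mulVec continuous_const
  exact (h1.continuousOn.inv₀ fun w hw => det_tutteMatrix_ne_zero hw).smul h2.continuousOn

variable (T) in
/-- Every interior vertex is the weighted mean of its neighbours with respect to `w`. -/
def IsBalanced (w : V → V → ℝ) (p : V → ℝ × ℝ) : Prop :=
  ∀ v, T.IsInterior v → ∑ u ∈ T.neighbors v, w v u • (p u - p v) = 0

theorem isBalanced_iff : T.IsBalanced w p ↔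
    T.IsHarmonic w (fun v => (p v).1) ∧ T.IsHarmonic w fun v => (p v).2 := by
  unfold IsBalanced IsHarmonic
  simp only [Prod.ext_iff, Prod.fst_sum, Prod.snd_sum, Prod.smul_fst, Prod.smul_snd, Prod.fst_sub,
    Prod.snd_sub, smul_eq_mul, Prod.fst_zero, Prod.snd_zero]
  exact ⟨fun h => ⟨fun v hv => (h v hv).1, fun v hv => (h v hv).2⟩,
    fun h v hv => ⟨h.1 v hv, h.2 v hv⟩⟩

theorem IsBalanced.affine (hp : T.IsBalanced w p) (α β γ : ℝ) :
    T.IsHarmonic w fun v => α * (p v).1 + β * (p v).2 + γ :=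
  (isBalanced_iff.1 hp).1.affine (isBalanced_iff.1 hp).2 α β γ

variable (T) in
/-- The convex combination map with weights `w` and boundary values `φ`. -/
noncomputable def tutteMap (φ : Fin n → ℝ × ℝ) (w : V → V → ℝ) (v : V) : ℝ × ℝ :=
  (T.harmonicExt (fun i => (φ i).1) w v, T.harmonicExt (fun i => (φ i).2) w v)

theorem tutteMap_bd (hw : ∀ v u, 0 < w v u) (i : Fin n) : T.tutteMap φ w (T.bd i) = φ i :=
  Prod.ext (harmonicExt_bd hw _ i) (harmonicExt_bd hw _ i)

theorem isBalanced_tutteMap (hw : ∀ v u, 0 < w v u) : T.IsBalanced w (T.tutteMap φ w) :=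
  isBalanced_iff.2 ⟨isHarmonic_harmonicExt hw _, isHarmonic_harmonicExt hw _⟩

theorem IsBalanced.eq_tutteMap (hw : ∀ v u, 0 < w v u) (hp : T.IsBalanced w p)
    (hbd : ∀ i, p (T.bd i) = φ i) : p = T.tutteMap φ w := by
  have key : ∀ (g h : V → ℝ), T.IsHarmonic w g → T.IsHarmonic w h →
      (∀ i, g (T.bd i) = h (T.bd i)) → ∀ v, g v = h v := fun g h hg hh hgh v => by
    have := (hg.affine hh 1 (-1) 0).eq_zero hw (fun i => by rw [hgh i]; ring) v
    linarith
  have h1 := isBalanced_iff.1 hp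
  have h2 := isBalanced_iff.1 (isBalanced_tutteMap (T := T) (φ := φ) hw)
  funext v
  exact Prod.ext (key _ _ h1.1 h2.1 (fun i => by rw [hbd, tutteMap_bd hw]) v)
    (key _ _ h1.2 h2.2 (fun i => by rw [hbd, tutteMap_bd hw]) v)

theorem continuousOn_tutteMap (φ : Fin n → ℝ × ℝ) :
    ContinuousOn (T.tutteMap φ) {w | ∀ v u, 0 < w v u} :=
  continuousOn_pi.2 fun v => ((continuous_apply v).comp_continuousOn
    (continuousOn_harmonicExt _)).prodMk ((continuous_apply v).comp_continuousOn
    (continuousOn_harmonicExt _))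

/-! ### Convex combination maps onto a strictly convex polygon are embeddings -/

theorem _root_.eq_zero_of_const_on_triangle {a b c : ℝ × ℝ} {α β : ℝ} (hD : cross a b c ≠ 0)
    (hab : α * a.1 + β * a.2 = α * b.1 + β * b.2) (hac : α * a.1 + β * a.2 = α * c.1 + β * c.2) :
    α = 0 ∧ β = 0 := by
  constructor
  · refine (mul_eq_zero.1 (?_ : cross a b c * α = 0)).resolve_left hD
    unfold cross
    linear_combination (b.2 - a.2) * hac - (c.2 - a.2) * hab
  · refine (mul_eq_zero.1 (?_ : cross a b c * β = 0)).resolve_left hD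
    unfold cross
    linear_combination (c.1 - a.1) * hab - (b.1 - a.1) * hac

theorem _root_.IsStrictPolygon.cross_ne_zero (hn : 3 ≤ n) (hφ : IsStrictPolygon φ)
    (i : Fin n) : cross (φ i) (φ (i + 1)) (φ (i + 1 + 1)) ≠ 0 := fun h => by
  have := hφ i (i + 1 + 1) (i + 1 + 1) (Fin.add_one_add_one_ne_self hn i)
    (Fin.add_one_ne_self hn _) (Fin.add_one_add_one_ne_self hn i) (Fin.add_one_ne_self hn _)
  rw [h] at this
  simp at this

/-- A linear function on a strictly convex polygon is unimodal along the boundary, because the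
polygon lies in the cone spanned by the two sides at any of its corners. -/
theorem _root_.IsStrictPolygon.isUnimodal (hn : 3 ≤ n) (hφ : IsStrictPolygon φ) {α β : ℝ}
    (hαβ : ¬ (α = 0 ∧ β = 0)) : IsUnimodal fun i => α * (φ i).1 + β * (φ i).2 := by
  intro i h1 h2 j
  obtain ⟨k, rfl⟩ : ∃ k, i = k + 1 := ⟨i - 1, by rw [sub_add_cancel]⟩
  rw [add_sub_cancel_right] at h2 ⊢
  simp only at h1 h2 ⊢
  by_cases hj : j = k + 1
  · subst hj; exact ⟨le_rfl, fun _ => Or.inl rfl⟩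
  by_cases hj1 : j = k + 1 + 1
  · subst hj1; exact ⟨h1, fun _ => Or.inr (Or.inl rfl)⟩
  by_cases hj2 : j = k
  · subst hj2; exact ⟨h2, fun _ => Or.inr (Or.inr rfl)⟩
  have hk1 := Fin.add_one_ne_self hn k
  have hk2 := Fin.add_one_add_one_ne_self hn k
  have hk3 := Fin.add_one_ne_self hn (k + 1)
  have hD := hφ.cross_ne_zero hn k
  have c1 := hφ k (k + 1 + 1) j hk2 hk3 hj2 hj
  have c2 := hφ (k + 1) k j hk1.symm hk2.symm hj hj1
  rw [cross_rotate (φ k)] at c2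
  set A := φ k
  set B := φ (k + 1)
  set C := φ (k + 1 + 1)
  set J := φ j
  have key : cross A B C * cross A B C * ((α * J.1 + β * J.2) - (α * B.1 + β * B.2)) =
      cross A B C * cross A B J * ((α * C.1 + β * C.2) - (α * B.1 + β * B.2)) +
      cross A B C * cross B C J * ((α * A.1 + β * A.2) - (α * B.1 + β * B.2)) := by
    unfold cross; ring
  have n1 := mul_nonpos_of_nonneg_of_nonpos c1.le (sub_nonpos.2 h1)
  have n2 := mul_nonpos_of_nonneg_of_nonpos c2.le (sub_nonpos.2 h2)
  have hD2 := mul_self_pos.2 hD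
  refine ⟨?_, fun heq => ?_⟩
  · by_contra hlt
    have := mul_pos hD2 (sub_pos.2 (not_le.1 hlt))
    linarith
  · rw [heq, sub_self, mul_zero] at key
    have e1 := (mul_eq_zero.1 (by linarith : cross A B C * cross A B J *
      ((α * C.1 + β * C.2) - (α * B.1 + β * B.2)) = 0)).resolve_left c1.ne'
    have e2 := (mul_eq_zero.1 (by linarith : cross A B C * cross B C J *
      ((α * A.1 + β * A.2) - (α * B.1 + β * B.2)) = 0)).resolve_left c2.ne'
    exact absurd (eq_zero_of_const_on_triangle hD (by linarith) (by linarith)) hαβ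

theorem IsBalanced.isTutte (hw : ∀ v u, 0 < w v u) (hφ : IsStrictPolygon φ)
    (hp : T.IsBalanced w p) (hbd : ∀ i, p (T.bd i) = φ i) {α β : ℝ}
    (hαβ : ¬ (α = 0 ∧ β = 0)) : T.IsTutte fun v => α * (p v).1 + β * (p v).2 where
  harmonic v hv := by
    have := hp.affine α β 0
    simp only [add_zero] at this
    exact this.flat_or hw hv
  top := by
    simp only [hbd]
    exact hφ.isUnimodal T.three_le hαβ
  bot := by
    have := hφ.isUnimodal T.three_le (α := -α) (β := -β) (by simpa using hαβ)
    simp only [hbd]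
    convert this using 2
    ring
  nonconst := by
    by_contra! hcon
    simp only [hbd] at hcon
    exact hαβ (eq_zero_of_const_on_triangle (hφ.cross_ne_zero T.three_le 0) (hcon _ _) (hcon _ _))

/-- Collapsed and folded triangles are excluded by the linear functions that are constant on one
of their edges. -/
theorem IsBalanced.isUnfolded (hw : ∀ v u, 0 < w v u) (hφ : IsStrictPolygon φ)
    (hp : T.IsBalanced w p) (hbd : ∀ i, p (T.bd i) = φ i) : T.IsUnfolded p := by
  -- the linear functions whose level lines are parallel to the line from `p a` to `x`
  have hdir : ∀ a (x : ℝ × ℝ), x ≠ p a →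
      T.IsTutte fun v => -(x.2 - (p a).2) * (p v).1 + (x.1 - (p a).1) * (p v).2 := fun a x hx =>
    hp.isTutte hw hφ hbd fun h => hx (Prod.ext (by linarith [h.2]) (by linarith [h.1]))
  have hcross : ∀ (a x y : ℝ × ℝ), -(x.2 - a.2) * y.1 + (x.1 - a.1) * y.2 =
      -(x.2 - a.2) * a.1 + (x.1 - a.1) * a.2 + cross a x y := fun a x y => by unfold cross; ring
  have hnondeg : ∀ {a b c}, {a, b, c} ∈ T.faces → cross (p a) (p b) (p c) ≠ 0 := by
    intro a b c hf h0
    by_cases hab : p b = p a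
    · by_cases hac : p c = p a
      · exact (hp.isTutte hw hφ hbd (α := 1) (β := 0) (by simp)).not_const hf
          (by rw [hab]) (by rw [hac])
      · refine (hdir a (p c) hac).not_const hf (by simp only [hab]) ?_
        rw [hcross _ _ (p c), cross_self_right, add_zero]
    · refine (hdir a (p b) hab).not_const hf ?_ ?_
      · rw [hcross _ _ (p b), cross_self_right, add_zero]
      · rw [hcross _ _ (p c), h0, add_zero]
  refine ⟨hnondeg, fun {a b c d} hc hd hcd => ?_⟩
  have hba : p b ≠ p a := fun h => hnondeg hc (by rw [h, cross_self_left])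
  have ht := hdir a (p b) hba
  have hab : -((p b).2 - (p a).2) * (p a).1 + ((p b).1 - (p a).1) * (p a).2 =
      -((p b).2 - (p a).2) * (p b).1 + ((p b).1 - (p a).1) * (p b).2 := by ring
  rcases lt_or_gt_of_ne (hnondeg hd) with h1 | h1
  · have := ht.neg.lt_of_lt hc hd hcd (by simp only [hab]) (by
      rw [hcross _ _ (p d)]; linarith)
    rw [hcross _ _ (p c)] at this
    exact mul_neg_of_pos_of_neg (by linarith) h1
  · have := ht.lt_of_lt hc hd hcd hab (by rw [hcross _ _ (p d)]; linarith)
    rw [hcross _ _ (p c)] at this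
    exact mul_neg_of_neg_of_pos (by linarith) h1

theorem IsBalanced.isTiling (hw : ∀ v u, 0 < w v u) (hφ : IsStrictPolygon φ)
    (hp : T.IsBalanced w p) (hbd : ∀ i, p (T.bd i) = φ i) : T.IsTiling φ p where
  toIsUnfolded := hp.isUnfolded hw hφ hbd
  bd := hbd
  side i v x := by
    set r := cross (φ i) (φ (i + 1)) (φ (i + 1 + 1)) with hr
    have hr2 := mul_self_pos.2 (hφ.cross_ne_zero T.three_le i)
    have hbdr : ∀ j, - (r * cross (φ i) (φ (i + 1)) (φ j)) ≤ 0 := fun j => by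
      by_cases h1 : j = i
      · simp [h1]
      by_cases h2 : j = i + 1
      · simp [h2]
      have := hφ i (i + 1 + 1) j (Fin.add_one_add_one_ne_self T.three_le i)
        (Fin.add_one_ne_self T.three_le _) h1 h2
      linarith
    have hform : ∀ z : ℝ × ℝ, - (r * cross (φ i) (φ (i + 1)) z) =
        r * ((φ (i + 1)).2 - (φ i).2) * z.1 + -r * ((φ (i + 1)).1 - (φ i).1) * z.2 +
        - r * (((φ (i + 1)).2 - (φ i).2) * (φ i).1 - ((φ (i + 1)).1 - (φ i).1) * (φ i).2) :=
      fun z => by unfold cross; ring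
    have hall : ∀ v, - (r * cross (φ i) (φ (i + 1)) (p v)) ≤ 0 := fun v => by
      rw [hform]
      refine (hp.affine _ _ _).le_of_bd_le hw (fun j => ?_) v
      rw [hbd, ← hform]
      exact hbdr j
    have h3 := mul_nonneg_of_nonpos_of_nonpos (hall v) (hall x)
    have h4 : 0 ≤ r * r * (cross (φ i) (φ (i + 1)) (p v) * cross (φ i) (φ (i + 1)) (p x)) := by
      linarith
    exact nonneg_of_mul_nonneg_right h4 hr2

theorem IsBalanced.mem_convexHull (hw : ∀ v u, 0 < w v u) (hp : T.IsBalanced w p)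
    (hbd : ∀ i, p (T.bd i) = φ i) (v : V) : p v ∈ convexHull ℝ (Set.range φ) := by
  by_contra hv
  obtain ⟨f, u, h1, h2⟩ := geometric_hahn_banach_closed_point (convex_convexHull ℝ _)
    ((Set.finite_range φ).isClosed_convexHull ℝ) hv
  have hf : ∀ z : ℝ × ℝ, f z = f (1, 0) * z.1 + f (0, 1) * z.2 + 0 := fun z => by
    have : z = z.1 • ((1, 0) : ℝ × ℝ) + z.2 • ((0, 1) : ℝ × ℝ) := by ext <;> simp
    conv_lhs => rw [this, map_add, map_smul, map_smul]
    simp only [smul_eq_mul]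
    ring
  have := (hp.affine (f (1, 0)) (f (0, 1)) 0).le_of_bd_le hw (M := u) (fun i => by
    rw [hbd, ← hf]
    exact (h1 _ (subset_convexHull ℝ _ (Set.mem_range_self i))).le) v
  rw [← hf] at this
  exact this.not_gt h2

end DiskTriangulation

/-! ### Triangles and segments -/

theorem mem_segment_of_cross_eq_zero {a b c z : ℝ × ℝ} (hD : cross a b c ≠ 0)
    (h : InClosedTri a b c z) (h0 : cross a b z = 0) : z ∈ segment ℝ a b := by
  have hsum := cross_sum a b c z
  rw [h0, add_zero] at hsum
  have hD2 := mul_self_pos.2 hD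
  refine ⟨cross b c z / cross a b c, cross c a z / cross a b c, ?_, ?_, ?_, ?_⟩
  · rw [← mul_div_mul_left _ _ hD]; exact div_nonneg h.2.1 hD2.le
  · rw [← mul_div_mul_left _ _ hD]; exact div_nonneg h.2.2 hD2.le
  · rw [← add_div, hsum, div_self hD]
  · have e1 : cross b c z * a.1 + cross c a z * b.1 = cross a b c * z.1 := by
      have : cross b c z * a.1 + cross c a z * b.1 + cross a b z * c.1 = cross a b c * z.1 := by
        unfold cross; ring
      rw [← this, h0]; ring
    have e2 : cross b c z * a.2 + cross c a z * b.2 = cross a b c * z.2 := by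
      have : cross b c z * a.2 + cross c a z * b.2 + cross a b z * c.2 = cross a b c * z.2 := by
        unfold cross; ring
      rw [← this, h0]; ring
    ext
    · simp only [Prod.fst_add, Prod.smul_fst, smul_eq_mul]; field_simp; linarith
    · simp only [Prod.snd_add, Prod.smul_snd, smul_eq_mul]; field_simp; linarith

theorem exists_eq_add_smul_of_cross_eq_zero {a b c : ℝ × ℝ} (hab : a ≠ b)
    (h : cross a b c = 0) : ∃ t : ℝ, c = a + t • (b - a) := by
  by_cases h1 : b.1 - a.1 = 0
  · have h2 : b.2 - a.2 ≠ 0 := fun h2 => hab (Prod.ext (by linarith) (by linarith))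
    refine ⟨(c.2 - a.2) / (b.2 - a.2), Prod.ext ?_ ?_⟩
    · have : c.1 - a.1 = 0 := by
        unfold cross at h
        rw [h1, zero_mul, zero_sub, neg_eq_zero] at h
        exact (mul_eq_zero.1 h).resolve_left h2
      simp [h1]; linarith
    · simp [h2]
  · refine ⟨(c.1 - a.1) / (b.1 - a.1), Prod.ext ?_ ?_⟩
    · simp [h1]
    · unfold cross at h
      simp only [Prod.snd_add, Prod.smul_snd, Prod.snd_sub, smul_eq_mul]
      field_simp
      linarith

theorem mem_segment_of_collinear {a b c : ℝ × ℝ} (h : cross a b c = 0) :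
    a ∈ segment ℝ b c ∨ b ∈ segment ℝ a c ∨ c ∈ segment ℝ a b := by
  by_cases hab : a = b
  · exact Or.inl (hab ▸ left_mem_segment ℝ a c)
  obtain ⟨t, ht⟩ := exists_eq_add_smul_of_cross_eq_zero hab h
  subst ht
  rcases lt_or_ge t 0 with h1 | h1
  · left
    have h2 : 1 - t ≠ 0 := by linarith
    refine ⟨-t / (1 - t), 1 / (1 - t), div_nonneg (by linarith) (by linarith),
      div_nonneg zero_le_one (by linarith), by field_simp; ring, ?_⟩
    ext <;> simp <;> field_simp <;> ring
  rcases le_or_gt t 1 with h2 | h2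
  · right; right
    refine ⟨1 - t, t, by linarith, h1, by ring, ?_⟩
    ext <;> simp <;> ring
  · right; left
    have h3 : t ≠ 0 := by linarith
    refine ⟨(t - 1) / t, 1 / t, div_nonneg (by linarith) (by linarith),
      div_nonneg zero_le_one (by linarith), by field_simp; ring, ?_⟩
    ext <;> simp <;> field_simp <;> ring

/-- Every point of a triangle lies on a segment from `a` to the opposite side. -/
theorem InClosedTri.exists_segment {a b c z : ℝ × ℝ} (hD : cross a b c ≠ 0)
    (h : InClosedTri a b c z) : ∃ y ∈ segment ℝ b c, z ∈ segment ℝ a y := by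
  have hD2 := mul_self_pos.2 hD
  have hsum : cross b c z / cross a b c + cross c a z / cross a b c + cross a b z / cross a b c
      = 1 := by rw [← add_div, ← add_div, cross_sum, div_self hD]
  have hnn : ∀ r, 0 ≤ cross a b c * r → 0 ≤ r / cross a b c := fun r hr => by
    rw [← mul_div_mul_left _ _ hD]; exact div_nonneg hr hD2.le
  have hα := hnn _ h.2.1
  have hβ := hnn _ h.2.2
  have hγ := hnn _ h.1
  have e1 : z.1 = cross b c z / cross a b c * a.1 + cross c a z / cross a b c * b.1 +
      cross a b z / cross a b c * c.1 := by
    field_simp; unfold cross; ring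
  have e2 : z.2 = cross b c z / cross a b c * a.2 + cross c a z / cross a b c * b.2 +
      cross a b z / cross a b c * c.2 := by
    field_simp; unfold cross; ring
  generalize cross b c z / cross a b c = α at *
  generalize cross c a z / cross a b c = β at *
  generalize cross a b z / cross a b c = γ at *
  by_cases h0 : β + γ = 0
  · have hβ0 : β = 0 := by linarith
    have hγ0 : γ = 0 := by linarith
    have hα1 : α = 1 := by linarith
    refine ⟨b, left_mem_segment _ _ _, ?_⟩
    have : z = a := Prod.ext (by rw [e1, hα1, hβ0, hγ0]; ring) (by rw [e2, hα1, hβ0, hγ0]; ring)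
    rw [this]; exact left_mem_segment _ _ _
  · have hpos : 0 ≤ β + γ := by linarith
    refine ⟨(β / (β + γ)) • b + (γ / (β + γ)) • c, ⟨_, _, div_nonneg hβ hpos,
      div_nonneg hγ hpos, by rw [← add_div, div_self h0], rfl⟩, α, β + γ, hα, hpos,
      by linarith, ?_⟩
    ext
    · simp only [Prod.fst_add, Prod.smul_fst, smul_eq_mul, e1]; field_simp; ring
    · simp only [Prod.snd_add, Prod.smul_snd, smul_eq_mul, e2]; field_simp; ring

/-- A segment from the interior of a triangle to a point outside of it meets a side. -/
theorem InTri.exists_mem_side {a b c z z' : ℝ × ℝ} (hD : cross a b c ≠ 0) (hz : InTri a b c z)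
    (hz' : ¬ InClosedTri a b c z') : ∃ y ∈ segment ℝ z z',
      y ∈ segment ℝ a b ∨ y ∈ segment ℝ b c ∨ y ∈ segment ℝ c a := by
  let γ : ℝ → ℝ × ℝ := fun t => (1 - t) • z + t • z'
  let f : ℝ → ℝ := fun t => min (cross a b c * cross a b (γ t))
    (min (cross a b c * cross b c (γ t)) (cross a b c * cross c a (γ t)))
  have hγ : Continuous γ := by fun_prop
  have hf : Continuous f := by fun_prop
  have h0 : γ 0 = z := by simp [γ]
  have h1 : γ 1 = z' := by simp [γ]
  have hf0 : 0 < f 0 := by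
    simp only [f, h0]
    exact lt_min hz.1 (lt_min hz.2.1 hz.2.2)
  have hf1 : f 1 < 0 := by
    by_contra h
    push Not at h
    simp only [f, h1, le_min_iff] at h
    exact hz' h
  obtain ⟨t, ht, hft⟩ := intermediate_value_Icc' zero_le_one hf.continuousOn
    (Set.mem_Icc.2 ⟨hf1.le, hf0.le⟩)
  have hcl : InClosedTri a b c (γ t) := by
    have : 0 ≤ f t := hft.ge
    simp only [f, le_min_iff] at this
    exact this
  refine ⟨γ t, ⟨1 - t, t, by linarith [ht.2], ht.1, by ring, rfl⟩, ?_⟩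
  have hrot : ∀ {a b c : ℝ × ℝ}, InClosedTri a b c (γ t) → InClosedTri b c a (γ t) :=
    fun {a b c} h => ⟨by rw [cross_rotate a]; exact h.2.1, by rw [cross_rotate a]; exact h.2.2,
      by rw [cross_rotate a]; exact h.1⟩
  have hD1 : cross b c a ≠ 0 := by rwa [cross_rotate]
  have hD2 : cross c a b ≠ 0 := by rwa [cross_rotate b c a]
  simp only [f] at hft
  rcases min_choice (cross a b c * cross a b (γ t))
    (min (cross a b c * cross b c (γ t)) (cross a b c * cross c a (γ t))) with h2 | h2
  · rw [h2] at hft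
    exact Or.inl (mem_segment_of_cross_eq_zero hD hcl ((mul_eq_zero.1 hft).resolve_left hD))
  · rcases min_choice (cross a b c * cross b c (γ t)) (cross a b c * cross c a (γ t)) with h3 | h3
    · rw [h2, h3] at hft
      exact Or.inr (Or.inl (mem_segment_of_cross_eq_zero hD1 (hrot hcl)
        ((mul_eq_zero.1 hft).resolve_left hD)))
    · rw [h2, h3] at hft
      exact Or.inr (Or.inr (mem_segment_of_cross_eq_zero hD2 (hrot (hrot hcl))
        ((mul_eq_zero.1 hft).resolve_left hD)))

/-- The diagonals of a convex quadrilateral meet. -/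
theorem segment_inter_of_convex_quadrilateral {a b c d : ℝ × ℝ} (h1 : 0 < cross a b c)
    (h2 : 0 < cross b c d) (h3 : 0 < cross a c d) (h4 : 0 < cross a b d) :
    (segment ℝ a c ∩ segment ℝ b d).Nonempty := by
  have hs1 : 0 < cross a c d + cross a b c := by linarith
  have hs : cross b c d + cross a b d = cross a c d + cross a b c := by unfold cross; ring
  have hs0 := hs1.ne'
  refine ⟨(cross b c d / (cross a c d + cross a b c)) • a +
    (cross a b d / (cross a c d + cross a b c)) • c, ⟨_, _, by positivity, by positivity, ?_, rfl⟩,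
    cross a c d / (cross a c d + cross a b c), cross a b c / (cross a c d + cross a b c),
    by positivity, by positivity, ?_, ?_⟩
  · rw [← add_div, hs, div_self hs0]
  · rw [← add_div, div_self hs0]
  · have e1 : cross a c d * b.1 + cross a b c * d.1 = cross b c d * a.1 + cross a b d * c.1 := by
      unfold cross; ring
    have e2 : cross a c d * b.2 + cross a b c * d.2 = cross b c d * a.2 + cross a b d * c.2 := by
      unfold cross; ring
    ext
    · simp only [Prod.fst_add, Prod.smul_fst, smul_eq_mul]; field_simp; linarith
    · simp only [Prod.snd_add, Prod.smul_snd, smul_eq_mul]; field_simp; linarith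

/-! ### Straight-line triangulations of a convex polygon in the plane -/

/-- The space of straight-line triangulations of `Ω` with boundary values `φ`. -/
def PlaneTriangulations {n : ℕ} [NeZero n] (Ω : Set (ℝ × ℝ)) (φ : Fin n → ℝ × ℝ) {V : Type*}
    [Fintype V] [DecidableEq V] (T : DiskTriangulation V n) : Set (V → ℝ × ℝ) :=
  {p | (∀ v, p v ∈ Ω) ∧ (∀ i, p (T.bd i) = φ i) ∧ Function.Injective p ∧
    ∀ u v x y, T.Adj u v → T.Adj x y → s(u, v) ≠ s(x, y) →
      segment ℝ (p u) (p v) ∩ segment ℝ (p x) (p y) ⊆ p '' ({u, v} ∩ {x, y})}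

/-- The properties of a convex polygon `Ω` with corners `φ` that are used below. -/
structure IsPlanePolygon {n : ℕ} [NeZero n] (Ω : Set (ℝ × ℝ)) (φ : Fin n → ℝ × ℝ) : Prop where
  convex : Convex ℝ Ω
  mem : ∀ i, φ i ∈ Ω
  injective : Function.Injective φ
  strict : IsStrictPolygon φ
  extreme : ∀ i, ∀ x ∈ Ω, ∀ y ∈ Ω, φ i ∈ segment ℝ x y → φ i = x ∨ φ i = y

namespace DiskTriangulation

variable {V : Type*} [Fintype V] [DecidableEq V] {n : ℕ} [NeZero n] {T : DiskTriangulation V n}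
  {p : V → ℝ × ℝ} {φ : Fin n → ℝ × ℝ} {w : V → V → ℝ} {Ω : Set (ℝ × ℝ)}

/-- Tutte's theorem: a convex combination map onto a convex polygon is a straight-line
triangulation. -/
theorem tutteMap_mem (hΩ : IsPlanePolygon Ω φ) (hw : ∀ v u, 0 < w v u) :
    T.tutteMap φ w ∈ PlaneTriangulations Ω φ T := by
  have hbal := isBalanced_tutteMap (T := T) (φ := φ) hw
  have hbd : ∀ i, T.tutteMap φ w (T.bd i) = φ i := fun i => tutteMap_bd hw i
  have htil := hbal.isTiling hw hΩ.strict hbd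
  refine ⟨fun v => convexHull_min (Set.range_subset_iff.2 hΩ.mem) hΩ.convex
    (hbal.mem_convexHull hw hbd v), hbd, htil.injective hΩ.strict hΩ.injective,
    fun u v x y huv hxy hne => htil.segment_inter hΩ.strict hΩ.injective huv hxy hne⟩

/-- Removing the vertices of a triangle leaves no component without boundary vertices. This is a
combinatorial fact; it is proved by moving outwards in a convex combination map. -/
theorem exists_bd_mem_of_closed (hφ : IsStrictPolygon φ) {a b c : V} (hf : {a, b, c} ∈ T.faces)
    {S : Set V} (hne : S.Nonempty) (hS : ∀ v ∈ S, v ∉ ({a, b, c} : Finset V))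
    (hcl : ∀ v ∈ S, ∀ u, T.Adj v u → u ∉ ({a, b, c} : Finset V) → u ∈ S) :
    ∃ i, T.bd i ∈ S := by
  by_contra! hbdS
  have hint : ∀ v ∈ S, T.IsInterior v := fun v hv i hi => hbdS i (hi ▸ hv)
  have hw : ∀ v u : V, 0 < (fun _ _ => 1 : V → V → ℝ) v u := fun _ _ => one_pos
  have hbal := isBalanced_tutteMap (T := T) (φ := φ) hw
  have hp := hbal.isTiling hw hφ fun i => tutteMap_bd hw i
  set p := T.tutteMap φ (fun _ _ => 1)
  obtain ⟨v, hv⟩ := hne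
  have hD2 := mul_self_pos.2 (hp.nondeg hf)
  -- a side of the triangle that separates it from `p v`
  obtain ⟨x, y, hneg, hnn⟩ : ∃ x y : ℝ × ℝ, cross (p a) (p b) (p c) * cross x y (p v) < 0 ∧
      ∀ u ∈ ({a, b, c} : Finset V), 0 ≤ cross (p a) (p b) (p c) * cross x y (p u) := by
    by_contra! hcon
    refine hS v hv (hp.mem_of_interior hφ (hint v hv) hf ?_)
    refine ⟨?_, ?_, ?_⟩ <;> by_contra hlt <;>
      obtain ⟨u, hu, hu'⟩ := hcon _ _ (not_le.1 hlt) <;>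
      simp only [Finset.mem_insert, Finset.mem_singleton] at hu <;>
      rcases hu with rfl | rfl | rfl
    · simp at hu'
    · simp at hu'
    · exact absurd hu' hD2.le.not_gt
    · rw [cross_rotate (p u)] at hu'; exact absurd hu' hD2.le.not_gt
    · simp at hu'
    · simp at hu'
    · simp at hu'
    · rw [← cross_rotate (p c) (p a) (p u)] at hu'; exact absurd hu' hD2.le.not_gt
    · simp at hu'
  let h : V → ℝ := fun u => - (cross (p a) (p b) (p c) * cross x y (p u))
  have hh : T.IsHarmonic (fun _ _ => 1) h := by
    have := hbal.affine (cross (p a) (p b) (p c) * (y.2 - x.2))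
      (- (cross (p a) (p b) (p c) * (y.1 - x.1)))
      (cross (p a) (p b) (p c) * ((y.1 - x.1) * x.2 - (y.2 - x.2) * x.1))
    convert this using 2 with u
    simp only [h]
    unfold cross
    ring
  obtain ⟨m, hmS, hm⟩ := Set.exists_max_image S h (Set.toFinite S) ⟨v, hv⟩
  have hpos : 0 < h m := lt_of_lt_of_le (neg_pos.2 hneg) (hm v hv)
  have hout : ∀ u, 0 < h u → u ∉ ({a, b, c} : Finset V) := fun u hu hmem =>
    (neg_pos.1 hu).not_ge (hnn u hmem)
  have hcl' := eq_univ_of_closed (T := T) (S := {u | u ∈ S ∧ h u = h m}) ⟨m, hmS, rfl⟩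
    (fun s hs u hu => by
      have hle : ∀ u, T.Adj s u → h u ≤ h s := fun u hu => by
        rw [hs.2]
        by_contra hlt
        push Not at hlt
        exact hlt.not_ge (hm u (hcl s hs.1 u hu (hout u (hpos.trans hlt))))
      have heq := hh.eq_of_le hw (hint s hs.1) hle hu
      rw [hs.2] at heq
      exact ⟨hcl s hs.1 u hu (hout u (heq ▸ hpos)), heq⟩) (T.bd 0)
  exact hbdS 0 hcl'.1

theorem notMem_edge (hp : p ∈ PlaneTriangulations Ω φ T) {u v x : V} (huv : T.Adj u v)
    (hxu : x ≠ u) (hxv : x ≠ v) : p x ∉ segment ℝ (p u) (p v) := by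
  intro hx
  obtain ⟨y, hxy⟩ := T.exists_adj x
  have hne : s(u, v) ≠ s(x, y) := fun h => by
    have : x ∈ s(u, v) := by rw [h]; exact Sym2.mem_mk_left x y
    rcases Sym2.mem_iff.1 this with h | h
    exacts [hxu h, hxv h]
  obtain ⟨r, hr, hrx⟩ := hp.2.2.2 u v x y huv hxy hne ⟨hx, left_mem_segment _ _ _⟩
  rw [hp.2.2.1 hrx] at hr
  rcases hr.1 with h | h
  exacts [hxu h, hxv h]

theorem disjoint_edges (hp : p ∈ PlaneTriangulations Ω φ T) {u v x y : V} (huv : T.Adj u v)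
    (hxy : T.Adj x y) (h1 : u ≠ x) (h2 : u ≠ y) (h3 : v ≠ x) (h4 : v ≠ y) {z : ℝ × ℝ}
    (hz : z ∈ segment ℝ (p u) (p v)) (hz' : z ∈ segment ℝ (p x) (p y)) : False := by
  have hne : s(u, v) ≠ s(x, y) := fun h => by
    have : u ∈ s(x, y) := by rw [← h]; exact Sym2.mem_mk_left u v
    rcases Sym2.mem_iff.1 this with h | h
    exacts [h1 h, h2 h]
  obtain ⟨r, ⟨hr1, hr2⟩, -⟩ := hp.2.2.2 u v x y huv hxy hne ⟨hz, hz'⟩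
  rcases hr1 with rfl | rfl <;> rcases hr2 with rfl | rfl
  exacts [h1 rfl, h2 rfl, h3 rfl, h4 rfl]

theorem cross_ne_zero_of_mem (hp : p ∈ PlaneTriangulations Ω φ T) {a b c : V}
    (hf : {a, b, c} ∈ T.faces) : cross (p a) (p b) (p c) ≠ 0 := by
  intro h0
  obtain ⟨hab, hac, hbc⟩ := face_ne hf
  rcases mem_segment_of_collinear h0 with h | h | h
  · exact notMem_edge hp (adj_of_mem hf (by simp) (by simp) hbc) hab hac h
  · exact notMem_edge hp (adj_of_mem hf (by simp) (by simp) hac) hab.symm hbc h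
  · exact notMem_edge hp (adj_of_mem hf (by simp) (by simp) hab) hac.symm hbc.symm h

/-- The triangles of a straight-line triangulation contain no further vertices. -/
theorem not_inClosedTri_of_mem (hΩ : IsPlanePolygon Ω φ) (hp : p ∈ PlaneTriangulations Ω φ T)
    {a b c v : V} (hf : {a, b, c} ∈ T.faces) (hv : v ∉ ({a, b, c} : Finset V)) :
    ¬ InClosedTri (p a) (p b) (p c) (p v) := by
  intro hcl
  obtain ⟨hab, hac, hbc⟩ := face_ne hf
  have hadj_ab : T.Adj a b := adj_of_mem hf (by simp) (by simp) hab
  have hadj_bc : T.Adj b c := adj_of_mem hf (by simp) (by simp) hbc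
  have hadj_ca : T.Adj c a := adj_of_mem hf (by simp) (by simp) hac.symm
  have hD := cross_ne_zero_of_mem hp hf
  have hnot : ∀ {v}, v ∉ ({a, b, c} : Finset V) → v ≠ a ∧ v ≠ b ∧ v ≠ c := fun {v} hv => by
    simpa [not_or] using hv
  obtain ⟨i, hi, hicl⟩ := exists_bd_mem_of_closed hΩ.strict hf
    (S := {v | v ∉ ({a, b, c} : Finset V) ∧ InClosedTri (p a) (p b) (p c) (p v)}) ⟨v, hv, hcl⟩
    (fun v hv => hv.1) (fun v hv u hvu hu => ⟨hu, by
      obtain ⟨hva, hvb, hvc⟩ := hnot hv.1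
      obtain ⟨hua, hub, huc⟩ := hnot hu
      have hlt : ∀ {r : ℝ}, 0 ≤ cross (p a) (p b) (p c) * r → r ≠ 0 →
          0 < cross (p a) (p b) (p c) * r := fun hr hr0 =>
        lt_of_le_of_ne hr (mul_ne_zero hD hr0).symm
      have h1 := hv.2
      have h2 : InClosedTri (p b) (p c) (p a) (p v) :=
        ⟨by rw [cross_rotate (p a)]; exact h1.2.1, by rw [cross_rotate (p a)]; exact h1.2.2,
          by rw [cross_rotate (p a)]; exact h1.1⟩
      have h3 : InClosedTri (p c) (p a) (p b) (p v) :=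
        ⟨by rw [cross_rotate (p b)]; exact h2.2.1, by rw [cross_rotate (p b)]; exact h2.2.2,
          by rw [cross_rotate (p b)]; exact h2.1⟩
      have hin : InTri (p a) (p b) (p c) (p v) := by
        refine ⟨hlt hv.2.1 fun h0 => notMem_edge hp hadj_ab hva hvb
          (mem_segment_of_cross_eq_zero hD h1 h0), hlt hv.2.2.1 fun h0 =>
          notMem_edge hp hadj_bc hvb hvc (mem_segment_of_cross_eq_zero ?_ h2 h0), hlt hv.2.2.2
          fun h0 => notMem_edge hp hadj_ca hvc hva (mem_segment_of_cross_eq_zero ?_ h3 h0)⟩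
        · rwa [cross_rotate (p a)]
        · rwa [cross_rotate (p b), cross_rotate (p a)]
      by_contra hout
      obtain ⟨y, hy, hside⟩ := hin.exists_mem_side hD hout
      rcases hside with hs | hs | hs
      · exact disjoint_edges hp hvu hadj_ab hva hvb hua hub hy hs
      · exact disjoint_edges hp hvu hadj_bc hvb hvc hub huc hy hs
      · exact disjoint_edges hp hvu hadj_ca hvc hva huc hua hy hs⟩)
  obtain ⟨hia, hib, hic⟩ := hnot hi
  obtain ⟨y, hy, hiy⟩ := hicl.exists_segment hD
  have hyΩ : y ∈ Ω := hΩ.convex.segment_subset (hp.1 b) (hp.1 c) hy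
  have := hΩ.extreme i (p a) (hp.1 a) y hyΩ (by rwa [← hp.2.1 i])
  rw [← hp.2.1 i] at this
  rcases this with h | h
  · exact hia (hp.2.2.1 h)
  · rw [← h] at hy
    exact notMem_edge hp hadj_bc hib hic hy

/-- In a straight-line triangulation, the two triangles at an edge lie on different sides. -/
theorem isUnfolded_of_mem (hΩ : IsPlanePolygon Ω φ) (hp : p ∈ PlaneTriangulations Ω φ T) :
    T.IsUnfolded p := by
  refine ⟨cross_ne_zero_of_mem hp, ?_⟩
  -- on the same side, either a vertex lies in the other triangle or two sides cross
  have key : ∀ {a b c d : V}, {a, b, c} ∈ T.faces → {a, b, d} ∈ T.faces → c ≠ d →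
      0 < cross (p a) (p b) (p c) → 0 < cross (p a) (p b) (p d) →
      ¬ 0 ≤ cross (p a) (p c) (p d) := by
    intro a b c d hc hd hcd h1 h2 h3
    obtain ⟨hab, hac, hbc⟩ := face_ne hc
    obtain ⟨-, had, hbd⟩ := face_ne hd
    have hadj_ac : T.Adj a c := adj_of_mem hc (by simp) (by simp) hac
    have hadj_ad : T.Adj a d := adj_of_mem hd (by simp) (by simp) had
    have hadj_bd : T.Adj b d := adj_of_mem hd (by simp) (by simp) hbd
    have hout : ¬ InClosedTri (p a) (p b) (p d) (p c) :=
      not_inClosedTri_of_mem hΩ hp hd (by simp [hac.symm, hbc.symm, hcd])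
    have h4 : 0 < cross (p b) (p c) (p d) := by
      by_contra h4
      refine hout ⟨(mul_pos h2 h1).le, mul_nonneg h2.le ?_, mul_nonneg h2.le ?_⟩
      · rw [cross_swap]; linarith
      · rwa [← cross_rotate (p d) (p a) (p c)]
    rcases h3.lt_or_eq with h3 | h3
    · obtain ⟨z, hz1, hz2⟩ := segment_inter_of_convex_quadrilateral h1 h4 h3 h2
      exact disjoint_edges hp hadj_ac hadj_bd hab had hbc.symm hcd hz1 hz2
    · rcases mem_segment_of_collinear h3.symm with h | h | h
      · -- `a` is not between `c` and `d`, which lie on the same side of the line `ab`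
        obtain ⟨s, t, hs, ht, hst, h⟩ := h
        have h5 := cross_combo (p a) (p b) (p c) (p d) s t hst
        rw [h, cross_self_outer] at h5
        rcases hs.eq_or_lt with rfl | hs
        · have : t = 1 := by linarith
          subst this; linarith
        · have := mul_pos hs h1
          have := mul_nonneg ht h2.le
          linarith
      · exact notMem_edge hp hadj_ad hac.symm hcd h
      · exact notMem_edge hp hadj_ac had.symm hcd.symm h
  have key2 : ∀ {a b c d : V}, {a, b, c} ∈ T.faces → {a, b, d} ∈ T.faces → c ≠ d →
      0 < cross (p a) (p b) (p c) → 0 < cross (p a) (p b) (p d) → False := by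
    intro a b c d hc hd hcd h1 h2
    refine key hc hd hcd h1 h2 ?_
    have := key hd hc hcd.symm h2 h1
    rw [cross_swap]; linarith
  intro a b c d hc hd hcd
  rcases lt_or_gt_of_ne (cross_ne_zero_of_mem hp hc) with h1 | h1 <;>
    rcases lt_or_gt_of_ne (cross_ne_zero_of_mem hp hd) with h2 | h2
  · exfalso
    refine key2 (a := b) (b := a) ?_ ?_ hcd (by rw [cross_swap_left]; linarith)
      (by rw [cross_swap_left]; linarith)
    · rwa [Finset.insert_comm]
    · rwa [Finset.insert_comm]
  · exact mul_neg_of_neg_of_pos h1 h2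
  · exact mul_neg_of_pos_of_neg h1 h2
  · exact (key2 hc hd hcd h1 h2).elim

/-- An interior vertex of an unfolded map is a convex combination of all its neighbours: the
vector opposite to each edge at `v` lies in the cone of some triangle at `v`; the sum of these
relations involves all neighbours. -/
theorem IsUnfolded.exists_weights (hp : T.IsUnfolded p) {v : V} (hv : T.IsInterior v) :
    ∃ c : V → ℝ, (∀ u, 0 < c u) ∧ ∑ u ∈ T.neighbors v, c u • (p u - p v) = 0 := by
  have hcone : ∀ u, ∃ x y : V, ∃ α β : ℝ, 0 ≤ α ∧ 0 ≤ β ∧ T.Adj v x ∧ T.Adj v y ∧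
      α • (p x - p v) + β • (p y - p v) = - (p u - p v) := by
    intro u
    obtain ⟨x, y, hf, h1, h2⟩ := hp.exists_cone hv (p v - (p u - p v))
    have hD := hp.nondeg hf
    have hD2 := mul_self_pos.2 hD
    obtain ⟨hvx, hvy, hxy⟩ := face_ne hf
    set z := p v - (p u - p v) with hz
    have hz1 : z.1 = (p v).1 - ((p u).1 - (p v).1) := rfl
    have hz2 : z.2 = (p v).2 - ((p u).2 - (p v).2) := rfl
    refine ⟨x, y, cross (p y) (p v) z / cross (p v) (p x) (p y),
      cross (p v) (p x) z / cross (p v) (p x) (p y), ?_, ?_,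
      adj_of_mem hf (by simp) (by simp) hvx, adj_of_mem hf (by simp) (by simp) hvy, ?_⟩
    · rw [← mul_div_mul_left _ _ hD]; exact div_nonneg h2 hD2.le
    · rw [← mul_div_mul_left _ _ hD]; exact div_nonneg h1 hD2.le
    · ext
      · simp only [Prod.fst_add, Prod.smul_fst, Prod.fst_sub, Prod.fst_neg, smul_eq_mul]
        field_simp
        unfold cross
        rw [hz1, hz2]
        ring
      · simp only [Prod.snd_add, Prod.smul_snd, Prod.snd_sub, Prod.snd_neg, smul_eq_mul]
        field_simp
        unfold cross
        rw [hz1, hz2]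
        ring
  choose x y α β hα hβ hx hy h using hcone
  refine ⟨fun r => 1 + ∑ u ∈ T.neighbors v, ((if r = x u then α u else 0) +
    (if r = y u then β u else 0)), fun r => ?_, ?_⟩
  · have : 0 ≤ ∑ u ∈ T.neighbors v, ((if r = x u then α u else 0) +
        (if r = y u then β u else 0)) :=
      Finset.sum_nonneg fun u _ => add_nonneg (by split_ifs; exacts [hα u, le_rfl])
        (by split_ifs; exacts [hβ u, le_rfl])
    linarith
  · simp only [add_smul, one_smul, Finset.sum_add_distrib, Finset.sum_smul]
    rw [Finset.sum_comm, Finset.sum_comm (t := T.neighbors v) (f := fun r u =>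
      (if r = y u then β u else 0) • (p r - p v))]
    have e1 : ∀ u, ∑ r ∈ T.neighbors v, (if r = x u then α u else 0) • (p r - p v) =
        α u • (p (x u) - p v) := fun u => by
      simp only [ite_smul, zero_smul, Finset.sum_ite_eq', mem_neighbors, hx u, if_true]
    have e2 : ∀ u, ∑ r ∈ T.neighbors v, (if r = y u then β u else 0) • (p r - p v) =
        β u • (p (y u) - p v) := fun u => by
      simp only [ite_smul, zero_smul, Finset.sum_ite_eq', mem_neighbors, hy u, if_true]
    simp only [e1, e2]
    rw [← Finset.sum_add_distrib, ← Finset.sum_add_distrib]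
    exact Finset.sum_eq_zero fun u _ => by rw [h u, add_neg_cancel]

/-- The converse of Tutte's theorem: every straight-line triangulation is a convex combination
map. -/
theorem exists_isBalanced_of_mem (hΩ : IsPlanePolygon Ω φ)
    (hp : p ∈ PlaneTriangulations Ω φ T) :
    ∃ w : V → V → ℝ, (∀ v u, 0 < w v u) ∧ T.IsBalanced w p := by
  have h : ∀ v, ∃ c : V → ℝ, (∀ u, 0 < c u) ∧
      (T.IsInterior v → ∑ u ∈ T.neighbors v, c u • (p u - p v) = 0) := by
    intro v
    by_cases hv : T.IsInterior v
    · obtain ⟨c, hc, hc'⟩ := (isUnfolded_of_mem hΩ hp).exists_weights hv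
      exact ⟨c, hc, fun _ => hc'⟩
    · exact ⟨fun _ => 1, fun _ => one_pos, fun h => absurd h hv⟩
  choose w hw hw' using h
  exact ⟨w, hw, hw'⟩

end DiskTriangulation

/-! ### The space of straight-line triangulations is a retract of the space of weights -/

theorem convex_positive_weights {V : Type*} : Convex ℝ {w : V → V → ℝ | ∀ v u, 0 < w v u} := by
  intro w hw w' hw' a b ha hb hab v u
  simp only [Pi.add_apply, Pi.smul_apply, smul_eq_mul]
  rcases ha.eq_or_lt with rfl | ha
  · obtain rfl : b = 1 := by linarith
    simpa using hw' v u
  · exact add_pos_of_pos_of_nonneg (mul_pos ha (hw v u)) (mul_nonneg hb (hw' v u).le)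

/-- A retract of a contractible space is contractible. -/
theorem ContractibleSpace.of_retract {X Y : Type*} [TopologicalSpace X]
    [TopologicalSpace Y] [ContractibleSpace Y] (s : C(X, Y)) (r : C(Y, X))
    (h : ∀ x, r (s x) = x) : ContractibleSpace X := by
  rw [contractible_iff_id_nullhomotopic]
  have h1 : ContinuousMap.id X = (r.comp (ContinuousMap.id Y)).comp s := by
    ext x; simp [h]
  rw [h1]
  exact ((id_nullhomotopic Y).comp_right r).comp_left s

namespace DiskTriangulation

variable {V : Type*} [Fintype V] [DecidableEq V] {n : ℕ} [NeZero n] {T : DiskTriangulation V n}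
  {φ : Fin n → ℝ × ℝ} {Ω : Set (ℝ × ℝ)}

/-- Weights that balance one triangulation can be continued to weights that balance all nearby
triangulations, by changing only the weights of two independent edges at each interior vertex. -/
theorem exists_local_weights (hΩ : IsPlanePolygon Ω φ) (p₀ : PlaneTriangulations Ω φ T) :
    ∃ U ∈ 𝓝 p₀, ∃ g : PlaneTriangulations Ω φ T → V → V → ℝ, ContinuousOn g U ∧
      ∀ p ∈ U, g p ∈ {w | (∀ v u, 0 < w v u) ∧ T.IsBalanced w p.1} := by
  classical
  obtain ⟨w, hw, hbal⟩ := exists_isBalanced_of_mem hΩ p₀.2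
  have hface : ∀ v, ∃ x y, {v, x, y} ∈ T.faces := fun v => by
    obtain ⟨f, hf, hv⟩ := T.exists_face v
    obtain ⟨x, y, rfl⟩ := exists_eq_insert hf hv
    exact ⟨x, y, hf⟩
  choose x y hf using hface
  -- the defect of the weights `w`, in the basis given by the two edges
  let E : PlaneTriangulations Ω φ T → V → ℝ × ℝ := fun p v =>
    ∑ u ∈ T.neighbors v, w v u • (p.1 u - p.1 v)
  let D : PlaneTriangulations Ω φ T → V → ℝ := fun p v =>
    cross (p.1 v) (p.1 (x v)) (p.1 (y v))
  let e₁ : PlaneTriangulations Ω φ T → V → ℝ := fun p v =>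
    ((E p v).1 * ((p.1 (y v)).2 - (p.1 v).2) - (E p v).2 * ((p.1 (y v)).1 - (p.1 v).1)) / D p v
  let e₂ : PlaneTriangulations Ω φ T → V → ℝ := fun p v =>
    (((p.1 (x v)).1 - (p.1 v).1) * (E p v).2 - ((p.1 (x v)).2 - (p.1 v).2) * (E p v).1) / D p v
  let g : PlaneTriangulations Ω φ T → V → V → ℝ := fun p v u =>
    if T.IsInterior v then w v u - (if u = x v then e₁ p v else 0) -
      (if u = y v then e₂ p v else 0) else w v u
  have hp : ∀ v, Continuous fun p : PlaneTriangulations Ω φ T => p.1 v := fun v =>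
    (continuous_apply v).comp continuous_subtype_val
  have hD0 : ∀ p v, D p v ≠ 0 := fun p v => cross_ne_zero_of_mem p.2 (hf v)
  have hD : ∀ v, Continuous fun p => D p v := fun v => continuous_cross (hp _) (hp _) (hp _)
  have hE : ∀ v, Continuous fun p => E p v := fun v =>
    continuous_finsetSum _ fun u _ => ((hp u).sub (hp v)).const_smul (w v u)
  have he₁ : ∀ v, Continuous fun p => e₁ p v := fun v => by
    exact (((hE v).fst.mul ((hp (y v)).snd.sub (hp v).snd)).sub
      ((hE v).snd.mul ((hp (y v)).fst.sub (hp v).fst))).div (hD v) (fun p => hD0 p v)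
  have he₂ : ∀ v, Continuous fun p => e₂ p v := fun v => by
    exact ((((hp (x v)).fst.sub (hp v).fst).mul (hE v).snd).sub
      (((hp (x v)).snd.sub (hp v).snd).mul (hE v).fst)).div (hD v) (fun p => hD0 p v)
  have hg : ∀ v u, Continuous fun p => g p v u := fun v u => by
    have h1 := he₁ v
    have h2 := he₂ v
    simp only [g]
    split_ifs <;> fun_prop
  have hg₀ : ∀ v u, g p₀ v u = w v u := fun v u => by
    by_cases hv : T.IsInterior v
    · have h0 : E p₀ v = 0 := hbal v hv
      simp [g, e₁, e₂, h0]
    · simp [g, hv]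
  refine ⟨{p | ∀ v u, 0 < g p v u}, ?_, g,
    (continuous_pi fun v => continuous_pi fun u => hg v u).continuousOn, fun p hp => ⟨hp, ?_⟩⟩
  · refine Filter.eventually_all.2 fun v => Filter.eventually_all.2 fun u => ?_
    exact ((hg v u).tendsto p₀).eventually_const_lt (by rw [hg₀]; exact hw v u)
  · intro v hv
    obtain ⟨hvx, hvy, hxy⟩ := face_ne (hf v)
    have hx : x v ∈ T.neighbors v := mem_neighbors.2 (adj_of_mem (hf v) (by simp) (by simp) hvx)
    have hy : y v ∈ T.neighbors v := mem_neighbors.2 (adj_of_mem (hf v) (by simp) (by simp) hvy)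
    simp only [g, if_pos hv, sub_smul, ite_smul, zero_smul, Finset.sum_sub_distrib,
      Finset.sum_ite_eq', hx, hy, if_true]
    have hDv := hD0 p v
    change E p v - e₁ p v • (p.1 (x v) - p.1 v) - e₂ p v • (p.1 (y v) - p.1 v) = 0
    have hDdef : D p v = ((p.1 (x v)).1 - (p.1 v).1) * ((p.1 (y v)).2 - (p.1 v).2) -
      ((p.1 (x v)).2 - (p.1 v).2) * ((p.1 (y v)).1 - (p.1 v).1) := rfl
    ext
    · simp only [Prod.fst_sub, Prod.smul_fst, smul_eq_mul, Prod.fst_zero, e₁, e₂]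
      field_simp
      rw [hDdef]
      ring
    · simp only [Prod.snd_sub, Prod.smul_snd, smul_eq_mul, Prod.snd_zero, e₁, e₂]
      field_simp
      rw [hDdef]
      ring

theorem convex_balancing_weights (p : V → ℝ × ℝ) :
    Convex ℝ {w : V → V → ℝ | (∀ v u, 0 < w v u) ∧ T.IsBalanced w p} := by
  rintro w ⟨hw, hwb⟩ w' ⟨hw', hwb'⟩ a b ha hb hab
  refine ⟨fun v u => ?_, fun v hv => ?_⟩
  · simp only [Pi.add_apply, Pi.smul_apply, smul_eq_mul]
    rcases ha.eq_or_lt with rfl | ha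
    · obtain rfl : b = 1 := by linarith
      simpa using hw' v u
    · exact add_pos_of_pos_of_nonneg (mul_pos ha (hw v u)) (mul_nonneg hb (hw' v u).le)
  · have h1 := hwb v hv
    have h2 := hwb' v hv
    simp only [Pi.add_apply, Pi.smul_apply, add_smul, Finset.sum_add_distrib, smul_assoc]
    rw [← Finset.smul_sum, ← Finset.smul_sum, h1, h2, smul_zero, smul_zero, add_zero]

/-- `tutteMap` retracts the convex set of positive weights onto the space of straight-line
triangulations, embedded by a continuous choice of weights. -/
theorem contractibleSpace_planeTriangulations (hΩ : IsPlanePolygon Ω φ) :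
    ContractibleSpace (PlaneTriangulations Ω φ T) := by
  obtain ⟨σ, hσ⟩ := exists_continuous_forall_mem_convex_of_local
    (t := fun p : PlaneTriangulations Ω φ T =>
      {w : V → V → ℝ | (∀ v u, 0 < w v u) ∧ T.IsBalanced w p.1})
    (fun p => convex_balancing_weights p.1) (exists_local_weights hΩ)
  have : ContractibleSpace {w : V → V → ℝ | ∀ v u, 0 < w v u} :=
    convex_positive_weights.contractibleSpace ⟨fun _ _ => 1, fun _ _ => one_pos⟩
  let s : C(PlaneTriangulations Ω φ T, {w : V → V → ℝ | ∀ v u, 0 < w v u}) :=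
    ⟨fun p => ⟨σ p, (hσ p).1⟩, σ.continuous.subtype_mk _⟩
  let r : C({w : V → V → ℝ | ∀ v u, 0 < w v u}, PlaneTriangulations Ω φ T) :=
    ⟨fun w => ⟨T.tutteMap φ w.1, tutteMap_mem hΩ w.2⟩,
      (continuousOn_iff_continuous_domRestrict.1 (continuousOn_tutteMap φ)).subtype_mk _⟩
  exact ContractibleSpace.of_retract s r fun p =>
    Subtype.ext ((hσ p).2.eq_tutteMap (hσ p).1 p.2.2.1).symm

end DiskTriangulation

/-! ### Charts in which geodesics are straight -/

/-- A chart `κ` of a surface whose image is convex and that maps the geodesic segments between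
points of its source to straight segments. -/
structure IsProjectiveChart {M : Type*} [TopologicalSpace M] (d : M → M → ℝ)
    (κ : OpenPartialHomeomorph M (ℝ × ℝ)) : Prop where
  convex : Convex ℝ κ.target
  mem_geodesicSegment_iff : ∀ x ∈ κ.source, ∀ y ∈ κ.source, ∀ z,
    z ∈ geodesicSegment d x y ↔ z ∈ κ.source ∧ κ z ∈ segment ℝ (κ x) (κ y)

theorem IsConvexPolygon.vertex_mem {M : Type*} [TopologicalSpace M] [T2Space M] {d : M → M → ℝ}
    (hd : ∀ x, d x x = 0) {n : ℕ} [NeZero n] {Ω : Set M} {φ : Fin n → M}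
    (hΩ : IsConvexPolygon d Ω φ) (i : Fin n) : φ i ∈ Ω := by
  refine hΩ.isCompact.isClosed.frontier_subset ?_
  rw [hΩ.frontier_eq]
  exact Set.mem_iUnion.2 ⟨i, by simp [geodesicSegment, hd]⟩

/-- In a convex set, the sides between extreme points that meet the boundary of the set have all
other extreme points strictly on one side. -/
theorem IsStrictPolygon.of_notMem_interior {n : ℕ} [NeZero n] (hn : 3 ≤ n) {Ω : Set (ℝ × ℝ)}
    {φ : Fin n → ℝ × ℝ} (hΩ : Convex ℝ Ω) (hmem : ∀ i, φ i ∈ Ω) (hinj : Function.Injective φ)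
    (hext : ∀ i, ∀ x ∈ Ω, ∀ y ∈ Ω, φ i ∈ segment ℝ x y → φ i = x ∨ φ i = y)
    (hside : ∀ i, (1 / 2 : ℝ) • φ i + (1 / 2 : ℝ) • φ (i + 1) ∉ interior Ω) :
    IsStrictPolygon φ := by
  have hsucc : ∀ i : Fin n, i ≠ i + 1 := fun i h =>
    Fin.add_one_add_one_ne_self hn i (by rw [← h, ← h])
  have hne : ∀ i j, j ≠ i → j ≠ i + 1 → cross (φ i) (φ (i + 1)) (φ j) ≠ 0 := by
    intro i j hji hji' h0
    rcases mem_segment_of_collinear h0 with h | h | h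
    · rcases hext _ _ (hmem _) _ (hmem _) h with h | h
      exacts [hsucc i (hinj h), hji (hinj h).symm]
    · rcases hext _ _ (hmem _) _ (hmem _) h with h | h
      exacts [hsucc i (hinj h).symm, hji' (hinj h).symm]
    · rcases hext _ _ (hmem _) _ (hmem _) h with h | h
      exacts [hji (hinj h), hji' (hinj h)]
  have htri : ∀ i j, j ≠ i → j ≠ i + 1 → ∀ z, InClosedTri (φ i) (φ (i + 1)) (φ j) z → z ∈ Ω := by
    intro i j hji hji' z hz
    obtain ⟨y, hy, hzy⟩ := hz.exists_segment (hne i j hji hji')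
    exact hΩ.segment_subset (hmem _) (hΩ.segment_subset (hmem _) (hmem _) hy) hzy
  intro i j k hji hji' hki hki'
  by_contra h
  have hlt : cross (φ i) (φ (i + 1)) (φ j) * cross (φ i) (φ (i + 1)) (φ k) < 0 :=
    lt_of_le_of_ne (not_lt.1 h) (mul_ne_zero (hne i j hji hji') (hne i k hki hki'))
  refine hside i (mem_interior_iff_mem_nhds.2 ?_)
  filter_upwards [eventually_inClosedTri_or hlt (by norm_num) (by norm_num)
    (by norm_num : (1 / 2 : ℝ) + 1 / 2 = 1)] with z hz
  exact hz.elim (htri i j hji hji' z) (htri i k hki hki' z)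

namespace IsProjectiveChart

variable {M : Type*} [TopologicalSpace M] {d : M → M → ℝ} {κ : OpenPartialHomeomorph M (ℝ × ℝ)}
  {n : ℕ} [NeZero n] {Ω : Set M} {φ : Fin n → M}

theorem symm_mem_geodesicSegment (hκ : IsProjectiveChart d κ) {x y : M} (hx : x ∈ κ.source)
    (hy : y ∈ κ.source) {w : ℝ × ℝ} (hw : w ∈ segment ℝ (κ x) (κ y)) :
    w ∈ κ.target ∧ κ.symm w ∈ geodesicSegment d x y := by
  have hwt : w ∈ κ.target := hκ.convex.segment_subset (κ.map_source hx) (κ.map_source hy) hw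
  refine ⟨hwt, (hκ.mem_geodesicSegment_iff x hx y hy _).2 ⟨κ.map_target hwt, ?_⟩⟩
  rwa [κ.right_inv hwt]

/-- The image of a geodesically convex polygon is a convex polygon in the plane. A side cannot
have corners on both sides, since its points would be interior to the polygon. -/
theorem isPlanePolygon [T2Space M] (hκ : IsProjectiveChart d κ) (hd : ∀ x, d x x = 0)
    (hΩ : IsConvexPolygon d Ω φ) (hsub : Ω ⊆ κ.source) :
    IsPlanePolygon (κ '' Ω) (κ ∘ φ) := by
  have hmem := hΩ.vertex_mem hd
  have hconv : Convex ℝ (κ '' Ω) := by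
    refine convex_iff_segment_subset.2 ?_
    rintro _ ⟨x, hx, rfl⟩ _ ⟨y, hy, rfl⟩ w hw
    obtain ⟨hwt, hws⟩ := hκ.symm_mem_geodesicSegment (hsub hx) (hsub hy) hw
    exact ⟨κ.symm w, hΩ.convex x hx y hy hws, κ.right_inv hwt⟩
  have hmem' : ∀ i, (κ ∘ φ) i ∈ κ '' Ω := fun i => ⟨φ i, hmem i, rfl⟩
  have hinj : Function.Injective (κ ∘ φ) := fun i j h =>
    hΩ.injective (κ.injOn (hsub (hmem i)) (hsub (hmem j)) h)
  have hext : ∀ i, ∀ x ∈ κ '' Ω, ∀ y ∈ κ '' Ω, (κ ∘ φ) i ∈ segment ℝ x y →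
      (κ ∘ φ) i = x ∨ (κ ∘ φ) i = y := by
    rintro i _ ⟨x, hx, rfl⟩ _ ⟨y, hy, rfl⟩ h
    have h1 := (hκ.mem_geodesicSegment_iff x (hsub hx) y (hsub hy) (φ i)).2 ⟨hsub (hmem i), h⟩
    exact (hΩ.extreme i x hx y hy h1).imp (congrArg κ) (congrArg κ)
  refine ⟨hconv, hmem', hinj,
    IsStrictPolygon.of_notMem_interior hΩ.three_le hconv hmem' hinj hext fun i hi => ?_, hext⟩
  -- otherwise the midpoint of the side would be an interior point of `Ω` on the frontier
  obtain ⟨hwt, hws⟩ := hκ.symm_mem_geodesicSegment (hsub (hmem i)) (hsub (hmem (i + 1)))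
    (w := (1 / 2 : ℝ) • κ (φ i) + (1 / 2 : ℝ) • κ (φ (i + 1)))
    ⟨1 / 2, 1 / 2, by norm_num, by norm_num, by norm_num, rfl⟩
  have hfr : κ.symm ((1 / 2 : ℝ) • κ (φ i) + (1 / 2 : ℝ) • κ (φ (i + 1))) ∈ frontier Ω := by
    rw [hΩ.frontier_eq]
    exact Set.mem_iUnion.2 ⟨i, hws⟩
  refine hfr.2 (mem_interior.2 ⟨κ.source ∩ κ ⁻¹' interior (κ '' Ω), ?_,
    κ.isOpen_inter_preimage isOpen_interior, κ.map_target hwt, ?_⟩)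
  · rintro z ⟨hz, hz'⟩
    obtain ⟨x, hx, hxz⟩ := interior_subset hz'
    rwa [← κ.injOn (hsub hx) hz hxz]
  · rw [Set.mem_preimage, κ.right_inv hwt]
    exact hi

variable {V : Type*} [Fintype V] [DecidableEq V] {T : DiskTriangulation V n}

theorem comp_mem_planeTriangulations (hκ : IsProjectiveChart d κ) (hsub : Ω ⊆ κ.source)
    {p : V → M} (hp : p ∈ GeodesicTriangulations d Ω φ T) :
    κ ∘ p ∈ PlaneTriangulations (κ '' Ω) (κ ∘ φ) T := by
  obtain ⟨h1, h2, h3, h4⟩ := hp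
  have hs : ∀ v, p v ∈ κ.source := fun v => hsub (h1 v)
  refine ⟨fun v => ⟨p v, h1 v, rfl⟩, fun i => congrArg κ (h2 i),
    fun u v h => h3 (κ.injOn (hs u) (hs v) h), ?_⟩
  rintro u v x y huv hxy hne w ⟨hw, hw'⟩
  obtain ⟨hwt, hws⟩ := hκ.symm_mem_geodesicSegment (hs u) (hs v) hw
  obtain ⟨r, hr, hrw⟩ := h4 u v x y huv hxy hne
    ⟨hws, (hκ.symm_mem_geodesicSegment (hs x) (hs y) hw').2⟩
  exact ⟨r, hr, by rw [Function.comp_apply, hrw, κ.right_inv hwt]⟩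

theorem symm_comp_mem_geodesicTriangulations (hκ : IsProjectiveChart d κ) (hsub : Ω ⊆ κ.source)
    (hφ : ∀ i, φ i ∈ κ.source) {q : V → ℝ × ℝ}
    (hq : q ∈ PlaneTriangulations (κ '' Ω) (κ ∘ φ) T) :
    κ.symm ∘ q ∈ GeodesicTriangulations d Ω φ T := by
  obtain ⟨h1, h2, h3, h4⟩ := hq
  have hmem : ∀ v, κ.symm (q v) ∈ Ω := fun v => by
    obtain ⟨x, hx, hxq⟩ := h1 v
    rwa [← hxq, κ.left_inv (hsub hx)]
  have hinv : ∀ v, κ (κ.symm (q v)) = q v := fun v => by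
    obtain ⟨x, hx, hxq⟩ := h1 v
    rw [← hxq, κ.left_inv (hsub hx)]
  have hseg : ∀ u v z, z ∈ geodesicSegment d (κ.symm (q u)) (κ.symm (q v)) →
      z ∈ κ.source ∧ κ z ∈ segment ℝ (q u) (q v) := fun u v z hz => by
    have := (hκ.mem_geodesicSegment_iff _ (hsub (hmem u)) _ (hsub (hmem v)) z).1 hz
    rwa [hinv, hinv] at this
  refine ⟨hmem, fun i => ?_, fun u v h => h3 ?_, ?_⟩
  · rw [Function.comp_apply, h2, Function.comp_apply, κ.left_inv (hφ i)]
  · rw [← hinv u, ← hinv v]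
    exact congrArg κ h
  · rintro u v x y huv hxy hne z ⟨hz, hz'⟩
    obtain ⟨hzs, hz⟩ := hseg u v z hz
    obtain ⟨r, hr, hrz⟩ := h4 u v x y huv hxy hne ⟨hz, (hseg x y z hz').2⟩
    exact ⟨r, hr, by rw [Function.comp_apply, hrz, κ.left_inv hzs]⟩

/-- A projective chart identifies the geodesic triangulations of `Ω` with the straight-line
triangulations of its image. -/
theorem contractibleSpace_geodesicTriangulations [T2Space M] (hκ : IsProjectiveChart d κ)
    (hd : ∀ x, d x x = 0) (hΩ : IsConvexPolygon d Ω φ) (hsub : Ω ⊆ κ.source) :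
    ContractibleSpace (GeodesicTriangulations d Ω φ T) := by
  have hplane := hκ.isPlanePolygon hd hΩ hsub
  have hφ : ∀ i, φ i ∈ κ.source := fun i => hsub (hΩ.vertex_mem hd i)
  have := DiskTriangulation.contractibleSpace_planeTriangulations (T := T) hplane
  let s : C(GeodesicTriangulations d Ω φ T, PlaneTriangulations (κ '' Ω) (κ ∘ φ) T) :=
    ⟨fun p => ⟨κ ∘ p.1, hκ.comp_mem_planeTriangulations hsub p.2⟩, by
      refine Continuous.subtype_mk (continuous_pi fun v => ?_) _
      exact κ.continuousOn.comp_continuous ((continuous_apply v).comp continuous_subtype_val)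
        fun p => hsub (p.2.1 v)⟩
  let r : C(PlaneTriangulations (κ '' Ω) (κ ∘ φ) T, GeodesicTriangulations d Ω φ T) :=
    ⟨fun q => ⟨κ.symm ∘ q.1, hκ.symm_comp_mem_geodesicTriangulations hsub hφ q.2⟩, by
      refine Continuous.subtype_mk (continuous_pi fun v => ?_) _
      refine κ.symm.continuousOn.comp_continuous
        ((continuous_apply v).comp continuous_subtype_val) fun q => ?_
      obtain ⟨x, hx, hxq⟩ := q.2.1 v
      rw [← hxq]
      exact κ.map_source (hsub hx)⟩
  exact ContractibleSpace.of_retract s r fun p =>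
    Subtype.ext (funext fun v => κ.left_inv (hsub (p.2.1 v)))

end IsProjectiveChart

/-! ### The Klein model of the hyperbolic plane -/

/-- A projective chart of the hyperbolic plane, whose image is the region above a parabola. -/
noncomputable def kleinChart : OpenPartialHomeomorph UpperHalfPlane (ℝ × ℝ) where
  toFun z := (z.re, z.re ^ 2 + z.im ^ 2)
  invFun w := UpperHalfPlane.ofComplex ⟨w.1, √(w.2 - w.1 ^ 2)⟩
  source := Set.univ
  target := {w | w.1 ^ 2 < w.2}
  map_source' z _ := by
    have := pow_pos z.im_pos 2
    simpa using this
  map_target' _ _ := trivial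
  left_inv' z _ := by
    have h : (⟨z.re, √(z.re ^ 2 + z.im ^ 2 - z.re ^ 2)⟩ : ℂ) = (z : ℂ) := by
      rw [add_sub_cancel_left, Real.sqrt_sq z.im_pos.le]
      rfl
    simp only [h, UpperHalfPlane.ofComplex_apply]
  right_inv' w hw := by
    have h : 0 < w.2 - w.1 ^ 2 := sub_pos.2 hw
    rw [UpperHalfPlane.ofComplex_apply_of_im_pos (by simpa using h)]
    refine Prod.ext rfl ?_
    change w.1 ^ 2 + √(w.2 - w.1 ^ 2) ^ 2 = w.2
    rw [Real.sq_sqrt h.le]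
    ring
  open_source := isOpen_univ
  open_target := isOpen_lt (by fun_prop) (by fun_prop)
  continuousOn_toFun := by
    have h1 := UpperHalfPlane.continuous_re
    have h2 := UpperHalfPlane.continuous_im
    exact Continuous.continuousOn (by fun_prop)
  continuousOn_invFun := by
    refine UpperHalfPlane.isEmbedding_coe.continuousOn_iff.2 ?_
    have h : Continuous fun w : ℝ × ℝ => (⟨w.1, √(w.2 - w.1 ^ 2)⟩ : ℂ) :=
      Complex.equivRealProdCLM.symm.continuous.comp
        (f := fun w : ℝ × ℝ => (w.1, √(w.2 - w.1 ^ 2))) (by fun_prop)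
    refine h.continuousOn.congr fun w hw => ?_
    have hw' : 0 < w.2 - w.1 ^ 2 := sub_pos.2 hw
    rw [Function.comp_apply, UpperHalfPlane.ofComplex_apply_of_im_pos (by simpa using hw')]

theorem kleinChart_apply (z : UpperHalfPlane) : kleinChart z = (z.re, z.re ^ 2 + z.im ^ 2) := rfl

/-- The polarization of the quadratic form `t - s ^ 2`, which equals `im z ^ 2` at the image of `z`
in the Klein model. -/
noncomputable def kleinForm (u v : ℝ × ℝ) : ℝ := (u.2 + v.2) / 2 - u.1 * v.1

theorem kleinForm_self (z : UpperHalfPlane) :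
    kleinForm (kleinChart z) (kleinChart z) = z.im ^ 2 := by
  simp only [kleinForm, kleinChart_apply]
  ring

theorem cosh_dist_mul (x y : UpperHalfPlane) : Real.cosh (dist x y) * (x.im * y.im) =
    kleinForm (kleinChart x) (kleinChart y) := by
  have := x.im_pos
  have := y.im_pos
  rw [UpperHalfPlane.cosh_dist']
  simp only [kleinForm, kleinChart_apply]
  field_simp
  ring

/-- Equality in the triangle inequality, squared and expressed by the hyperbolic cosines. -/
theorem add_eq_iff_cosh {a b c : ℝ} (ha : 0 ≤ a) (hb : 0 ≤ b) (hc : 0 ≤ c) : a + b = c ↔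
    Real.cosh a * Real.cosh b ≤ Real.cosh c ∧ (Real.cosh c - Real.cosh a * Real.cosh b) ^ 2 =
      (Real.cosh a ^ 2 - 1) * (Real.cosh b ^ 2 - 1) := by
  have hsa := Real.sinh_nonneg_iff.2 ha
  have hsb := Real.sinh_nonneg_iff.2 hb
  have e : (Real.cosh a ^ 2 - 1) * (Real.cosh b ^ 2 - 1) = (Real.sinh a * Real.sinh b) ^ 2 := by
    rw [Real.cosh_sq, Real.cosh_sq]
    ring
  rw [e]
  constructor
  · rintro rfl
    rw [Real.cosh_add]
    exact ⟨le_add_of_nonneg_right (mul_nonneg hsa hsb), by ring⟩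
  · rintro ⟨h1, h2⟩
    have h3 := (sq_eq_sq₀ (sub_nonneg.2 h1) (mul_nonneg hsa hsb)).1 h2
    refine Real.cosh_strictMonoOn.injOn (add_nonneg ha hb) hc ?_
    rw [Real.cosh_add]
    linarith

/-- The Gram determinant of three vectors for `kleinForm` is a multiple of the square of their
determinant. -/
theorem kleinForm_gram (x y z : ℝ × ℝ) :
    (kleinForm x z ^ 2 - kleinForm x x * kleinForm z z) *
        (kleinForm z y ^ 2 - kleinForm z z * kleinForm y y) -
      (kleinForm x y * kleinForm z z - kleinForm x z * kleinForm z y) ^ 2 =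
      kleinForm z z * (cross x y z ^ 2 / 4) := by
  unfold kleinForm cross
  ring

/-- Being metrically between `x` and `y` means, in the Klein model, being on their line and
satisfying an inequality that singles out the segment. -/
theorem mem_geodesicSegment_hyperbolicDist_iff (x y z : UpperHalfPlane) :
    z ∈ geodesicSegment hyperbolicDist x y ↔
      cross (kleinChart x) (kleinChart y) (kleinChart z) = 0 ∧
        kleinForm (kleinChart x) (kleinChart z) * kleinForm (kleinChart z) (kleinChart y) ≤
          kleinForm (kleinChart x) (kleinChart y) * z.im ^ 2 := by
  have hx := x.im_pos
  have hy := y.im_pos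
  have hz := z.im_pos
  have hgram := kleinForm_gram (kleinChart x) (kleinChart y) (kleinChart z)
  change dist x z + dist z y = dist x y ↔ _
  rw [add_eq_iff_cosh dist_nonneg dist_nonneg dist_nonneg, and_comm]
  simp only [kleinForm_self, ← cosh_dist_mul] at hgram ⊢
  generalize Real.cosh (dist x y) = c at *
  generalize Real.cosh (dist x z) = a at *
  generalize Real.cosh (dist z y) = b at *
  generalize cross (kleinChart x) (kleinChart y) (kleinChart z) = D at *
  have hpos : 0 < x.im * y.im * z.im ^ 2 := by positivity
  refine and_congr ?_ ?_
  · have key : (x.im * y.im * z.im ^ 2) ^ 2 * ((a ^ 2 - 1) * (b ^ 2 - 1) - (c - a * b) ^ 2) =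
        z.im ^ 2 * (D ^ 2 / 4) := by
      rw [← hgram]
      ring
    constructor
    · intro h
      rw [h, sub_self, mul_zero] at key
      have := (mul_eq_zero.1 key.symm).resolve_left (pow_pos hz 2).ne'
      exact pow_eq_zero_iff two_ne_zero |>.1 (by linarith)
    · rintro rfl
      have h0 : (x.im * y.im * z.im ^ 2) ^ 2 * ((a ^ 2 - 1) * (b ^ 2 - 1) - (c - a * b) ^ 2) = 0 :=
        by rw [key]; ring
      linarith [(mul_eq_zero.1 h0).resolve_left (pow_pos hpos 2).ne']
  · have e1 : a * (x.im * z.im) * (b * (z.im * y.im)) = a * b * (x.im * y.im * z.im ^ 2) := by ring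
    have e2 : c * (x.im * y.im) * z.im ^ 2 = c * (x.im * y.im * z.im ^ 2) := by ring
    rw [e1, e2, mul_le_mul_iff_left₀ hpos]

theorem isProjectiveChart_kleinChart : IsProjectiveChart hyperbolicDist kleinChart := by
  refine ⟨?_, fun x _ y _ z => ?_⟩
  · intro u hu v hv a b ha hb hab
    have h1 : u.1 ^ 2 < u.2 := hu
    have h2 : v.1 ^ 2 < v.2 := hv
    change (a * u.1 + b * v.1) ^ 2 < a * u.2 + b * v.2
    obtain rfl : a = 1 - b := by linarith
    have h3 : ((1 - b) * u.1 + b * v.1) ^ 2 =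
        (1 - b) * u.1 ^ 2 + b * v.1 ^ 2 - (1 - b) * b * (u.1 - v.1) ^ 2 := by ring
    have h4 : 0 ≤ (1 - b) * b * (u.1 - v.1) ^ 2 := by positivity
    rcases hb.eq_or_lt with rfl | hb
    · linarith
    · linarith [mul_lt_mul_of_pos_left h2 hb, mul_le_mul_of_nonneg_left h1.le ha]
  · rw [iff_true_intro (show z ∈ kleinChart.source from trivial), true_and]
    by_cases hxy : x = y
    · subst hxy
      rw [segment_same, Set.mem_singleton_iff]
      constructor
      · intro h
        have h' : dist x z + dist z x = dist x x := h
        rw [dist_comm z x, dist_self] at h'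
        rw [dist_eq_zero.1 (by linarith : dist x z = 0)]
      · intro h
        rw [kleinChart.injOn trivial trivial h]
        change dist x x + dist x x = dist x x
        simp
    have hne : kleinChart x ≠ kleinChart y := fun h => hxy (kleinChart.injOn trivial trivial h)
    rw [mem_geodesicSegment_hyperbolicDist_iff, ← kleinForm_self]
    -- the reverse Cauchy-Schwarz inequality
    have hcs : kleinForm (kleinChart x) (kleinChart x) * kleinForm (kleinChart y) (kleinChart y) <
        kleinForm (kleinChart x) (kleinChart y) ^ 2 := by
      have h1 := Real.one_lt_cosh.2 (dist_pos.2 hxy).ne'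
      have h2 : 0 < x.im * y.im := mul_pos x.im_pos y.im_pos
      rw [kleinForm_self, kleinForm_self, ← cosh_dist_mul, ← mul_pow]
      exact pow_lt_pow_left₀ (by nlinarith) h2.le two_ne_zero
    have key : ∀ t : ℝ, kleinForm (kleinChart x) (kleinChart y) *
          kleinForm (kleinChart x + t • (kleinChart y - kleinChart x))
            (kleinChart x + t • (kleinChart y - kleinChart x)) -
        kleinForm (kleinChart x) (kleinChart x + t • (kleinChart y - kleinChart x)) *
          kleinForm (kleinChart x + t • (kleinChart y - kleinChart x)) (kleinChart y) =
        t * (1 - t) * (kleinForm (kleinChart x) (kleinChart y) ^ 2 -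
          kleinForm (kleinChart x) (kleinChart x) * kleinForm (kleinChart y) (kleinChart y)) := by
      intro t
      simp only [kleinForm, Prod.fst_add, Prod.snd_add, Prod.smul_fst, Prod.smul_snd,
        Prod.fst_sub, Prod.snd_sub, smul_eq_mul]
      ring
    rw [segment_eq_image']
    constructor
    · rintro ⟨h1, h2⟩
      obtain ⟨t, ht⟩ := exists_eq_add_smul_of_cross_eq_zero hne h1
      rw [ht] at h2
      have h3 := key t
      have h4 : 0 ≤ t * (1 - t) := by
        by_contra h
        have := mul_neg_of_neg_of_pos (not_le.1 h) (sub_pos.2 hcs)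
        linarith
      exact ⟨t, ⟨by nlinarith, by nlinarith⟩, ht.symm⟩
    · rintro ⟨t, ⟨h0, h1⟩, ht⟩
      have h3 := key t
      simp only at ht
      rw [ht] at h3
      refine ⟨?_, ?_⟩
      · rw [← ht]
        simp only [cross, Prod.fst_add, Prod.snd_add, Prod.smul_fst, Prod.smul_snd,
          Prod.fst_sub, Prod.snd_sub, smul_eq_mul]
        ring
      · have := mul_nonneg (mul_nonneg h0 (sub_nonneg.2 h1)) (sub_pos.2 hcs).le
        linarith

/-! ### The gnomonic projection of a hemisphere -/

namespace Gnomonic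

/-- Three-dimensional Euclidean space. -/
local notation "E³" => EuclideanSpace ℝ (Fin 3)

variable (b : OrthonormalBasis (Fin 3) ℝ E³)

/-- The plane tangent to the sphere at `b 2`, parametrized by `ℝ × ℝ`. -/
noncomputable def lift (w : ℝ × ℝ) : E³ := w.1 • b 0 + w.2 • b 1 + b 2

/-- The central projection to the plane tangent to the sphere at `b 2`. -/
noncomputable def proj (x : E³) : ℝ × ℝ :=
  (inner ℝ (b 0) x / inner ℝ (b 2) x, inner ℝ (b 1) x / inner ℝ (b 2) x)

theorem inner_zero_lift (w : ℝ × ℝ) : inner ℝ (b 0) (lift b w) = w.1 := by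
  simp [lift, inner_add_right, inner_smul_right, orthonormal_iff_ite.1 b.orthonormal]

theorem inner_one_lift (w : ℝ × ℝ) : inner ℝ (b 1) (lift b w) = w.2 := by
  simp [lift, inner_add_right, inner_smul_right, orthonormal_iff_ite.1 b.orthonormal]

theorem inner_two_lift (w : ℝ × ℝ) : inner ℝ (b 2) (lift b w) = 1 := by
  simp [lift, inner_add_right, inner_smul_right, orthonormal_iff_ite.1 b.orthonormal]

theorem lift_ne_zero (w : ℝ × ℝ) : lift b w ≠ 0 := fun h => by
  simpa [h] using inner_two_lift b w

theorem continuous_lift : Continuous (lift b) := by unfold lift; fun_prop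

theorem smul_lift_proj {x : E³} (hx : inner ℝ (b 2) x ≠ 0) :
    inner ℝ (b 2) x • lift b (proj b x) = x := by
  conv_rhs => rw [← b.sum_repr' x, Fin.sum_univ_three]
  rw [lift, smul_add, smul_add, smul_smul, smul_smul, proj, mul_div_cancel₀ _ hx,
    mul_div_cancel₀ _ hx]

theorem proj_smul {r : ℝ} (hr : r ≠ 0) (x : E³) : proj b (r • x) = proj b x := by
  simp only [proj, inner_smul_right, mul_div_mul_left _ _ hr]

theorem proj_lift (w : ℝ × ℝ) : proj b (lift b w) = w := by
  simp [proj, inner_zero_lift, inner_one_lift, inner_two_lift]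

theorem lift_combo (u v : ℝ × ℝ) {s t : ℝ} (h : s + t = 1) :
    lift b (s • u + t • v) = s • lift b u + t • lift b v := by
  obtain rfl : s = 1 - t := by linarith
  simp only [lift, Prod.fst_add, Prod.snd_add, Prod.smul_fst, Prod.smul_snd, smul_eq_mul]
  module

/-- Central projection maps the cone over two points to the segment between their images. -/
theorem mem_span_pair_iff {x y z : E³} (hx : 0 < inner ℝ (b 2) x) (hy : 0 < inner ℝ (b 2) y)
    (hz : z ≠ 0) : z ∈ Submodule.span NNReal {x, y} ↔
      0 < inner ℝ (b 2) z ∧ proj b z ∈ segment ℝ (proj b x) (proj b y) := by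
  have hspan : z ∈ Submodule.span NNReal {x, y} ↔
      ∃ α β : ℝ, 0 ≤ α ∧ 0 ≤ β ∧ α • x + β • y = z := by
    rw [Submodule.mem_span_pair]
    constructor
    · rintro ⟨α, β, h⟩
      exact ⟨α, β, α.coe_nonneg, β.coe_nonneg, h⟩
    · rintro ⟨α, β, hα, hβ, h⟩
      lift α to NNReal using hα
      lift β to NNReal using hβ
      exact ⟨α, β, h⟩
  rw [hspan]
  constructor
  · rintro ⟨α, β, hα, hβ, rfl⟩
    have e : inner ℝ (b 2) (α • x + β • y) = α * inner ℝ (b 2) x + β * inner ℝ (b 2) y := by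
      rw [inner_add_right, inner_smul_right, inner_smul_right]
    have hpos : 0 < α * inner ℝ (b 2) x + β * inner ℝ (b 2) y := by
      rcases hα.eq_or_lt with h1 | h1
      · rcases hβ.eq_or_lt with h2 | h2
        · exact absurd (by rw [← h1, ← h2]; simp) hz
        · exact add_pos_of_nonneg_of_pos (mul_nonneg hα hx.le) (mul_pos h2 hy)
      · exact add_pos_of_pos_of_nonneg (mul_pos h1 hx) (mul_nonneg hβ hy.le)
    refine ⟨e ▸ hpos, _, _, div_nonneg (mul_nonneg hα hx.le) hpos.le,
      div_nonneg (mul_nonneg hβ hy.le) hpos.le, by rw [← add_div, div_self hpos.ne'], ?_⟩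
    have hx' := hx.ne'
    have hy' := hy.ne'
    have hp' := hpos.ne'
    refine Prod.ext ?_ ?_
    · simp only [proj, e, Prod.fst_add, Prod.smul_fst, smul_eq_mul]
      rw [inner_add_right, inner_smul_right, inner_smul_right]
      field_simp
    · simp only [proj, e, Prod.snd_add, Prod.smul_snd, smul_eq_mul]
      rw [inner_add_right, inner_smul_right, inner_smul_right]
      field_simp
  · rintro ⟨hz', s, t, hs, ht, hst, h⟩
    refine ⟨inner ℝ (b 2) z * (s / inner ℝ (b 2) x), inner ℝ (b 2) z * (t / inner ℝ (b 2) y),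
      by positivity, by positivity, ?_⟩
    have hlift : ∀ r u, 0 < inner ℝ (b 2) u →
        (inner ℝ (b 2) z * (r / inner ℝ (b 2) u)) • u =
          inner ℝ (b 2) z • r • lift b (proj b u) := fun r u hu => by
      conv_lhs => arg 2; rw [← smul_lift_proj b hu.ne']
      rw [smul_smul, smul_smul, mul_assoc, div_mul_cancel₀ _ hu.ne']
    rw [hlift s x hx, hlift t y hy, ← smul_add, ← lift_combo b _ _ hst, h,
      smul_lift_proj b hz'.ne']

/-- The central projection of the open hemisphere centred at `b 2`. -/
noncomputable def chart : OpenPartialHomeomorph UnitSphere (ℝ × ℝ) where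
  toFun x := proj b x
  invFun w := ⟨‖lift b w‖⁻¹ • lift b w, by
    rw [mem_sphere_zero_iff_norm, norm_smul, norm_inv, norm_norm,
      inv_mul_cancel₀ (norm_ne_zero_iff.2 (lift_ne_zero b w))]⟩
  source := {x | 0 < inner ℝ (b 2) (x : E³)}
  target := Set.univ
  map_source' _ _ := trivial
  map_target' w _ := by
    have := norm_pos_iff.2 (lift_ne_zero b w)
    change 0 < inner ℝ (b 2) (‖lift b w‖⁻¹ • lift b w)
    rw [inner_smul_right, inner_two_lift, mul_one]
    positivity
  left_inv' x hx := by
    have hx' : 0 < inner ℝ (b 2) (x : E³) := hx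
    refine Subtype.ext ?_
    change ‖lift b (proj b x)‖⁻¹ • lift b (proj b x) = x
    have h := smul_lift_proj b hx'.ne'
    have h1 : inner ℝ (b 2) (x : E³) * ‖lift b (proj b x)‖ = 1 := by
      have h2 := norm_eq_of_mem_sphere x
      rwa [← h, norm_smul, Real.norm_of_nonneg hx'.le] at h2
    rw [← eq_inv_of_mul_eq_one_left h1, h]
  right_inv' w _ := by
    change proj b (‖lift b w‖⁻¹ • lift b w) = w
    rw [proj_smul b (inv_ne_zero (norm_ne_zero_iff.2 (lift_ne_zero b w))), proj_lift]
  open_source := isOpen_lt continuous_const (by fun_prop)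
  open_target := isOpen_univ
  continuousOn_toFun := by
    have h : ∀ i, ContinuousOn (fun x : UnitSphere => inner ℝ (b i) (x : E³))
      {x | 0 < inner ℝ (b 2) (x : E³)} := fun i => Continuous.continuousOn (by fun_prop)
    exact ((h 0).div (h 2) fun x hx => ne_of_gt hx).prodMk
      ((h 1).div (h 2) fun x hx => ne_of_gt hx)
  continuousOn_invFun := by
    refine (Continuous.subtype_mk ?_ _).continuousOn
    exact ((continuous_lift b).norm.inv₀ fun w => norm_ne_zero_iff.2 (lift_ne_zero b w)).smul
      (continuous_lift b)

theorem isProjectiveChart : IsProjectiveChart sphericalDist (chart b) := by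
  refine ⟨convex_univ, fun x hx y hy z => ?_⟩
  have hx' : 0 < inner ℝ (b 2) (x : E³) := hx
  have hy' : 0 < inner ℝ (b 2) (y : E³) := hy
  have hπ : InnerProductGeometry.angle (x : E³) y ≠ Real.pi := fun h => by
    obtain ⟨-, r, hr, hxy⟩ := InnerProductGeometry.angle_eq_pi_iff.1 h
    rw [hxy, inner_smul_right] at hy'
    exact absurd hy' (mul_neg_of_neg_of_pos hr hx').not_gt
  have h := InnerProductGeometry.angle_eq_angle_add_angle_iff (x := (x : E³)) (z := y)
    (ne_zero_of_mem_unit_sphere z)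
  rw [or_iff_right hπ, mem_span_pair_iff b hx' hy' (ne_zero_of_mem_unit_sphere z)] at h
  exact eq_comm.trans h

end Gnomonic

theorem corollary3p6 {V : Type*} [Fintype V] [DecidableEq V] {n : ℕ} [NeZero n]
    (T : DiskTriangulation V n) :
    (∀ (Ω : Set UpperHalfPlane) (φ : Fin n → UpperHalfPlane),
      IsConvexPolygon hyperbolicDist Ω φ →
        ContractibleSpace (GeodesicTriangulations hyperbolicDist Ω φ T)) ∧
    (∀ (Ω : Set UnitSphere) (φ : Fin n → UnitSphere),
      IsConvexPolygon sphericalDist Ω φ → (∃ c, Ω ⊆ openHemisphere c) →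
        ContractibleSpace (GeodesicTriangulations sphericalDist Ω φ T)) := by
  constructor
  · intro Ω φ hΩ
    exact isProjectiveChart_kleinChart.contractibleSpace_geodesicTriangulations
      (fun x => dist_self x) hΩ (Set.subset_univ Ω)
  · rintro Ω φ hΩ ⟨c, hc⟩
    have hortho : Orthonormal ℝ (({2} : Set (Fin 3)).domRestrict
        fun _ => (c : EuclideanSpace ℝ (Fin 3))) :=
      ⟨fun _ => norm_eq_of_mem_sphere c, fun i j hij => absurd (Subsingleton.elim i j) hij⟩
    obtain ⟨b, hb⟩ := hortho.exists_orthonormalBasis_extension_of_card_eq (by simp)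
    refine (Gnomonic.isProjectiveChart b).contractibleSpace_geodesicTriangulations
      (fun x => InnerProductGeometry.angle_self (ne_zero_of_mem_unit_sphere x)) hΩ fun x hx => ?_
    have := hc hx
    rwa [openHemisphere, ← hb 2 rfl] at this
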